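/- **Conventions.** Let $(K,v_0)$ be a field with a Krull valuation (written additively, possibly trivial), with value group $v_0K$ and residue field $Kv_0$. Let $K(x)$ be the rational function field, and let $\mathcal V$ be the set of all extensions $v$ of $v_0$ to $K(x)$, where equivalent valuations are identified. A *closed ball* of radius $\gamma\in v_0K\cup\{\infty\}$ is a set $\{a\in K: v_0(a-c)\ge\gamma\}$, and an *open ball* of radius $\gamma\in v_0K$ is a set $\{a\in K: v_0(a-c)>\gamma\}$, with $c\in K$; a ball remembers its kind and its radius. A ball $B$ is contained in a ball $B'$ if this holds for the sets and moreover the radius of $B'$ is smaller than that of $B$, or the radii are equal and it is not the case that $B$ is closed and $B'$ is open. An *approximation type* $\mathbf A$ over $(K,v_0)$ is either empty or a nonempty set of balls that is linearly ordered by containment and contains every ball that contains one of its members. Write $\mathbf A_\gamma$, $\mathbf A_\gamma^\circ$ for the closed and the open ball of radius $\gamma$ in $\mathbf A$ ($\emptyset$ if there is none), $\operatorname{supp}\mathbf A=\{\gamma:\mathbf A_\gamma\ne\emptyset\}$, and $\bigcap\mathbf A$ for the intersection of all balls in $\mathbf A$ ($=K$ if $\mathbf A=\emptyset$). For an extension $(L,v)$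 of $(K,v_0)$ and $y\in L$, $\operatorname{appr}_v(y,K)$ is the approximation type consisting of all nonempty sets $\{c\in K: v(y-c)\ge\gamma\}$, as closed balls of radius $\gamma\in v_0K\cup\{\infty\}$, and all nonempty sets $\{c\in K: v(y-c)>\gamma\}$, as open balls of radius $\gamma\in v_0K$. $\mathbf A$ is * *trivial* if $\mathbf A=\operatorname{appr}_{v_0}(c,K)$ for some $c\in K$; * *immediate* if $\mathbf A\neq\emptyset$ and $\bigcap\mathbf A=\emptyset$; it is then *transcendental* if for every $f\in K[X]$ there is $\delta\in\operatorname{supp}\mathbf A$ such that $v_0f(c)$ is constant for $c\in\mathbf A_\delta$, and *algebraic* otherwise; * an *algebraic completion type* if it is algebraic immediate with $\operatorname{supp}\mathbf A=v_0K$; * *value-extending* if it is non-trivial, $\mathbf A_\gamma^\circ\ne\emptyset$ for all $\gamma\in\operatorname{supp}\mathbf A$, and $\bigcap\mathbf A\neq\emptyset$; * *residue-extending* if it is non-trivial, for every $c\in K$ there is $\gamma\in\operatorname{supp}\mathbf A$ with $c\in\mathbf A_\gamma\setminus\mathbf A^\circ_\gamma$, and $\bigcap\mathbf A\ne\emptyset$;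 * *pure* if it is transcendental immediate, value-extending or residue-extending; *almost pure* if it is pure or an algebraic completion type. For $v\in\mathcal V$, an element $t\in K(x)^\times$ is *value-transcendental* if $vt$ is not torsion modulo $v_0K$, and *residue-transcendental* if $vt=0$ and its residue $tv$ is transcendental over $Kv_0$. The extension $v$ is *pure* if $d(x-b)$ is value- or residue-transcendental for some $b,d\in K$, or $\operatorname{appr}_v(x,K)$ is transcendental immediate; it is *almost pure* if it is pure or $\operatorname{appr}_v(x,K)$ is an algebraic completion type. It is *immediate* if $vK(x)=v_0K$ and $K(x)v=Kv_0$; *value-transcendental* if $vK(x)/v_0K$ has rational rank $1$ and $K(x)v|Kv_0$ is algebraic; *residue-transcendental* if $K(x)v|Kv_0$ has transcendence degree $1$ and $vK(x)/v_0K$ is torsion. "$v$ is determined by its approximation type" means: if $v'\in\mathcal V$ and $\operatorname{appr}_{v'}(x,K)=\operatorname{appr}_v(x,K)$, then $v'=v$. $(K,v_0)$ *lies dense in its algebraic closure* $\tilde K$ if for some extension $w$ of $v_0$ to $\tilde K$, for all $a\in\tilde K$ and $\alpha\in w\tilde K$ there is $c\in K$ with $w(a-c)>\alpha$. **Theorem.**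 Assume that $K$ is algebraically closed or that $(K,v_0)$ lies dense in its algebraic closure. Then $v\mapsto\operatorname{appr}_v(x,K)$ is a bijection from $\mathcal V$ onto the set of non-trivial approximation types over $(K,v_0)$. Moreover: **(I)** If $K$ is algebraically closed, then $v_0K$ is divisible, every $v\in\mathcal V$ is pure, and every $v\in\mathcal V$ is exactly one of immediate, value-transcendental, residue-transcendental, where: 1. $v$ is immediate if and only if $\operatorname{appr}_v(x,K)$ is immediate; in this case $v$ is determined by its approximation type. 2. $v$ is value-transcendental if and only if $x-b$ is value-transcendental for some $b\in K$, and this holds if and only if $\operatorname{appr}_v(x,K)$ is value-extending; in this case $v$ is determined by its approximation type. 3. $v$ is residue-transcendental if and only if $d(x-b)$ is residue-transcendental for some $b,d\in K$, and this holds if and only if $\operatorname{appr}_v(x,K)$ is residue-extending; in this case $v$ is determined by its approximation type. 4. $v\mapsto\operatorname{appr}_v(x,K)$ is a bijection from the set of pure extensions of $v_0$ to $K(x)$ onto the set of pure approximation types. **(II)** If $(K,v_0)$ lies dense in its algebraic closure, then $v_0K$ is divisible, every $v\in\mathcal V$ is almost pure, and every $v\in\mathcal V$ is exactly one of immediate,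 value-transcendental, residue-transcendental, where: 1. $v$ is immediate if and only if $\operatorname{appr}_v(x,K)$ is transcendental immediate. If $\operatorname{appr}_v(x,K)$ is algebraic immediate, then $v$ is value-transcendental. 2. If $v$ is pure, then $v$ is value-transcendental if and only if $x-b$ is value-transcendental for some $b\in K$. In general, $v$ is value-transcendental if and only if $x-b$ is value-transcendental for some $b\in K$ or $\operatorname{appr}_v(x,K)$ is algebraic immediate. Further, $x-b$ is value-transcendental for some $b\in K$ if and only if $\operatorname{appr}_v(x,K)$ is value-extending. If $v$ is value-transcendental, then it is determined by its approximation type. 3. The statement 3 of (I) holds. 4. $v\mapsto\operatorname{appr}_v(x,K)$ is a bijection from the set of almost pure extensions of $v_0$ to $K(x)$ onto the set of almost pure approximation types. -/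

import Mathlib

/-!
Valuations are written multiplicatively, as in Mathlib: the order is reversed, `0` plays the role
of the value `∞`, and `v a ≤ v b` here is `va ≥ vb` in additive notation.
-/

namespace ApproxType

section Balls

variable {K Γ₀ : Type*} [Field K] [LinearOrderedCommGroupWithZero Γ₀]

/-- The closed ultrametric ball of radius `γ` centered at `c`. -/
def closedBall (v₀ : Valuation K Γ₀) (c : K) (γ : Γ₀) : Set K := {a | v₀ (a - c) ≤ γ}

/-- The open ultrametric ball of radius `γ` centered at `c`. -/
def openBall (v₀ : Valuation K Γ₀) (c : K) (γ : Γ₀) : Set K := {a | v₀ (a - c) < γ}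

/-- Whether a ball is closed or open. -/
inductive BallKind : Type
  | closed
  | opened

/-- An ultrametric ball of `(K, v₀)`, as a ball that remembers its kind and its radius (the same
set of points can be a ball in several ways: when the value group is discrete or trivial, an open
ball is, as a set, also a closed ball of another radius). The radius of a closed ball is an element
of the value group of `K` or `∞`, the radius of an open ball is an element of the value group. -/
structure Ball (v₀ : Valuation K Γ₀) where
  /-- closed or open -/
  kind : BallKind
  /-- the radius -/
  radius : Γ₀
  /-- the set of points of the ball -/
  carrier : Set K
  /-- it is a ball of the given kind and radius -/
  isBall :
    (kind = BallKind.closed ∧ ∃ d c : K, radius = v₀ d ∧ carrier = closedBall v₀ c radius) ∨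
    (kind = BallKind.opened ∧ ∃ d c : K, d ≠ 0 ∧ radius = v₀ d ∧
      carrier = openBall v₀ c radius)

/-- The ball `B` is contained in the ball `B'`: its points lie in `B'`, and `B'` has a larger
radius, or both have the same radius and it is not the case that `B` is closed and `B'` is open. -/
def Ball.Sub {v₀ : Valuation K Γ₀} (B B' : Ball v₀) : Prop :=
  B.carrier ⊆ B'.carrier ∧
    (B.radius < B'.radius ∨
      (B.radius = B'.radius ∧ (B'.kind = BallKind.closed ∨ B.kind = BallKind.opened)))

/-- A nest of balls: a nonempty collection of closed and open balls, linearly ordered by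
inclusion. -/
def IsNest {v₀ : Valuation K Γ₀} (N : Set (Ball v₀)) : Prop :=
  N.Nonempty ∧ ∀ B ∈ N, ∀ B' ∈ N, B.Sub B' ∨ B'.Sub B

/-- A full nest of balls: a nest that consists of all the balls containing some ball of it. -/
def IsFullNest {v₀ : Valuation K Γ₀} (N : Set (Ball v₀)) : Prop :=
  IsNest N ∧ N = {B' | ∃ B ∈ N, B.Sub B'}

/-- An approximation type over `(K, v₀)`: a full nest of balls, or the empty set. -/
structure AType (v₀ : Valuation K Γ₀) where
  /-- the balls of the approximation type -/
  balls : Set (Ball v₀)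
  /-- they form a full nest, or there are none -/
  isFullNest : balls = ∅ ∨ IsFullNest balls

end Balls

section Realization

variable {K L Γ₀ Γ : Type*} [Field K] [Field L] [Algebra K L]
  [LinearOrderedCommGroupWithZero Γ₀] [LinearOrderedCommGroupWithZero Γ]

/-- The intersection with `K` of the closed ball of radius `γ` (in the value group of `K`, or `∞`)
around `x` in `(L, v)`. The value `γ = v₀ d` is viewed in the value group of `L` as the value
of `d`. -/
def apprClosed (v₀ : Valuation K Γ₀) (v : Valuation L Γ) (x : L) (γ : Γ₀) : Set K :=
  {c | ∃ d : K, v₀ d = γ ∧ v (x - algebraMap K L c) ≤ v (algebraMap K L d)}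

/-- The intersection with `K` of the open ball of radius `γ` around `x` in `(L, v)`. -/
def apprOpen (v₀ : Valuation K Γ₀) (v : Valuation L Γ) (x : L) (γ : Γ₀) : Set K :=
  {c | ∃ d : K, v₀ d = γ ∧ v (x - algebraMap K L c) < v (algebraMap K L d)}

/-- The collection of all nonempty intersections with `K` of closed and open balls around `x` in
`(L, v)` (a member of `Ball v₀` is always nonempty). -/
def apprSet (v₀ : Valuation K Γ₀) (v : Valuation L Γ) (x : L) : Set (Ball v₀) :=
  {B | (B.kind = BallKind.closed ∧ B.carrier = apprClosed v₀ v x B.radius) ∨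
    (B.kind = BallKind.opened ∧ B.carrier = apprOpen v₀ v x B.radius)}

theorem mem_apprClosed (v₀ : Valuation K Γ₀) (v : Valuation L Γ) [v₀.HasExtension v] (x : L)
    (c d : K) : c ∈ apprClosed v₀ v x (v₀ d) ↔
      v (x - algebraMap K L c) ≤ v (algebraMap K L d) := by
  constructor
  · rintro ⟨e, he, h⟩
    rwa [← (Valuation.HasExtension.val_map_eq_iff v₀ v e d).2 he]
  · intro h
    exact ⟨d, rfl, h⟩

theorem mem_apprOpen (v₀ : Valuation K Γ₀) (v : Valuation L Γ) [v₀.HasExtension v] (x : L)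
    (c d : K) : c ∈ apprOpen v₀ v x (v₀ d) ↔
      v (x - algebraMap K L c) < v (algebraMap K L d) := by
  constructor
  · rintro ⟨e, he, h⟩
    rwa [← (Valuation.HasExtension.val_map_eq_iff v₀ v e d).2 he]
  · intro h
    exact ⟨d, rfl, h⟩

theorem closedBall_eq_apprClosed (v₀ : Valuation K Γ₀) (v : Valuation L Γ) [v₀.HasExtension v]
    (x : L) (c d : K) (hc : c ∈ apprClosed v₀ v x (v₀ d)) :
    closedBall v₀ c (v₀ d) = apprClosed v₀ v x (v₀ d) := by
  ext a
  rw [mem_apprClosed] at hc ⊢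
  rw [closedBall, Set.mem_ofPred_eq, ← Valuation.HasExtension.val_map_le_iff v₀ v, map_sub]
  constructor
  · intro h
    have e : x - algebraMap K L a
        = (x - algebraMap K L c) - (algebraMap K L a - algebraMap K L c) := by ring
    rw [e]
    exact v.map_sub_le hc h
  · intro h
    have e : algebraMap K L a - algebraMap K L c
        = (x - algebraMap K L c) - (x - algebraMap K L a) := by ring
    rw [e]
    exact v.map_sub_le hc h

theorem openBall_eq_apprOpen (v₀ : Valuation K Γ₀) (v : Valuation L Γ) [v₀.HasExtension v]
    (x : L) (c d : K) (hc : c ∈ apprOpen v₀ v x (v₀ d)) :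
    openBall v₀ c (v₀ d) = apprOpen v₀ v x (v₀ d) := by
  ext a
  rw [mem_apprOpen] at hc ⊢
  rw [openBall, Set.mem_ofPred_eq, ← Valuation.HasExtension.val_map_lt_iff v₀ v, map_sub]
  constructor
  · intro h
    have e : x - algebraMap K L a
        = (x - algebraMap K L c) - (algebraMap K L a - algebraMap K L c) := by ring
    rw [e]
    exact lt_of_le_of_lt (v.map_sub _ _) (max_lt hc h)
  · intro h
    have e : algebraMap K L a - algebraMap K L c
        = (x - algebraMap K L c) - (x - algebraMap K L a) := by ring
    rw [e]
    exact lt_of_le_of_lt (v.map_sub _ _) (max_lt hc h)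

theorem Ball.nonempty {v₀ : Valuation K Γ₀} (B : Ball v₀) : B.carrier.Nonempty := by
  rcases B.isBall with ⟨-, d, c, hr, h⟩ | ⟨-, d, c, hd, hr, h⟩
  · exact ⟨c, by rw [h]; simp [closedBall]⟩
  · refine ⟨c, ?_⟩
    rw [h, hr]
    simpa [openBall, zero_lt_iff] using hd

theorem Ball.sub_refl {v₀ : Valuation K Γ₀} (B : Ball v₀) : B.Sub B := by
  refine ⟨subset_rfl, Or.inr ⟨rfl, ?_⟩⟩
  cases B.kind <;> simp

/-- Membership in `apprSet` can be tested at a single point of the ball. -/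
theorem mem_apprSet_of_mem (v₀ : Valuation K Γ₀) (v : Valuation L Γ) [v₀.HasExtension v] (x : L)
    (B : Ball v₀) (a : K) (ha : a ∈ B.carrier)
    (h : (B.kind = BallKind.closed ∧ a ∈ apprClosed v₀ v x B.radius) ∨
      (B.kind = BallKind.opened ∧ a ∈ apprOpen v₀ v x B.radius)) :
    B ∈ apprSet v₀ v x := by
  obtain ⟨k, r, S, hB⟩ := B
  simp only at ha h
  rcases hB with ⟨rfl, d, c, rfl, rfl⟩ | ⟨rfl, d, c, hd, rfl, rfl⟩
  · have h' : a ∈ apprClosed v₀ v x (v₀ d) := by simpa using h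
    left
    refine ⟨rfl, ?_⟩
    rw [← closedBall_eq_apprClosed v₀ v x a d h']
    ext b
    simp only [closedBall, Set.mem_ofPred_eq] at ha ⊢
    constructor
    · intro hb
      have e : b - a = (b - c) - (a - c) := by ring
      rw [e]
      exact v₀.map_sub_le hb ha
    · intro hb
      have e : b - c = (b - a) + (a - c) := by ring
      rw [e]
      exact v₀.map_add_le hb ha
  · have h' : a ∈ apprOpen v₀ v x (v₀ d) := by simpa using h
    right
    refine ⟨rfl, ?_⟩
    rw [← openBall_eq_apprOpen v₀ v x a d h']
    ext b
    simp only [openBall, Set.mem_ofPred_eq] at ha ⊢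
    constructor
    · intro hb
      have e : b - a = (b - c) - (a - c) := by ring
      rw [e]
      exact lt_of_le_of_lt (v₀.map_sub _ _) (max_lt hb ha)
    · intro hb
      have e : b - c = (b - a) + (a - c) := by ring
      rw [e]
      exact lt_of_le_of_lt (v₀.map_add _ _) (max_lt hb ha)

theorem apprSet_isFullNest (v₀ : Valuation K Γ₀) (v : Valuation L Γ) [v₀.HasExtension v] (x : L) :
    apprSet v₀ v x = ∅ ∨ IsFullNest (apprSet v₀ v x) := by
  rcases Set.eq_empty_or_nonempty (apprSet v₀ v x) with h0 | h0
  · exact Or.inl h0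
  right
  have key : ∀ B B' : Ball v₀, B ∈ apprSet v₀ v x → B' ∈ apprSet v₀ v x →
      (B.radius < B'.radius ∨
        (B.radius = B'.radius ∧ (B'.kind = BallKind.closed ∨ B.kind = BallKind.opened))) →
      B.Sub B' := by
    intro B B' hB hB' hr
    refine ⟨?_, hr⟩
    obtain ⟨k, r, S, hb⟩ := B
    obtain ⟨k', r', S', hb'⟩ := B'
    simp only [apprSet, Set.mem_ofPred_eq] at hB hB' hr ⊢
    have hd : ∃ d, r = v₀ d := by
      rcases hb with ⟨-, d, -, h, -⟩ | ⟨-, d, -, -, h, -⟩ <;> exact ⟨d, h⟩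
    have hd' : ∃ d, r' = v₀ d := by
      rcases hb' with ⟨-, d, -, h, -⟩ | ⟨-, d, -, -, h, -⟩ <;> exact ⟨d, h⟩
    obtain ⟨d, rfl⟩ := hd
    obtain ⟨d', rfl⟩ := hd'
    rw [← Valuation.HasExtension.val_map_lt_iff v₀ v,
      ← Valuation.HasExtension.val_map_eq_iff v₀ v] at hr
    intro a ha
    rcases hB with ⟨rfl, rfl⟩ | ⟨rfl, rfl⟩ <;> rcases hB' with ⟨rfl, rfl⟩ | ⟨rfl, rfl⟩ <;>
      simp only [mem_apprClosed, mem_apprOpen] at ha ⊢ <;>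
      rcases hr with hr | ⟨hr, hk⟩
    · exact ha.trans hr.le
    · exact ha.trans hr.le
    · exact lt_of_le_of_lt ha hr
    · simp at hk
    · exact (ha.trans hr).le
    · exact ha.le.trans hr.le
    · exact ha.trans hr
    · exact lt_of_lt_of_le ha hr.le
  refine ⟨⟨h0, ?_⟩, ?_⟩
  · intro B hB B' hB'
    rcases lt_trichotomy B.radius B'.radius with h | h | h
    · exact Or.inl (key B B' hB hB' (Or.inl h))
    · rcases hk : B'.kind with _ | _
      · exact Or.inl (key B B' hB hB' (Or.inr ⟨h, Or.inl hk⟩))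
      · exact Or.inr (key B' B hB' hB (Or.inr ⟨h.symm, Or.inr hk⟩))
    · exact Or.inr (key B' B hB' hB (Or.inl h))
  · ext B'
    constructor
    · intro h
      exact ⟨B', h, B'.sub_refl⟩
    · rintro ⟨B, hB, hs, hr⟩
      obtain ⟨a, ha⟩ := B.nonempty
      apply mem_apprSet_of_mem v₀ v x B' a (hs ha)
      obtain ⟨k, r, S, hb⟩ := B
      obtain ⟨k', r', S', hb'⟩ := B'
      simp only [apprSet, Set.mem_ofPred_eq] at hB hr ha ⊢
      have hd : ∃ d, r = v₀ d := by
        rcases hb with ⟨-, d, -, h, -⟩ | ⟨-, d, -, -, h, -⟩ <;> exact ⟨d, h⟩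
      have hd' : ∃ d, r' = v₀ d := by
        rcases hb' with ⟨-, d, -, h, -⟩ | ⟨-, d, -, -, h, -⟩ <;> exact ⟨d, h⟩
      obtain ⟨d, rfl⟩ := hd
      obtain ⟨d', rfl⟩ := hd'
      rw [← Valuation.HasExtension.val_map_lt_iff v₀ v,
        ← Valuation.HasExtension.val_map_eq_iff v₀ v] at hr
      rcases hB with ⟨rfl, rfl⟩ | ⟨rfl, rfl⟩ <;> rcases k' with _ | _ <;>
        simp only [mem_apprClosed, mem_apprOpen, true_and, reduceCtorEq, false_and, or_false,
          false_or] at ha ⊢ <;>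
        rcases hr with hr | ⟨hr, hk⟩
      · exact ha.trans hr.le
      · exact ha.trans hr.le
      · exact lt_of_le_of_lt ha hr
      · simp at hk
      · exact (ha.trans hr).le
      · exact ha.le.trans hr.le
      · exact ha.trans hr
      · exact lt_of_lt_of_le ha hr.le

/-- The approximation type of `x` over `(K, v₀)` in an extension `(L, v)`. -/
def appr (v₀ : Valuation K Γ₀) (v : Valuation L Γ) [v₀.HasExtension v] (x : L) : AType v₀ :=
  ⟨apprSet v₀ v x, apprSet_isFullNest v₀ v x⟩

end Realization

section Properties

variable {K Γ₀ : Type*} [Field K] [LinearOrderedCommGroupWithZero Γ₀] {v₀ : Valuation K Γ₀}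

/-- The closed ball of radius `γ` of an approximation type (empty if there is none). -/
def AType.closedAt (A : AType v₀) (γ : Γ₀) : Set K :=
  {c | ∃ B ∈ A.balls, B.kind = BallKind.closed ∧ B.radius = γ ∧ c ∈ B.carrier}

/-- The open ball of radius `γ` of an approximation type (empty if there is none). -/
def AType.openAt (A : AType v₀) (γ : Γ₀) : Set K :=
  {c | ∃ B ∈ A.balls, B.kind = BallKind.opened ∧ B.radius = γ ∧ c ∈ B.carrier}

/-- The support: the radii of the closed balls of the approximation type. -/
def AType.supp (A : AType v₀) : Set Γ₀ :=
  {γ | ∃ B ∈ A.balls, B.kind = BallKind.closed ∧ B.radius = γ}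

/-- The intersection of all balls of the approximation type; it is `K` if there are none. -/
def AType.inter (A : AType v₀) : Set K := {c | ∀ B ∈ A.balls, c ∈ B.carrier}

/-- An approximation type is trivial if it is realized by an element of `K`. -/
def AType.IsTrivial (A : AType v₀) : Prop := ∃ c : K, A = appr v₀ v₀ c

/-- An approximation type is immediate if it is nonempty and the intersection of its balls is
empty. -/
def AType.IsImmediate (A : AType v₀) : Prop := A.balls.Nonempty ∧ A.inter = ∅

/-- The approximation type fixes the value of the polynomial `f`. -/
def AType.FixesValue (A : AType v₀) (f : Polynomial K) : Prop :=
  ∃ δ ∈ A.supp, ∀ c ∈ A.closedAt δ, ∀ c' ∈ A.closedAt δ, v₀ (f.eval c) = v₀ (f.eval c')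

/-- Transcendental immediate approximation types. -/
def AType.IsTransImmediate (A : AType v₀) : Prop :=
  A.IsImmediate ∧ ∀ f : Polynomial K, A.FixesValue f

/-- Algebraic immediate approximation types. -/
def AType.IsAlgImmediate (A : AType v₀) : Prop :=
  A.IsImmediate ∧ ∃ f : Polynomial K, ¬ A.FixesValue f

/-- Value-extending (non-trivial) approximation types: every radius of a closed ball is also the
radius of an open ball, and the intersection of all balls is nonempty. -/
def AType.IsValueExtending (A : AType v₀) : Prop :=
  ¬ A.IsTrivial ∧ (∀ γ ∈ A.supp, (A.openAt γ).Nonempty) ∧ A.inter.Nonempty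

/-- Residue-extending (non-trivial) approximation types. -/
def AType.IsResidueExtending (A : AType v₀) : Prop :=
  ¬ A.IsTrivial ∧ (∀ c : K, ∃ γ ∈ A.supp, c ∈ A.closedAt γ \ A.openAt γ) ∧ A.inter.Nonempty

/-- Completion types: immediate, with support the value group of `K` (without `∞`). -/
def AType.IsCompletionType (A : AType v₀) : Prop :=
  A.IsImmediate ∧ A.supp = {γ | ∃ d : K, d ≠ 0 ∧ v₀ d = γ}

/-- Pure approximation types. -/
def AType.IsPure (A : AType v₀) : Prop :=
  A.IsTransImmediate ∨ A.IsValueExtending ∨ A.IsResidueExtending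

/-- Almost pure approximation types: pure ones and algebraic completion types. -/
def AType.IsAlmostPure (A : AType v₀) : Prop :=
  A.IsPure ∨ (A.IsAlgImmediate ∧ A.IsCompletionType)

/-- The value group of `(K, v₀)` is divisible. -/
def DivisibleValueGroup (v₀ : Valuation K Γ₀) : Prop :=
  ∀ n : ℕ, 0 < n → ∀ a : K, a ≠ 0 → ∃ b : K, v₀ b ^ n = v₀ a

/-- `(K, v₀)` lies dense in its algebraic closure, for some extension of `v₀` to it. -/
def DenseInAlgClosure (v₀ : Valuation K Γ₀) : Prop :=
  ∃ W : ValuationSubring (AlgebraicClosure K), v₀.HasExtension W.valuation ∧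
    ∀ a b : AlgebraicClosure K, b ≠ 0 →
      ∃ c : K, W.valuation (a - algebraMap K (AlgebraicClosure K) c) < W.valuation b

end Properties

section Extensions

variable {K L Γ₀ Γ : Type*} [Field K] [Field L] [Algebra K L]
  [LinearOrderedCommGroupWithZero Γ₀] [LinearOrderedCommGroupWithZero Γ]

/-- The residue field of a valuation. -/
abbrev Residue (v : Valuation L Γ) : Type _ := IsLocalRing.ResidueField v.valuationSubring

/-- The value group `v(Lˣ)`. -/
def valueGroup (v : Valuation L Γ) : Subgroup Γˣ :=
  (Units.map v.toMonoidWithZeroHom.toMonoidHom).range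

variable (K) in
/-- The value group of the restriction of `v` to `K`, inside the value group of `L`. -/
def baseValueGroup (v : Valuation L Γ) : Subgroup (valueGroup v) :=
  (valueGroup (v.comap (algebraMap K L))).subgroupOf (valueGroup v)

variable (K) in
/-- The quotient `vL / vK`. -/
abbrev ValueQuotient (v : Valuation L Γ) : Type _ := valueGroup v ⧸ baseValueGroup K v

/-- The rational rank of a (multiplicatively written) abelian group `G`: the dimension of `ℚ ⊗ G`
over `ℚ`. -/
noncomputable def rationalRank (G : Type*) [CommGroup G] : Cardinal :=
  Module.rank ℚ (TensorProduct ℤ ℚ (Additive G))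

/-- `(L|K, v)` is immediate: value group and residue field do not change. -/
def IsImmediateExt (v₀ : Valuation K Γ₀) (v : Valuation L Γ) [v₀.HasExtension v] : Prop :=
  baseValueGroup K v = ⊤ ∧ Function.Surjective (algebraMap (Residue v₀) (Residue v))

/-- `(L|K, v)` is value-transcendental: `vL/vK` has rational rank 1, `Lv|Kv` is algebraic. -/
def IsValueTransExt (v₀ : Valuation K Γ₀) (v : Valuation L Γ) [v₀.HasExtension v] : Prop :=
  rationalRank (ValueQuotient K v) = 1 ∧ Algebra.IsAlgebraic (Residue v₀) (Residue v)

/-- `(L|K, v)` is residue-transcendental: `Lv|Kv` has transcendence degree 1, `vL/vK` is a torsion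
group. -/
def IsResidueTransExt (v₀ : Valuation K Γ₀) (v : Valuation L Γ) [v₀.HasExtension v] : Prop :=
  Algebra.trdeg (Residue v₀) (Residue v) = 1 ∧ IsMulTorsion (ValueQuotient K v)

variable (K) in
/-- `t` is a value-transcendental element: `vt` is not a torsion element modulo `vK`. -/
def IsValueTransElem (v : Valuation L Γ) (t : L) : Prop :=
  t ≠ 0 ∧ ∀ n : ℕ, 0 < n → ∀ d : K, v t ^ n ≠ v (algebraMap K L d)

/-- `t` is a residue-transcendental element: `vt` is the neutral element of the value group and the
residue of `t` is transcendental over the residue field of `K`. -/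
def IsResidueTransElem (v₀ : Valuation K Γ₀) (v : Valuation L Γ) [v₀.HasExtension v] (t : L) :
    Prop :=
  v t = 1 ∧ ∃ h : t ∈ v.valuationSubring,
    Transcendental (Residue v₀) (IsLocalRing.residue v.valuationSubring ⟨t, h⟩)

end Extensions

section RationalFunctionField

variable {K Γ₀ : Type*} [Field K] [LinearOrderedCommGroupWithZero Γ₀]

/-- The set of all extensions of `v₀` to the rational function field `K(x)`. Equivalent valuations
are identified, so an extension is given by its valuation ring (two valuations on a field are
equivalent if and only if they have the same valuation ring). -/
def Ext (v₀ : Valuation K Γ₀) : Type _ :=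
  {O : ValuationSubring (RatFunc K) // v₀.HasExtension O.valuation}

/-- The valuation of an extension. -/
noncomputable abbrev Ext.val {v₀ : Valuation K Γ₀} (v : Ext v₀) : Valuation (RatFunc K) v.1.ValueGroup :=
  v.1.valuation

instance Ext.hasExtension {v₀ : Valuation K Γ₀} (v : Ext v₀) : v₀.HasExtension v.val := v.2

/-- The element `x - b` of `K(x)`. -/
noncomputable def xSub (b : K) : RatFunc K := RatFunc.X - algebraMap K (RatFunc K) b

/-- The element `d (x - b)` of `K(x)`. -/
noncomputable def dxSub (d b : K) : RatFunc K := algebraMap K (RatFunc K) d * xSub b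

/-- The approximation type of `x` over `(K, v₀)` with respect to an extension `v`. -/
noncomputable def Ext.apprX {v₀ : Valuation K Γ₀} (v : Ext v₀) : AType v₀ :=
  appr v₀ v.val (RatFunc.X : RatFunc K)

/-- The extension `(K(x)|K, v)` is pure in `x`. -/
def Ext.IsPure {v₀ : Valuation K Γ₀} (v : Ext v₀) : Prop :=
  (∃ b d : K, IsValueTransElem K v.val (dxSub d b) ∨ IsResidueTransElem v₀ v.val (dxSub d b)) ∨
    v.apprX.IsTransImmediate

/-- The extension `(K(x)|K, v)` is almost pure in `x`. -/
def Ext.IsAlmostPure {v₀ : Valuation K Γ₀} (v : Ext v₀) : Prop :=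
  v.IsPure ∨ (v.apprX.IsAlgImmediate ∧ v.apprX.IsCompletionType)

/-- The extension belongs to exactly one of the cases immediate, value-transcendental,
residue-transcendental. -/
def Ext.ThreeExclusiveCases {v₀ : Valuation K Γ₀} (v : Ext v₀) : Prop :=
  (IsImmediateExt v₀ v.val ∨ IsValueTransExt v₀ v.val ∨ IsResidueTransExt v₀ v.val) ∧
  ¬ (IsImmediateExt v₀ v.val ∧ IsValueTransExt v₀ v.val) ∧
  ¬ (IsImmediateExt v₀ v.val ∧ IsResidueTransExt v₀ v.val) ∧
  ¬ (IsValueTransExt v₀ v.val ∧ IsResidueTransExt v₀ v.val)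

/-- The valuation `v` is uniquely determined, among all extensions of `v₀` to `K(x)`, by the
approximation type of `x`. -/
def Ext.DeterminedByAppr {v₀ : Valuation K Γ₀} (v : Ext v₀) : Prop :=
  ∀ v' : Ext v₀, v'.apprX = v.apprX → v' = v

end RationalFunctionField

end ApproxType

/-! Surjectivity holds over every valued field. A Gauss valuation prescribes a center b and a value
γ for x - b, where γ may lie in a larger group. Valuation rings of this kind, with centers and radii
following the balls of a given approximation type, converge along an ultrafilter to a valuation ring
realizing the type (`exists_ext_of_eventually`, `exists_ext_apprX_eq`). Triviality is the only
obstruction, as x - c is never 0.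

Injectivity and the classification come from a single computation. Fix v, call the set of all
extensions with the same approximation type its fiber, and let `fiberUnits` be the group of elements
that are principal units throughout the fiber. Outside the residue-transcendental case, the
multiplicative group of K(x) is generated, modulo these, by the constants and at most one further
element t. So every u has the value of some a tᵏ, uniformly on the fiber. As the value group of K is
divisible, deciding whether a tᵏ lies in the valuation ring means comparing t with constants, and
these comparisons depend on the approximation type only. Hence v is determined, and its value group
and residue field can be read off.

The generators are found as follows. If the distances from x to K are bounded away from zero,
density allows the roots of a polynomial to be moved into K at the cost of a principal unit, so the
constants and the x - c generate (`DenseInAlgClosure.eq_top_of_linear`). If x is a limit of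
constants, a polynomial f equals f(c) up to a principal unit for c near x, unless its value is
beyond all values of K. If such small polynomials exist, Euclidean division by one of least degree
shows that it serves as t (`Ext.IsLimit.isValueTransExt`).

Four cases result. Without a best approximation to x in K the type is immediate: transcendental with
v immediate, or, when x is a limit and small polynomials exist, algebraic with v
value-transcendental. With a best approximation b, the value of x - b is either new, and v is
value-transcendental, or equal to that of some d. In the latter case (x - b)/d has transcendental
residue, because the residue field of K is algebraically closed, and this residue generates the
residue field of K(x). `DenseInAlgClosure.classification` collects these cases; an algebraically
closed field is a dense one without algebraic immediate types. -/

namespace ApproxType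

/-! ### Gauss valuations on polynomials and rational functions -/

section GaussValuation

open Polynomial

variable {R Γ : Type*} [CommRing R] [LinearOrderedCommGroupWithZero Γ]

/-- The largest of the values `v (aᵢ) γⁱ`, where `aᵢ` are the coefficients of `f`. -/
noncomputable def gaussFun (v : Valuation R Γ) (γ : Γ) (f : R[X]) : Γ :=
  f.support.sup fun i => v (f.coeff i) * γ ^ i

theorem gaussFun_le_iff (v : Valuation R Γ) (γ : Γ) (f : R[X]) (b : Γ) :
    gaussFun v γ f ≤ b ↔ ∀ i, v (f.coeff i) * γ ^ i ≤ b := by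
  rw [gaussFun, Finset.sup_le_iff]
  refine ⟨fun h i => ?_, fun h i _ => h i⟩
  by_cases hi : i ∈ f.support
  · exact h i hi
  · rw [notMem_support_iff.1 hi]; simp

theorem le_gaussFun (v : Valuation R Γ) (γ : Γ) (f : R[X]) (i : ℕ) :
    v (f.coeff i) * γ ^ i ≤ gaussFun v γ f :=
  (gaussFun_le_iff v γ f _).1 le_rfl i

theorem gaussFun_lt_iff (v : Valuation R Γ) (γ : Γ) (f : R[X]) {b : Γ} (hb : b ≠ 0) :
    gaussFun v γ f < b ↔ ∀ i, v (f.coeff i) * γ ^ i < b := by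
  refine ⟨fun h i => (le_gaussFun v γ f i).trans_lt h, fun h => ?_⟩
  rw [gaussFun, Finset.sup_lt_iff (by rw [bot_eq_zero]; exact zero_lt_iff.2 hb)]
  exact fun i _ => h i

theorem exists_gaussFun_le (v : Valuation R Γ) (γ : Γ) (f : R[X]) :
    ∃ i, gaussFun v γ f ≤ v (f.coeff i) * γ ^ i := by
  by_cases h : gaussFun v γ f = 0
  · exact ⟨0, h ▸ zero_le⟩
  · by_contra! H
    exact lt_irrefl _ ((gaussFun_lt_iff v γ f h).2 H)

/-- Gauss's lemma: if i and j are the least indices at which the two maxima are attained, the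
product of these two coefficients strictly dominates all other terms in the coefficient of index i +
j. -/
theorem gaussFun_mul (v : Valuation R Γ) {γ : Γ} (hγ : γ ≠ 0) (f g : R[X]) :
    gaussFun v γ (f * g) = gaussFun v γ f * gaussFun v γ g := by
  classical
  apply le_antisymm
  · rw [gaussFun_le_iff]
    intro n
    rw [coeff_mul]
    have hn : γ ^ n ≠ 0 := pow_ne_zero _ hγ
    rw [← le_div_iff₀ (zero_lt_iff.2 hn)]
    refine v.map_sum_le fun x hx => ?_
    rw [le_div_iff₀ (zero_lt_iff.2 hn), ← Finset.HasAntidiagonal.mem_antidiagonal.1 hx, map_mul, pow_add,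
      mul_mul_mul_comm]
    exact mul_le_mul' (le_gaussFun v γ f _) (le_gaussFun v γ g _)
  · by_cases hf : gaussFun v γ f = 0
    · simp [hf]
    by_cases hg : gaussFun v γ g = 0
    · simp [hg]
    have hi := Nat.find_spec (exists_gaussFun_le v γ f)
    have hi' := fun k => Nat.find_min (exists_gaussFun_le v γ f) (m := k)
    have hj := Nat.find_spec (exists_gaussFun_le v γ g)
    have hj' := fun k => Nat.find_min (exists_gaussFun_le v γ g) (m := k)
    set i := Nat.find (exists_gaussFun_le v γ f)
    set j := Nat.find (exists_gaussFun_le v γ g)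
    refine le_trans ?_ (le_gaussFun v γ (f * g) (i + j))
    have hn : γ ^ (i + j) ≠ 0 := pow_ne_zero _ hγ
    have hmain : gaussFun v γ f * gaussFun v γ g ≤ v (f.coeff i * g.coeff j) * γ ^ (i + j) := by
      rw [map_mul, pow_add, mul_mul_mul_comm]
      exact mul_le_mul' hi hj
    have hpos : 0 < v (f.coeff i * g.coeff j) := by
      rw [zero_lt_iff]
      intro h
      rw [h, zero_mul, le_zero_iff] at hmain
      exact mul_ne_zero hf hg hmain
    rw [coeff_mul, ← Finset.add_sum_erase _ _
      (Finset.HasAntidiagonal.mem_antidiagonal.2 (rfl : (i, j).1 + (i, j).2 = i + j))]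
    rw [v.map_add_eq_of_lt_left]
    · exact hmain
    refine v.map_sum_lt hpos.ne' fun x hx => ?_
    obtain ⟨hne, hx⟩ := Finset.mem_erase.1 hx
    rw [Finset.HasAntidiagonal.mem_antidiagonal] at hx
    refine lt_of_mul_lt_mul_right (lt_of_lt_of_le ?_ hmain) (zero_le (a := γ ^ (i + j)))
    rw [← hx, map_mul, pow_add, mul_mul_mul_comm]
    rcases lt_trichotomy x.1 i with h | h | h
    · exact mul_lt_mul_of_lt_of_le_of_nonneg_of_pos (lt_of_not_ge (hi' _ h)) (le_gaussFun v γ g _)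
        zero_le (zero_lt_iff.2 hg)
    · exact absurd (Prod.ext h (by simp only; omega)) hne
    · exact (mul_le_mul' (le_gaussFun v γ f _) le_rfl).trans_lt
        (mul_lt_mul_of_pos_left (lt_of_not_ge (hj' _ (by omega))) (zero_lt_iff.2 hf))

/-- The Gauss valuation `∑ aᵢ Xⁱ ↦ max v (aᵢ) γⁱ`. -/
noncomputable def gaussVal (v : Valuation R Γ) (γ : Γ) (hγ : γ ≠ 0) : Valuation R[X] Γ where
  toFun := gaussFun v γ
  map_zero' := by simp [gaussFun, bot_eq_zero]
  map_one' := by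
    apply le_antisymm
    · rw [gaussFun_le_iff]
      intro i
      rw [coeff_one]
      split_ifs with h
      · simp [h]
      · simp
    · simpa using le_gaussFun v γ 1 0
  map_mul' := gaussFun_mul v hγ
  map_add_le_max' f g := by
    rw [gaussFun_le_iff]
    intro i
    rw [coeff_add]
    rcases le_total (v (f.coeff i)) (v (g.coeff i)) with h | h
    · refine le_trans ?_ (le_max_right _ _)
      exact (mul_le_mul_left (v.map_add_le h le_rfl) _).trans (le_gaussFun v γ g i)
    · refine le_trans ?_ (le_max_left _ _)
      exact (mul_le_mul_left (v.map_add_le le_rfl h) _).trans (le_gaussFun v γ f i)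

theorem gaussVal_apply (v : Valuation R Γ) (γ : Γ) (hγ : γ ≠ 0) (f : R[X]) :
    gaussVal v γ hγ f = gaussFun v γ f := rfl

theorem gaussVal_C (v : Valuation R Γ) (γ : Γ) (hγ : γ ≠ 0) (a : R) :
    gaussVal v γ hγ (C a) = v a := by
  rw [gaussVal_apply]
  apply le_antisymm
  · rw [gaussFun_le_iff]
    intro i
    rw [coeff_C]
    split_ifs with h
    · simp [h]
    · simp
  · simpa using le_gaussFun v γ (C a) 0

theorem gaussVal_X_add_C (v : Valuation R Γ) (γ : Γ) (hγ : γ ≠ 0) (a : R) :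
    gaussVal v γ hγ (X + C a) = max γ (v a) := by
  rw [gaussVal_apply]
  apply le_antisymm
  · rw [gaussFun_le_iff]
    intro i
    rw [coeff_add, coeff_X, coeff_C]
    rcases i with _ | _ | i
    · simp
    · simp
    · simp
  · rw [max_le_iff]
    constructor
    · have h := le_gaussFun v γ (X + C a) 1
      rwa [coeff_add, coeff_X_one, coeff_C_succ, add_zero, map_one, one_mul, pow_one] at h
    · have h := le_gaussFun v γ (X + C a) 0
      rwa [coeff_add, coeff_X_zero, coeff_C_zero, zero_add, pow_zero, mul_one] at h

theorem gaussVal_ne_zero {k : Type*} [Field k] (v : Valuation k Γ) (γ : Γ) (hγ : γ ≠ 0)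
    {f : k[X]} (hf : f ≠ 0) : gaussVal v γ hγ f ≠ 0 := by
  intro h
  have h1 := le_gaussFun v γ f f.natDegree
  rw [← gaussVal_apply v γ hγ, h, le_zero_iff] at h1
  simp [hf, hγ] at h1

/-- The Gauss valuation on `K(x)` with `x - b` of value `γ`. -/
noncomputable def gaussRat {K : Type*} [Field K] (v : Valuation K Γ) (b : K) (γ : Γ)
    (hγ : γ ≠ 0) : Valuation (RatFunc K) Γ :=
  ((gaussVal v γ hγ).comap (compRingHom (X + C b))).extendToLocalization
    (S := nonZeroDivisors K[X]) (by
      intro f hf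
      simp only [Ideal.primeCompl, Submonoid.mem_mk, Subsemigroup.mem_mk]
      simp only [Set.mem_compl_iff, SetLike.mem_coe, Valuation.mem_supp_iff, Valuation.comap_apply]
      refine gaussVal_ne_zero v γ hγ ?_
      have hf0 := nonZeroDivisors.ne_zero hf
      rw [coe_compRingHom_apply]
      intro h
      rw [comp_eq_zero_iff] at h
      rcases h with h | h
      · exact hf0 h
      · have h2 := congrArg (fun p => coeff p 1) h.2
        simp [coeff_C] at h2) (RatFunc K)

theorem gaussRat_algebraMap {K : Type*} [Field K] (v : Valuation K Γ) (b : K) (γ : Γ)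
    (hγ : γ ≠ 0) (a : K) : gaussRat v b γ hγ (algebraMap K (RatFunc K) a) = v a := by
  rw [IsScalarTower.algebraMap_apply K K[X] (RatFunc K), gaussRat,
    Valuation.extendToLocalization_apply_map_apply, Valuation.comap_apply, algebraMap_eq,
    coe_compRingHom_apply, C_comp, gaussVal_C]

theorem gaussRat_xSub {K : Type*} [Field K] (v : Valuation K Γ) (b : K) (γ : Γ)
    (hγ : γ ≠ 0) (c : K) : gaussRat v b γ hγ (xSub c) = max γ (v (b - c)) := by
  have : xSub c = algebraMap K[X] (RatFunc K) (X - C c) := by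
    simp [xSub, ← algebraMap_eq]
  rw [this, gaussRat,
    Valuation.extendToLocalization_apply_map_apply, Valuation.comap_apply,
    coe_compRingHom_apply, sub_comp, C_comp, X_comp, add_sub_assoc, ← C_sub, gaussVal_X_add_C]

end GaussValuation

/-! ### Limits of valuation rings along ultrafilters -/

section UltraLimit

variable {L ι : Type*} [Field L]

/-- The limit of a family of valuation rings along an ultrafilter. -/
def ultraLimit (U : Ultrafilter ι) (O : ι → ValuationSubring L) : ValuationSubring L where
  carrier := {h | ∀ᶠ i in (U : Filter ι), h ∈ O i}
  mul_mem' ha hb := by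
    filter_upwards [ha, hb] with i h1 h2 using mul_mem h1 h2
  one_mem' := Filter.Eventually.of_forall fun i => one_mem _
  add_mem' ha hb := by
    filter_upwards [ha, hb] with i h1 h2 using add_mem h1 h2
  zero_mem' := Filter.Eventually.of_forall fun i => zero_mem _
  neg_mem' ha := by
    filter_upwards [ha] with i h1 using neg_mem h1
  mem_or_inv_mem' h := by
    simp only [Set.mem_ofPred_eq]
    -- This is where an ultrafilter is needed: a disjunction that holds throughout must have one
    -- alternative that holds eventually.
    rw [← Ultrafilter.eventually_or]
    exact Filter.Eventually.of_forall fun i => (O i).mem_or_inv_mem h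

theorem mem_ultraLimit (U : Ultrafilter ι) (O : ι → ValuationSubring L) (h : L) :
    h ∈ ultraLimit U O ↔ ∀ᶠ i in (U : Filter ι), h ∈ O i := Iff.rfl

theorem valuation_le_iff_mem (O : ValuationSubring L) (f g : L) (hg : g ≠ 0) :
    O.valuation f ≤ O.valuation g ↔ f / g ∈ O := by
  rw [← O.valuation_le_one_iff, map_div₀, div_le_one₀]
  exact zero_lt_iff.2 ((Valuation.ne_zero_iff _).2 hg)

variable {Γ : Type*} [LinearOrderedCommGroupWithZero Γ]

theorem ultraLimit_le_iff (U : Ultrafilter ι) (u : ι → Valuation L Γ) (f g : L) (hg : g ≠ 0) :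
    (ultraLimit U fun i => (u i).valuationSubring).valuation f ≤
      (ultraLimit U fun i => (u i).valuationSubring).valuation g ↔
    ∀ᶠ i in (U : Filter ι), u i f ≤ u i g := by
  rw [valuation_le_iff_mem _ _ _ hg, mem_ultraLimit]
  refine Filter.eventually_congr (Filter.Eventually.of_forall fun i => ?_)
  rw [Valuation.mem_valuationSubring_iff, map_div₀, div_le_one₀]
  exact zero_lt_iff.2 ((Valuation.ne_zero_iff _).2 hg)

theorem ultraLimit_lt_iff (U : Ultrafilter ι) (u : ι → Valuation L Γ) (f g : L) (hf : f ≠ 0) :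
    (ultraLimit U fun i => (u i).valuationSubring).valuation f <
      (ultraLimit U fun i => (u i).valuationSubring).valuation g ↔
    ∀ᶠ i in (U : Filter ι), u i f < u i g := by
  rw [← not_le, ultraLimit_le_iff U u g f hf, ← Ultrafilter.eventually_not]
  simp only [not_le]

end UltraLimit

/-! ### Calculus of balls and approximation types -/

section ATypes

variable {K Γ₀ : Type*} [Field K] [LinearOrderedCommGroupWithZero Γ₀] {v₀ : Valuation K Γ₀}

theorem Ball.ext' {B B' : Ball v₀} (h1 : B.kind = B'.kind) (h2 : B.radius = B'.radius)
    (h3 : B.carrier = B'.carrier) : B = B' := by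
  cases B; cases B'; simp_all

theorem sub_le_of_sub_le {a b c : K} {γ : Γ₀} (h1 : v₀ (a - c) ≤ γ) (h2 : v₀ (b - c) ≤ γ) :
    v₀ (a - b) ≤ γ := by
  rw [← sub_sub_sub_cancel_right a b c]; exact v₀.map_sub_le h1 h2

theorem sub_lt_of_sub_lt {a b c : K} {γ : Γ₀} (h1 : v₀ (a - c) < γ) (h2 : v₀ (b - c) < γ) :
    v₀ (a - b) < γ := by
  rw [← sub_sub_sub_cancel_right a b c]; exact (v₀.map_sub _ _).trans_lt (max_lt h1 h2)

/-- The closed ball of center `c` and radius `v₀ d`. -/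
def Ball.mkClosed (v₀ : Valuation K Γ₀) (c d : K) : Ball v₀ :=
  ⟨.closed, v₀ d, closedBall v₀ c (v₀ d), Or.inl ⟨rfl, d, c, rfl, rfl⟩⟩

/-- The open ball of center `c` and radius `v₀ d`. -/
def Ball.mkOpen (v₀ : Valuation K Γ₀) (c d : K) (hd : d ≠ 0) : Ball v₀ :=
  ⟨.opened, v₀ d, openBall v₀ c (v₀ d), Or.inr ⟨rfl, d, c, hd, rfl, rfl⟩⟩

theorem closedBall_eq_of_mem {c c' : K} {γ : Γ₀} (h : c ∈ closedBall v₀ c' γ) :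
    closedBall v₀ c γ = closedBall v₀ c' γ := by
  ext a
  simp only [closedBall, Set.mem_ofPred_eq] at *
  exact ⟨fun h1 => sub_le_of_sub_le h1 (by rwa [v₀.map_sub_swap]), fun h1 => sub_le_of_sub_le h1 h⟩

theorem openBall_eq_of_mem {c c' : K} {γ : Γ₀} (h : c ∈ openBall v₀ c' γ) :
    openBall v₀ c γ = openBall v₀ c' γ := by
  ext a
  simp only [openBall, Set.mem_ofPred_eq] at *
  exact ⟨fun h1 => sub_lt_of_sub_lt h1 (by rwa [v₀.map_sub_swap]), fun h1 => sub_lt_of_sub_lt h1 h⟩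

theorem Ball.eq_mkClosed (B : Ball v₀) (hk : B.kind = .closed) {c : K} (hc : c ∈ B.carrier) :
    ∃ d, B.radius = v₀ d ∧ B = Ball.mkClosed v₀ c d := by
  obtain ⟨k, r, S, hB⟩ := B
  simp only at hk hc ⊢
  rcases hB with ⟨-, d, c', rfl, rfl⟩ | ⟨h, -⟩
  · exact ⟨d, rfl, Ball.ext' hk rfl (closedBall_eq_of_mem hc).symm⟩
  · rw [hk] at h; cases h

theorem Ball.eq_mkOpen (B : Ball v₀) (hk : B.kind = .opened) {c : K} (hc : c ∈ B.carrier) :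
    ∃ (d : K) (hd : d ≠ 0), B.radius = v₀ d ∧ B = Ball.mkOpen v₀ c d hd := by
  obtain ⟨k, r, S, hB⟩ := B
  simp only at hk hc ⊢
  rcases hB with ⟨h, -⟩ | ⟨-, d, c', hd, rfl, rfl⟩
  · rw [hk] at h; cases h
  · exact ⟨d, hd, rfl, Ball.ext' hk rfl (openBall_eq_of_mem hc).symm⟩

theorem mkClosed_congr (c : K) {d d' : K} (h : v₀ d = v₀ d') :
    Ball.mkClosed v₀ c d = Ball.mkClosed v₀ c d' :=
  Ball.ext' rfl h (by simp [Ball.mkClosed, h])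

theorem mkOpen_congr (c : K) {d d' : K} (hd : d ≠ 0) (hd' : d' ≠ 0) (h : v₀ d = v₀ d') :
    Ball.mkOpen v₀ c d hd = Ball.mkOpen v₀ c d' hd' :=
  Ball.ext' rfl h (by simp [Ball.mkOpen, h])

theorem AType.mem_closedAt (A : AType v₀) (c d : K) :
    c ∈ A.closedAt (v₀ d) ↔ Ball.mkClosed v₀ c d ∈ A.balls := by
  constructor
  · rintro ⟨B, hB, hk, hr, hc⟩
    obtain ⟨d', hd', rfl⟩ := B.eq_mkClosed hk hc
    rwa [mkClosed_congr c (hd'.symm.trans hr)] at hB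
  · intro h
    exact ⟨_, h, rfl, rfl, by simp [Ball.mkClosed, closedBall]⟩

theorem AType.mem_openAt (A : AType v₀) (c d : K) (hd : d ≠ 0) :
    c ∈ A.openAt (v₀ d) ↔ Ball.mkOpen v₀ c d hd ∈ A.balls := by
  constructor
  · rintro ⟨B, hB, hk, hr, hc⟩
    obtain ⟨d', hd', hr', rfl⟩ := B.eq_mkOpen hk hc
    rwa [mkOpen_congr c hd' hd (hr'.symm.trans hr)] at hB
  · intro h
    exact ⟨_, h, rfl, rfl, by simpa [Ball.mkOpen, openBall, zero_lt_iff] using hd⟩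

theorem AType.openAt_zero (A : AType v₀) : A.openAt 0 = ∅ := by
  rw [Set.eq_empty_iff_forall_notMem]
  rintro c ⟨B, hB, hk, hr, hc⟩
  obtain ⟨d, hd, hr', -⟩ := B.eq_mkOpen hk hc
  rw [hr', v₀.zero_iff] at hr
  exact hd hr

/-- A ball has a point and its radius is a value of K, and kind, radius and one point determine it;
so these membership relations carry all the information. -/
theorem AType.ext_of_mem {A A' : AType v₀}
    (h1 : ∀ c d, c ∈ A.closedAt (v₀ d) ↔ c ∈ A'.closedAt (v₀ d))
    (h2 : ∀ c d, d ≠ 0 → (c ∈ A.openAt (v₀ d) ↔ c ∈ A'.openAt (v₀ d))) : A = A' := by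
  have : A.balls = A'.balls := by
    ext B
    obtain ⟨c, hc⟩ := B.nonempty
    rcases hk : B.kind with _ | _
    · obtain ⟨d, -, rfl⟩ := B.eq_mkClosed hk hc
      rw [← AType.mem_closedAt, ← AType.mem_closedAt, h1]
    · obtain ⟨d, hd, -, rfl⟩ := B.eq_mkOpen hk hc
      rw [← AType.mem_openAt, ← AType.mem_openAt, h2 c d hd]
  cases A; cases A'; simp_all

theorem AType.mem_of_sub (A : AType v₀) {B B' : Ball v₀} (hB : B ∈ A.balls) (h : B.Sub B') :
    B' ∈ A.balls := by
  rcases A.isFullNest with h0 | ⟨-, h0⟩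
  · rw [h0] at hB; exact hB.elim
  · rw [h0]; exact ⟨B, hB, h⟩

theorem AType.sub_or_sub (A : AType v₀) {B B' : Ball v₀} (hB : B ∈ A.balls) (hB' : B' ∈ A.balls) :
    B.Sub B' ∨ B'.Sub B := by
  rcases A.isFullNest with h0 | ⟨h0, -⟩
  · rw [h0] at hB; exact hB.elim
  · exact h0.2 B hB B' hB'

theorem AType.closedAt_mono (A : AType v₀) {c c' d d' : K} (h : c ∈ A.closedAt (v₀ d))
    (hd : v₀ d ≤ v₀ d') (hc : v₀ (c - c') ≤ v₀ d') : c' ∈ A.closedAt (v₀ d') := by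
  rw [AType.mem_closedAt] at *
  refine A.mem_of_sub h ⟨fun a ha => ?_, ?_⟩
  · simp only [Ball.mkClosed, closedBall, Set.mem_ofPred_eq] at ha ⊢
    exact sub_le_of_sub_le (ha.trans hd) (by rwa [v₀.map_sub_swap])
  · exact hd.lt_or_eq.imp id fun h => ⟨h, Or.inl rfl⟩

theorem AType.openAt_mono (A : AType v₀) {c c' d d' : K} (h : c ∈ A.openAt (v₀ d))
    (hd : v₀ d ≤ v₀ d') (hc : v₀ (c - c') < v₀ d') : c' ∈ A.openAt (v₀ d') := by
  have hd' : d' ≠ 0 := by rintro rfl; simp at hc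
  have hd0 : d ≠ 0 := by rintro rfl; simp [AType.openAt_zero] at h
  rw [AType.mem_openAt _ _ _ hd'] at *
  rw [AType.mem_openAt _ _ _ hd0] at h
  refine A.mem_of_sub h ⟨fun a ha => ?_, ?_⟩
  · simp only [Ball.mkOpen, openBall, Set.mem_ofPred_eq] at ha ⊢
    exact sub_lt_of_sub_lt (ha.trans_le hd) (by rwa [v₀.map_sub_swap])
  · exact hd.lt_or_eq.imp id fun h => ⟨h, Or.inr rfl⟩

theorem AType.openAt_of_closedAt (A : AType v₀) {c c' d d' : K} (h : c ∈ A.closedAt (v₀ d))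
    (hd : v₀ d < v₀ d') (hc : v₀ (c - c') < v₀ d') : c' ∈ A.openAt (v₀ d') := by
  have hd' : d' ≠ 0 := by rintro rfl; simp at hc
  rw [AType.mem_openAt _ _ _ hd']
  rw [AType.mem_closedAt] at h
  refine A.mem_of_sub h ⟨fun a ha => ?_, Or.inl hd⟩
  simp only [Ball.mkClosed, Ball.mkOpen, closedBall, openBall, Set.mem_ofPred_eq] at ha ⊢
  exact sub_lt_of_sub_lt (ha.trans_lt hd) (by rwa [v₀.map_sub_swap])

theorem AType.closedAt_of_openAt (A : AType v₀) {c c' d d' : K} (h : c ∈ A.openAt (v₀ d))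
    (hd : v₀ d ≤ v₀ d') (hc : v₀ (c - c') ≤ v₀ d') : c' ∈ A.closedAt (v₀ d') := by
  have hd0 : d ≠ 0 := by rintro rfl; simp [AType.openAt_zero] at h
  rw [AType.mem_openAt _ _ _ hd0] at h
  rw [AType.mem_closedAt] at *
  refine A.mem_of_sub h ⟨fun a ha => ?_, ?_⟩
  · simp only [Ball.mkClosed, Ball.mkOpen, closedBall, openBall, Set.mem_ofPred_eq] at ha ⊢
    exact sub_le_of_sub_le (ha.le.trans hd) (by rwa [v₀.map_sub_swap])
  · exact hd.lt_or_eq.imp id fun h => ⟨h, Or.inl rfl⟩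

theorem AType.sub_le_of_closedAt (A : AType v₀) {c c' d d' : K} (h : c ∈ A.closedAt (v₀ d))
    (h' : c' ∈ A.closedAt (v₀ d')) (hd : v₀ d ≤ v₀ d') : v₀ (c - c') ≤ v₀ d' := by
  have h2 := A.closedAt_mono h hd (c' := c) (by simp)
  rw [AType.mem_closedAt] at h2 h'
  rcases A.sub_or_sub h2 h' with h3 | h3
  · exact h3.1 (by simp [Ball.mkClosed, closedBall])
  · rw [v₀.map_sub_swap]
    exact h3.1 (by simp [Ball.mkClosed, closedBall])

theorem AType.sub_lt_of_openAt (A : AType v₀) {c c' d : K} (h : c ∈ A.openAt (v₀ d))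
    (h' : c' ∈ A.openAt (v₀ d)) : v₀ (c - c') < v₀ d := by
  have hd0 : d ≠ 0 := by rintro rfl; simp [AType.openAt_zero] at h
  have : 0 < v₀ d := zero_lt_iff.2 (by simpa using hd0)
  rw [AType.mem_openAt _ _ _ hd0] at h h'
  rcases A.sub_or_sub h h' with h3 | h3
  · exact h3.1 (by simpa [Ball.mkOpen, openBall] using this)
  · rw [v₀.map_sub_swap]
    exact h3.1 (by simpa [Ball.mkOpen, openBall] using this)

theorem mem_closedAt_appr {L Γ : Type*} [Field L] [Algebra K L]
    [LinearOrderedCommGroupWithZero Γ] (v : Valuation L Γ) [v₀.HasExtension v] (x : L) (c d : K) :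
    c ∈ (appr v₀ v x).closedAt (v₀ d) ↔ v (x - algebraMap K L c) ≤ v (algebraMap K L d) := by
  rw [AType.mem_closedAt, ← mem_apprClosed v₀]
  constructor
  · intro h
    rcases h with ⟨-, h⟩ | ⟨h, -⟩
    · have h1 : c ∈ (Ball.mkClosed v₀ c d).carrier := by simp [Ball.mkClosed, closedBall]
      rwa [h] at h1
    · cases h
  · intro h
    exact mem_apprSet_of_mem v₀ v x _ c (by simp [Ball.mkClosed, closedBall]) (Or.inl ⟨rfl, h⟩)

theorem mem_openAt_appr {L Γ : Type*} [Field L] [Algebra K L]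
    [LinearOrderedCommGroupWithZero Γ] (v : Valuation L Γ) [v₀.HasExtension v] (x : L) (c d : K) :
    c ∈ (appr v₀ v x).openAt (v₀ d) ↔ v (x - algebraMap K L c) < v (algebraMap K L d) := by
  by_cases hd : d = 0
  · subst hd
    simp [AType.openAt_zero]
  have h0 : c ∈ (Ball.mkOpen v₀ c d hd).carrier := by
    simpa [Ball.mkOpen, openBall, zero_lt_iff] using hd
  rw [AType.mem_openAt _ _ _ hd, ← mem_apprOpen v₀]
  constructor
  · intro h
    rcases h with ⟨h, -⟩ | ⟨-, h⟩
    · cases h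
    · rwa [h] at h0
  · intro h
    exact mem_apprSet_of_mem v₀ v x _ c h0 (Or.inr ⟨rfl, h⟩)

/-- A closed ball of radius 0 (the additive ∞) is a single point c, and a full nest containing it
consists of all balls around c. -/
theorem AType.isTrivial_iff (A : AType v₀) : A.IsTrivial ↔ ∃ c, c ∈ A.closedAt 0 := by
  constructor
  · rintro ⟨c, rfl⟩
    refine ⟨c, ?_⟩
    rw [← map_zero v₀, mem_closedAt_appr]
    simp
  · rintro ⟨c, hc⟩
    rw [← map_zero v₀] at hc
    refine ⟨c, AType.ext_of_mem (fun a d => ?_) fun a d hd => ?_⟩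
    · rw [mem_closedAt_appr]
      refine ⟨fun h => A.sub_le_of_closedAt hc h (by simp), fun h =>
        A.closedAt_mono hc (by simp) h⟩
    · rw [mem_openAt_appr]
      have hd0 : v₀ 0 < v₀ d := by simpa [zero_lt_iff] using hd
      refine ⟨fun h => ?_, fun h => A.openAt_of_closedAt hc hd0 h⟩
      exact A.sub_lt_of_openAt (A.openAt_of_closedAt hc hd0 (by simpa using hd0)) h

theorem AType.exists_of_mem_supp (A : AType v₀) {γ : Γ₀} (h : γ ∈ A.supp) :
    ∃ c d, v₀ d = γ ∧ c ∈ A.closedAt γ := by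
  obtain ⟨B, hB, hk, rfl⟩ := h
  obtain ⟨c, hc⟩ := B.nonempty
  obtain ⟨d, hd, -⟩ := B.eq_mkClosed hk hc
  exact ⟨c, d, hd.symm, B, hB, hk, rfl, hc⟩

theorem AType.mem_supp_of_mem (A : AType v₀) {γ : Γ₀} {c : K} (h : c ∈ A.closedAt γ) :
    γ ∈ A.supp := by
  obtain ⟨B, hB, hk, hr, -⟩ := h
  exact ⟨B, hB, hk, hr⟩

end ATypes

/-! ### Every non-trivial approximation type is realized -/

section Realize

variable {K Γ₀ : Type*} [Field K] [LinearOrderedCommGroupWithZero Γ₀] {v₀ : Valuation K Γ₀}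

theorem mem_closedAt_apprX (v : Ext v₀) (c d : K) :
    c ∈ v.apprX.closedAt (v₀ d) ↔ v.val (xSub c) ≤ v.val (algebraMap K _ d) :=
  mem_closedAt_appr _ _ _ _

theorem mem_openAt_apprX (v : Ext v₀) (c d : K) :
    c ∈ v.apprX.openAt (v₀ d) ↔ v.val (xSub c) < v.val (algebraMap K _ d) :=
  mem_openAt_appr _ _ _ _

theorem xSub_eq_algebraMap (c : K) :
    xSub c = algebraMap (Polynomial K) (RatFunc K) (Polynomial.X - Polynomial.C c) := by
  simp [xSub, ← Polynomial.algebraMap_eq]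

theorem xSub_ne_zero (c : K) : xSub c ≠ 0 := by
  rw [xSub_eq_algebraMap]
  exact (map_ne_zero_iff _ (IsFractionRing.injective _ _)).2 (Polynomial.X_sub_C_ne_zero c)

theorem val_pos (v : Ext v₀) {f : RatFunc K} (hf : f ≠ 0) : 0 < v.val f :=
  zero_lt_iff.2 ((Valuation.ne_zero_iff _).2 hf)

theorem Ext.not_isTrivial_apprX (v : Ext v₀) : ¬ v.apprX.IsTrivial := by
  rw [AType.isTrivial_iff]
  rintro ⟨c, hc⟩
  rw [← map_zero v₀, mem_closedAt_apprX] at hc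
  simp only [map_zero, le_zero_iff] at hc
  exact (val_pos v (xSub_ne_zero c)).ne' hc

/-- In the Gauss valuation of index i, the value of x - c is the maximum of γᵢ and the value of bᵢ -
c. The four eventual conditions therefore say that these valuations, in the limit along an
ultrafilter finer than l, put c into exactly the balls of A. -/
theorem exists_ext_of_eventually {ι Γ : Type*} [LinearOrderedCommGroupWithZero Γ] (l : Filter ι)
    [l.NeBot] (φ : Γ₀ →*₀ Γ) (hφ : StrictMono φ)
    (b : ι → K) (γ : ι → Γ) (hγ : ∀ i, γ i ≠ 0) (A : AType v₀)
    (h1 : ∀ c d, c ∈ A.closedAt (v₀ d) → ∀ᶠ i in l, γ i ≤ φ (v₀ d) ∧ v₀ (b i - c) ≤ v₀ d)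
    (h2 : ∀ c d, d ≠ 0 → c ∈ A.openAt (v₀ d) → ∀ᶠ i in l, γ i < φ (v₀ d) ∧ v₀ (b i - c) < v₀ d)
    (h3 : ∀ c d, d ≠ 0 → c ∉ A.closedAt (v₀ d) →
      ∀ᶠ i in l, ¬ (γ i ≤ φ (v₀ d) ∧ v₀ (b i - c) ≤ v₀ d))
    (h4 : ∀ c d, d ≠ 0 → c ∉ A.openAt (v₀ d) →
      ∀ᶠ i in l, ¬ (γ i < φ (v₀ d) ∧ v₀ (b i - c) < v₀ d))
    (hA : ¬ A.IsTrivial) : ∃ v : Ext v₀, v.apprX = A := by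
  set w : Valuation K Γ := v₀.map φ hφ.monotone with hw
  have hwa : ∀ a, w a = φ (v₀ a) := fun a => rfl
  set u : ι → Valuation (RatFunc K) Γ := fun i => gaussRat w (b i) (γ i) (hγ i) with hu
  set U : Ultrafilter ι := Ultrafilter.of l
  have hU : (U : Filter ι) ≤ l := Ultrafilter.of_le l
  have hext : v₀.HasExtension (ultraLimit U fun i => (u i).valuationSubring).valuation := by
    constructor
    rw [Valuation.isEquiv_iff_val_le_one]
    intro a
    rw [Valuation.comap_apply, ValuationSubring.valuation_le_one_iff, mem_ultraLimit]
    have : ∀ i, algebraMap K (RatFunc K) a ∈ (u i).valuationSubring ↔ v₀ a ≤ 1 := by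
      intro i
      rw [Valuation.mem_valuationSubring_iff, hu, gaussRat_algebraMap, hwa, ← map_one φ,
        hφ.le_iff_le]
    simp only [this, Filter.eventually_const]
  have hle : ∀ i c d, u i (xSub c) ≤ u i (algebraMap K _ d) ↔
      γ i ≤ φ (v₀ d) ∧ v₀ (b i - c) ≤ v₀ d := by
    intro i c d
    rw [hu, gaussRat_xSub, gaussRat_algebraMap, max_le_iff, hwa, hwa, hφ.le_iff_le]
  have hlt : ∀ i c d, u i (xSub c) < u i (algebraMap K _ d) ↔
      γ i < φ (v₀ d) ∧ v₀ (b i - c) < v₀ d := by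
    intro i c d
    rw [hu, gaussRat_xSub, gaussRat_algebraMap, max_lt_iff, hwa, hwa, hφ.lt_iff_lt]
  refine ⟨⟨_, hext⟩, AType.ext_of_mem (fun c d => ?_) fun c d hd => ?_⟩
  -- Radius 0 is not covered by `h3`; here both sides fail because neither type is trivial.
  · by_cases hd : d = 0
    · subst hd
      rw [map_zero]
      exact iff_of_false (fun h => Ext.not_isTrivial_apprX _ ((AType.isTrivial_iff _).2 ⟨c, h⟩))
        (fun h => hA ((AType.isTrivial_iff _).2 ⟨c, h⟩))
    refine (mem_closedAt_apprX _ c d).trans ?_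
    have : algebraMap K (RatFunc K) d ≠ 0 := by simpa using hd
    refine (ultraLimit_le_iff U u _ _ this).trans ?_
    simp only [hle]
    by_cases h : c ∈ A.closedAt (v₀ d)
    · exact iff_of_true (hU (h1 c d h)) h
    · exact iff_of_false (fun h' => (Ultrafilter.eventually_not.1 (hU (h3 c d hd h))) h') h
  · refine (mem_openAt_apprX _ c d).trans ?_
    refine (ultraLimit_lt_iff U u _ _ (xSub_ne_zero c)).trans ?_
    simp only [hlt]
    by_cases h : c ∈ A.openAt (v₀ d)
    · exact iff_of_true (hU (h2 c d hd h)) h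
    · exact iff_of_false (fun h' => (Ultrafilter.eventually_not.1 (hU (h4 c d hd h))) h') h

/-- Every linearly ordered group with zero embeds into one in which there are elements
infinitesimally smaller than `1`. -/
theorem exists_infinitesimal (Γ₀ : Type*) [LinearOrderedCommGroupWithZero Γ₀] :
    ∃ (φ : Γ₀ →*₀ WithZero (Γ₀ˣ ×ₗ (WithZero (Multiplicative ℤ))ˣ))
      (ε : WithZero (Γ₀ˣ ×ₗ (WithZero (Multiplicative ℤ))ˣ)),
      StrictMono φ ∧ ε ≠ 0 ∧ ε < 1 ∧ ∀ γ δ, γ < δ → φ γ < ε * φ δ := by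
  have hn : (WithZero.exp (-1 : ℤ)) ≠ 0 := WithZero.exp_ne_zero
  have hlt : WithZero.exp (-1 : ℤ) < 1 := by
    rw [← WithZero.exp_zero, WithZero.exp_lt_exp]; norm_num
  have hs : StrictMono (LinearOrderedCommGroupWithZero.inl Γ₀ (WithZero (Multiplicative ℤ))) := by
    intro a b hab
    have hb : b ≠ 0 := (zero_le.trans_lt hab).ne'
    by_cases ha : a = 0
    · subst ha
      rw [map_zero, LinearOrderedCommGroupWithZero.inl_eq_coe_inlₗ hb]
      exact WithZero.zero_lt_coe _
    · rw [LinearOrderedCommGroupWithZero.inl_eq_coe_inlₗ ha,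
        LinearOrderedCommGroupWithZero.inl_eq_coe_inlₗ hb, WithZero.coe_lt_coe]
      refine Prod.Lex.toLex_lt_toLex.2 (Or.inl ?_)
      exact hab
  -- In the lexicographic product the second factor is infinitesimal with respect to the first; ε is
  -- its generator below 1.
  refine ⟨(LinearOrderedCommGroupWithZero.inl Γ₀ (WithZero (Multiplicative ℤ))).toMonoidWithZeroHom,
    LinearOrderedCommGroupWithZero.inr Γ₀ _ (WithZero.exp (-1 : ℤ)), hs, ?_, ?_, ?_⟩
  · rw [LinearOrderedCommGroupWithZero.inr_eq_coe_inrₗ hn]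
    exact WithZero.coe_ne_zero
  · rw [LinearOrderedCommGroupWithZero.inr_eq_coe_inrₗ hn, ← WithZero.coe_one, WithZero.coe_lt_coe]
    refine Prod.Lex.toLex_lt_toLex.2 (Or.inr ⟨rfl, ?_⟩)
    exact hlt
  · intro γ δ h
    have hδ : δ ≠ 0 := (zero_le.trans_lt h).ne'
    change LinearOrderedCommGroupWithZero.inl Γ₀ _ γ < _ *
      LinearOrderedCommGroupWithZero.inl Γ₀ _ δ
    rw [mul_comm, LinearOrderedCommGroupWithZero.inl_mul_inr_eq_coe_toLex hδ hn]
    by_cases hγ : γ = 0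
    · rw [hγ, map_zero]
      exact WithZero.zero_lt_coe _
    · rw [LinearOrderedCommGroupWithZero.inl_eq_coe_inlₗ hγ, WithZero.coe_lt_coe]
      refine Prod.Lex.toLex_lt_toLex.2 (Or.inl ?_)
      exact h

/-- Every non-trivial approximation type is realized by an extension to `K(x)`. -/
theorem exists_ext_apprX_eq (A : AType v₀) (hA : ¬ A.IsTrivial) : ∃ v : Ext v₀, v.apprX = A := by
  obtain ⟨φ, ε, hφ, hε0, hε1, hε⟩ := exists_infinitesimal Γ₀
  by_cases hs : A.supp.Nonempty
  -- If below every open ball of A there is a smaller closed one, the closed balls determine A: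
  -- centers and radii run through them as they shrink.
  · by_cases hop : ∀ c d, c ∈ A.openAt (v₀ d) → ∃ γ ∈ A.supp, γ < v₀ d
    · have := hs.to_subtype
      have hγ0 : ∀ γ : A.supp, φ γ.1 ≠ 0 := by
        rintro ⟨γ, hγ⟩ h
        obtain ⟨c, d, -, hc⟩ := A.exists_of_mem_supp hγ
        rw [← map_zero φ] at h
        have h0 : γ = 0 := hφ.injective h
        rw [h0] at hc
        exact hA ((A.isTrivial_iff).2 ⟨c, hc⟩)
      choose! b e he hb using fun γ (h : γ ∈ A.supp) => A.exists_of_mem_supp h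
      have hb' : ∀ γ : A.supp, b γ ∈ A.closedAt (v₀ (e γ)) := fun γ => by
        rw [he _ γ.2]; exact hb _ γ.2
      refine exists_ext_of_eventually Filter.atBot φ hφ (fun γ : A.supp => b γ)
        (fun γ => φ γ.1) hγ0 A ?_ ?_ ?_ ?_ hA
      · intro c d hc
        filter_upwards [Filter.eventually_le_atBot (⟨v₀ d, A.mem_supp_of_mem hc⟩ : A.supp)]
          with γ hγ
        exact ⟨hφ.monotone hγ, A.sub_le_of_closedAt (hb' γ) hc (by rw [he _ γ.2]; exact hγ)⟩
      · intro c d hd hc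
        obtain ⟨δ, hδ, hδd⟩ := hop c d hc
        filter_upwards [Filter.eventually_le_atBot (⟨δ, hδ⟩ : A.supp)] with γ hγ
        have hlt : γ.1 < v₀ d := lt_of_le_of_lt hγ hδd
        refine ⟨hφ hlt, A.sub_lt_of_openAt (A.openAt_of_closedAt (hb' γ) ?_ ?_) hc⟩
        · rw [he _ γ.2]; exact hlt
        · simpa [zero_lt_iff] using hd
      · refine fun c d hd hc => Filter.Eventually.of_forall fun γ hγ => hc ?_
        exact A.closedAt_mono (hb' γ) (by rw [he _ γ.2]; exact hφ.le_iff_le.1 hγ.1) hγ.2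
      · refine fun c d hd hc => Filter.Eventually.of_forall fun γ hγ => hc ?_
        exact A.openAt_of_closedAt (hb' γ) (by rw [he _ γ.2]; exact hφ.lt_iff_lt.1 hγ.1) hγ.2
    -- Now an open ball is the smallest ball of A. Giving x - c₀ a value infinitesimally below its
    -- radius keeps it above all smaller values of K.
    · push Not at hop
      obtain ⟨c₀, d₀, h₀, hmin⟩ := hop
      have hd₀ : φ (v₀ d₀) ≠ 0 := by
        rw [map_ne_zero, Valuation.ne_zero_iff]
        rintro rfl
        simp [AType.openAt_zero] at h₀
      have hle : ∀ d, ε * φ (v₀ d₀) ≤ φ (v₀ d) → v₀ d₀ ≤ v₀ d := fun d h =>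
        le_of_not_gt fun h' => (hε _ _ h').not_ge h
      have hlt : ∀ d, v₀ d₀ ≤ v₀ d → ε * φ (v₀ d₀) < φ (v₀ d) := fun d h =>
        ((mul_lt_iff_lt_one_left (zero_lt_iff.2 hd₀)).2 hε1).trans_le (hφ.monotone h)
      refine exists_ext_of_eventually (⊤ : Filter Unit) φ hφ (fun _ => c₀)
        (fun _ => ε * φ (v₀ d₀)) (fun _ => mul_ne_zero hε0 hd₀) A ?_ ?_ ?_ ?_ hA
      · refine fun c d hc => Filter.Eventually.of_forall fun _ => ?_
        have h := hmin _ (A.mem_supp_of_mem hc)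
        exact ⟨(hlt d h).le, A.sub_le_of_closedAt (A.closedAt_of_openAt h₀ h (by simp)) hc le_rfl⟩
      · refine fun c d hd hc => Filter.Eventually.of_forall fun _ => ?_
        have hd' : 0 < v₀ d := by simpa [zero_lt_iff] using hd
        have h := hmin _ (A.mem_supp_of_mem (A.closedAt_of_openAt hc le_rfl
          (c' := c) (by simp)))
        exact ⟨hlt d h, A.sub_lt_of_openAt (A.openAt_mono h₀ h (by simpa using hd')) hc⟩
      · refine fun c d hd hc => Filter.Eventually.of_forall fun _ h => hc ?_
        exact A.closedAt_of_openAt h₀ (hle d h.1) h.2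
      · refine fun c d hd hc => Filter.Eventually.of_forall fun _ h => hc ?_
        exact A.openAt_mono h₀ (hle d h.1.le) h.2
  -- A is empty, so the value of x has to exceed all values of K. The factor ε⁻¹ makes this strict
  -- even when the group of units of Γ₀ is trivial.
  · have hcl : ∀ c d, c ∉ A.closedAt (v₀ d) := fun c d h => hs ⟨_, A.mem_supp_of_mem h⟩
    have hop : ∀ c d, c ∉ A.openAt (v₀ d) := fun c d h =>
      hcl c d (A.closedAt_of_openAt h le_rfl (by simp))
    have key : ∀ d : K, d ≠ 0 → ∀ᶠ i : Γ₀ˣ in Filter.atTop, φ (v₀ d) < φ i * ε⁻¹ := by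
      intro d hd
      have hd' : v₀ d ≠ 0 := by simpa using hd
      filter_upwards [Filter.eventually_ge_atTop (Units.mk0 _ hd')] with i hi
      have hi' : φ (v₀ d) ≤ φ i := hφ.monotone (by simpa using Units.val_le_val.2 hi)
      refine hi'.trans_lt ?_
      rw [lt_mul_inv_iff₀ (zero_lt_iff.2 hε0), mul_lt_iff_lt_one_right]
      · exact hε1
      · rw [zero_lt_iff, map_ne_zero]
        exact i.ne_zero
    refine exists_ext_of_eventually (Filter.atTop : Filter Γ₀ˣ) φ hφ (fun _ => 0)
      (fun γ => φ γ * ε⁻¹) (fun γ => mul_ne_zero ((map_ne_zero _).2 γ.ne_zero) (inv_ne_zero hε0))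
      A ?_ ?_ ?_ ?_ hA
    · exact fun c d h => (hcl c d h).elim
    · exact fun c d _ h => (hop c d h).elim
    · intro c d hd _
      filter_upwards [key d hd] with i hi h using hi.not_ge h.1
    · intro c d hd _
      filter_upwards [key d hd] with i hi h using hi.not_gt h.1

end Realize

/-! ### Consequences of density in the algebraic closure -/

section Dense

open Polynomial

variable {K Γ₀ : Type*} [Field K] [LinearOrderedCommGroupWithZero Γ₀] {v₀ : Valuation K Γ₀}

theorem denseInAlgClosure_of_isAlgClosed [IsAlgClosed K] (v₀ : Valuation K Γ₀) :
    DenseInAlgClosure v₀ := by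
  have hb : Function.Bijective (algebraMap K (AlgebraicClosure K)) :=
    IsAlgClosed.algebraMap_bijective_of_isIntegral
  let e : K ≃+* AlgebraicClosure K := RingEquiv.ofBijective _ hb
  refine ⟨v₀.valuationSubring.comap (e.symm : AlgebraicClosure K →+* K), ⟨?_⟩, fun a b hb0 => ?_⟩
  · rw [Valuation.isEquiv_iff_val_le_one]
    intro a
    rw [Valuation.comap_apply, ValuationSubring.valuation_le_one_iff, ValuationSubring.mem_comap]
    have : (e.symm : AlgebraicClosure K →+* K) (algebraMap K (AlgebraicClosure K) a) = a :=
      e.symm_apply_apply a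
    rw [this, Valuation.mem_valuationSubring_iff]
  · obtain ⟨c, rfl⟩ := hb.2 a
    refine ⟨c, ?_⟩
    rw [sub_self, map_zero, zero_lt_iff, Valuation.ne_zero_iff]
    exact hb0

/-- An element of K that approximates an n-th root z of a better than 0 does has the same value as
z. -/
theorem DenseInAlgClosure.divisibleValueGroup (h : DenseInAlgClosure v₀) :
    DivisibleValueGroup v₀ := by
  obtain ⟨W, hW, hd⟩ := h
  intro n hn a ha
  obtain ⟨z, hz⟩ := IsAlgClosed.exists_pow_nat_eq (algebraMap K (AlgebraicClosure K) a) hn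
  have hz0 : z ≠ 0 := by
    rintro rfl
    rw [zero_pow hn.ne'] at hz
    exact ha ((map_eq_zero _).1 hz.symm)
  obtain ⟨c, hc⟩ := hd z z hz0
  refine ⟨c, ?_⟩
  rw [W.valuation.map_sub_swap] at hc
  have h1 : W.valuation (algebraMap K _ c) = W.valuation z :=
    W.valuation.map_eq_of_sub_lt hc
  rw [← map_pow, ← Valuation.HasExtension.val_map_eq_iff v₀ W.valuation, map_pow, map_pow, h1,
    ← hz, map_pow]

/-- Lift a monic irreducible polynomial to the valuation ring. A root of the lift in the algebraic
closure is integral, hence lies in the integrally closed ring W, and an element of K congruent to it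
modulo the maximal ideal has a residue that is a root. -/
theorem DenseInAlgClosure.isAlgClosed_residue (h : DenseInAlgClosure v₀) :
    IsAlgClosed (Residue v₀) := by
  obtain ⟨W, hW, hd⟩ := h
  refine IsAlgClosed.of_exists_root _ fun p hp hirr => ?_
  have hl : p ∈ lifts (IsLocalRing.residue v₀.valuationSubring) := by
    rw [lifts_iff_coeff_lifts]
    exact fun n => IsLocalRing.residue_surjective _
  obtain ⟨F, hFp, hFd, hF⟩ := lifts_and_natDegree_eq_and_monic hl hp
  let j : v₀.valuationSubring →+* W :=
    ((algebraMap K (AlgebraicClosure K)).comp v₀.valuationSubring.subtype).codRestrict W.toSubring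
      fun a => by
        change algebraMap K (AlgebraicClosure K) a ∈ W
        rw [← W.valuation_le_one_iff, Valuation.HasExtension.val_map_le_one_iff v₀ W.valuation]
        exact a.2
  have hj : ∀ a, ((j a : W) : AlgebraicClosure K) = algebraMap K _ (a : K) := fun a => rfl
  have hGm : (F.map j).Monic := hF.map j
  have hdeg : ((F.map j).map (algebraMap W (AlgebraicClosure K))).degree ≠ 0 := by
    rw [(hGm).degree_map, hF.degree_map]
    rw [degree_eq_natDegree hF.ne_zero, hFd, ← degree_eq_natDegree hp.ne_zero]
    exact hirr.degree_pos.ne'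
  obtain ⟨α, hα⟩ := IsAlgClosed.exists_root _ hdeg
  have hint : IsIntegral W α := ⟨F.map j, hGm, by rw [← eval_map]; exact hα⟩
  obtain ⟨β, rfl⟩ := IsIntegrallyClosed.isIntegral_iff.1 hint
  have hβ : (F.map j).eval β = 0 := by
    rw [IsRoot, eval_map_apply] at hα
    exact (map_eq_zero_iff _ (IsFractionRing.injective W _)).1 hα
  obtain ⟨c, hc⟩ := hd (algebraMap W _ β) 1 one_ne_zero
  rw [map_one] at hc
  have hc1 : v₀ c ≤ 1 := by
    rw [← Valuation.HasExtension.val_map_le_one_iff v₀ W.valuation]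
    have : algebraMap K (AlgebraicClosure K) c =
      algebraMap W _ β - (algebraMap W _ β - algebraMap K _ c) := by ring
    rw [this]
    exact W.valuation.map_sub_le (W.valuation_le_one β) hc.le
  refine ⟨IsLocalRing.residue _ (⟨c, hc1⟩ : v₀.valuationSubring), ?_⟩
  rw [← hFp, eval_map_apply, IsLocalRing.residue_eq_zero_iff]
  set c' : v₀.valuationSubring := ⟨c, hc1⟩
  obtain ⟨q, hq⟩ := sub_dvd_eval_sub β (j c') (F.map j)
  rw [hβ, eval_map_apply, zero_sub] at hq
  have h1 : W.valuation (algebraMap K _ ((F.eval c' : v₀.valuationSubring) : K)) < 1 := by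
    rw [← hj, ← Valuation.map_neg]
    have h2 : -((j (F.eval c') : W) : AlgebraicClosure K) =
        (algebraMap W _ β - algebraMap K _ c) * q :=
      congrArg (fun z : W => (z : AlgebraicClosure K)) hq
    rw [h2, map_mul]
    exact mul_lt_one_of_lt_of_le hc (W.valuation_le_one q)
  rw [Valuation.HasExtension.val_map_lt_one_iff v₀ W.valuation] at h1
  exact (Valuation.mem_maximalIdeal_iff _ _).2 h1

/-- A product of linear factors depends continuously on its roots for the Gauss valuation, so the
roots can be moved into K one at a time. -/
theorem exists_prod_approx {k Γ : Type*} [Field k] [Algebra K k]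
    [LinearOrderedCommGroupWithZero Γ] (w : Valuation k Γ)
    (hd : ∀ a : k, ∀ η : Γ, η ≠ 0 → ∃ c : K, w (a - algebraMap K k c) < η) (γ : Γ) (hγ : γ ≠ 0)
    (s : Multiset k) : ∀ η : Γ, η ≠ 0 → ∃ t : Multiset K, t.card = s.card ∧
      gaussVal w γ hγ ((s.map fun r => X - C r).prod -
        (t.map fun c => X - C (algebraMap K k c)).prod) < η := by
  have hX : ∀ a : k, gaussVal w γ hγ (X - C a) ≠ 0 := fun a =>
    gaussVal_ne_zero w γ hγ (X_sub_C_ne_zero a)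
  induction s using Multiset.induction_on with
  | empty => exact fun η hη => ⟨0, rfl, by simpa [zero_lt_iff] using hη⟩
  | cons r s ih =>
    intro η hη
    obtain ⟨t, ht, h⟩ := ih (η / gaussVal w γ hγ (X - C r)) (div_ne_zero hη (hX r))
    have hP : (t.map fun c => X - C (algebraMap K k c)).prod ≠ 0 := by
      refine Multiset.prod_ne_zero ?_
      simp only [Multiset.mem_map, not_exists, not_and]
      exact fun c _ => X_sub_C_ne_zero _
    set P := (t.map fun c => X - C (algebraMap K k c)).prod
    set Q := (s.map fun r => X - C r).prod
    have hP' := gaussVal_ne_zero w γ hγ hP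
    obtain ⟨c, hc⟩ := hd r (η / gaussVal w γ hγ P) (div_ne_zero hη hP')
    refine ⟨c ::ₘ t, by simp [ht], ?_⟩
    rw [Multiset.map_cons, Multiset.map_cons, Multiset.prod_cons, Multiset.prod_cons]
    have : (X - C r) * Q - (X - C (algebraMap K k c)) * P =
        (X - C r) * (Q - P) - C (r - algebraMap K k c) * P := by
      rw [C_sub]; ring
    rw [this]
    refine (Valuation.map_sub _ _ _).trans_lt (max_lt ?_ ?_)
    · rw [map_mul, mul_comm, ← lt_div_iff₀ (zero_lt_iff.2 (hX r))]
      exact h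
    · rw [map_mul, gaussVal_C, ← lt_div_iff₀ (zero_lt_iff.2 hP')]
      exact hc

/-- The weights mⁱ turn the coefficient bound into a bound at all points of value at most that of m.
The tolerance a eⁿ is a lower bound for a ∏ (y - c) at points y whose distance from all c is at
least the value of e. -/
theorem DenseInAlgClosure.exists_coeff_approx (h : DenseInAlgClosure v₀) {f : K[X]} (hf : f ≠ 0)
    {e m : K} (he : e ≠ 0) (hm : m ≠ 0) : ∃ (a : K) (t : Multiset K), a ≠ 0 ∧
      ∀ i, v₀ ((f - C a * (t.map fun c => X - C c).prod).coeff i * m ^ i) <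
        v₀ (a * e ^ t.card) := by
  obtain ⟨W, hW, hd⟩ := h
  set k := AlgebraicClosure K
  have hd' : ∀ a : k, ∀ η : W.ValueGroup, η ≠ 0 →
      ∃ c : K, W.valuation (a - algebraMap K k c) < η := by
    intro a η hη
    obtain ⟨b, rfl⟩ := W.valuation_surjective η
    exact hd a b (by simpa using hη)
  have hγ : W.valuation (algebraMap K k m) ≠ 0 := by simpa using hm
  have ha : f.leadingCoeff ≠ 0 := by simpa using hf
  have hsp := (IsAlgClosed.splits (f.map (algebraMap K k))).eq_prod_roots
  obtain ⟨t, ht, hlt⟩ := exists_prod_approx W.valuation hd' _ hγ (f.map (algebraMap K k)).roots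
    (W.valuation (algebraMap K k (e ^ (f.map (algebraMap K k)).roots.card))) (by
      rw [Valuation.ne_zero_iff, _root_.map_ne_zero]; exact pow_ne_zero _ he)
  refine ⟨f.leadingCoeff, t, ha, fun i => ?_⟩
  rw [← Valuation.HasExtension.val_map_lt_iff v₀ W.valuation, ht]
  have hdiff : (f - C f.leadingCoeff * (t.map fun c => X - C c).prod).map (algebraMap K k) =
      C (algebraMap K k f.leadingCoeff) * (((f.map (algebraMap K k)).roots.map fun r => X - C r).prod -
        (t.map fun c => X - C (algebraMap K k c)).prod) := by
    rw [mul_sub]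
    rw [Polynomial.map_sub, leadingCoeff_map] at *
    conv_lhs => rw [hsp]
    rw [Polynomial.map_mul, map_C, Polynomial.map_multiset_prod, Multiset.map_map]
    simp
  rw [map_mul, map_mul, ← coeff_map, hdiff, coeff_C_mul, map_mul, mul_assoc, map_mul, map_mul,
    mul_lt_mul_iff_right₀ (zero_lt_iff.2 (by simpa using hf)), map_pow, map_pow]
  exact (le_gaussFun W.valuation _ _ i).trans_lt hlt

theorem val_aeval_lt {L Γ : Type*} [Field L] [Algebra K L] [LinearOrderedCommGroupWithZero Γ]
    (v : Valuation L Γ) [v₀.HasExtension v] {h : K[X]} {m η : K} (hη : η ≠ 0)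
    (H : ∀ i, v₀ (h.coeff i * m ^ i) < v₀ η) {y : L} (hy : v y ≤ v (algebraMap K L m)) :
    v (aeval y h) < v (algebraMap K L η) := by
  rw [aeval_eq_sum_range]
  refine v.map_sum_lt (by simpa using hη) fun i _ => ?_
  have h1 := (Valuation.HasExtension.val_map_lt_iff v₀ v _ _).2 (H i)
  refine lt_of_le_of_lt ?_ h1
  rw [Algebra.smul_def, map_mul, map_mul, map_mul, map_pow, map_pow, map_pow]
  exact mul_le_mul' le_rfl (pow_le_pow_left' hy i)

theorem pow_card_le_prod_map {L Γ : Type*} [Field L] [LinearOrderedCommGroupWithZero Γ]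
    (v : Valuation L Γ) {α : Type*} (s : Multiset α) (g : α → L) (b : Γ)
    (h : ∀ a ∈ s, b ≤ v (g a)) : b ^ s.card ≤ v (s.map g).prod := by
  induction s using Multiset.induction_on with
  | empty => simp
  | cons a s ih =>
    rw [Multiset.card_cons, pow_succ', Multiset.map_cons, Multiset.prod_cons, map_mul]
    exact mul_le_mul' (h a (by simp)) (ih fun a ha => h a (by simp [ha]))

/-- Over a field that is dense in its algebraic closure, polynomials can be approximated by
products of linear factors, uniformly at all points of bounded value that are bounded away
from the roots. -/
theorem DenseInAlgClosure.exists_linear_approx (h : DenseInAlgClosure v₀) {f : K[X]} (hf : f ≠ 0)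
    {e m : K} (he : e ≠ 0) (hm : m ≠ 0) : ∃ (a : K) (t : Multiset K), a ≠ 0 ∧
      ∀ (v : Ext v₀) (y : RatFunc K), v.val y ≤ v.val (algebraMap K _ m) →
        (∀ c ∈ t, v.val (algebraMap K _ e) ≤ v.val (y - algebraMap K _ c)) →
        v.val (aeval y f - algebraMap K _ a * (t.map fun c => y - algebraMap K _ c).prod) <
          v.val (algebraMap K _ a * (t.map fun c => y - algebraMap K _ c).prod) := by
  obtain ⟨a, t, ha, H⟩ := h.exists_coeff_approx hf he hm
  refine ⟨a, t, ha, fun v y hy hc => ?_⟩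
  have h1 := val_aeval_lt v.val (mul_ne_zero ha (pow_ne_zero _ he)) H hy
  have h2 : aeval y (f - C a * (t.map fun c => X - C c).prod) =
      aeval y f - algebraMap K _ a * (t.map fun c => y - algebraMap K _ c).prod := by
    rw [map_sub, map_mul, aeval_C, map_multiset_prod, Multiset.map_map]
    simp
  rw [← h2]
  refine h1.trans_le ?_
  rw [map_mul, map_mul, map_mul, map_pow, map_pow]
  exact mul_le_mul' le_rfl (pow_card_le_prod_map _ _ _ _ hc)

/-- Polynomials are Lipschitz continuous and bounded on bounded sets. -/
theorem exists_lipschitz (v₀ : Valuation K Γ₀) (f : K[X]) (m : K) : ∃ B : K, B ≠ 0 ∧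
    ∀ (v : Ext v₀) (y z : RatFunc K), v.val y ≤ v.val (algebraMap K _ m) →
      v.val z ≤ v.val (algebraMap K _ m) → v.val (aeval y f) ≤ v.val (algebraMap K _ B) ∧
        v.val (aeval y f - aeval z f) ≤ v.val (algebraMap K _ B) * v.val (y - z) := by
  -- The bound must serve all extensions simultaneously, so the larger of two constants is selected
  -- by v₀ alone.
  have hmax : ∀ a b : K, a ≠ 0 → b ≠ 0 → ∃ c : K, c ≠ 0 ∧ ∀ v : Ext v₀,
      v.val (algebraMap K _ a) ≤ v.val (algebraMap K _ c) ∧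
      v.val (algebraMap K _ b) ≤ v.val (algebraMap K _ c) := by
    intro a b ha hb
    rcases le_total (v₀ a) (v₀ b) with h | h
    · exact ⟨b, hb, fun v => ⟨(Valuation.HasExtension.val_map_le_iff v₀ v.val _ _).2 h, le_rfl⟩⟩
    · exact ⟨a, ha, fun v => ⟨le_rfl, (Valuation.HasExtension.val_map_le_iff v₀ v.val _ _).2 h⟩⟩
  induction f using Polynomial.induction_on with
  | C a =>
    by_cases ha : a = 0
    · exact ⟨1, one_ne_zero, fun v y z _ _ => by simp [ha]⟩
    · exact ⟨a, ha, fun v y z _ _ => by simp⟩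
  | add p q hp hq =>
    obtain ⟨B, hB, h1⟩ := hp
    obtain ⟨B', hB', h2⟩ := hq
    obtain ⟨c, hc, h3⟩ := hmax B B' hB hB'
    refine ⟨c, hc, fun v y z hy hz => ?_⟩
    obtain ⟨h1, h1'⟩ := h1 v y z hy hz
    obtain ⟨h2, h2'⟩ := h2 v y z hy hz
    obtain ⟨h3, h3'⟩ := h3 v
    rw [map_add (aeval y), map_add (aeval z), add_sub_add_comm]
    exact ⟨v.val.map_add_le (h1.trans h3) (h2.trans h3'),
      v.val.map_add_le (h1'.trans (mul_le_mul' h3 le_rfl)) (h2'.trans (mul_le_mul' h3' le_rfl))⟩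
  | monomial n a h =>
    obtain ⟨B, hB, h1⟩ := h
    obtain ⟨m', hm', h2⟩ : ∃ m' : K, m' ≠ 0 ∧ ∀ v : Ext v₀,
        v.val (algebraMap K _ m) ≤ v.val (algebraMap K _ m') := by
      by_cases hm : m = 0
      · exact ⟨1, one_ne_zero, fun v => by simp [hm]⟩
      · exact ⟨m, hm, fun v => le_rfl⟩
    obtain ⟨c, hc, h3⟩ := hmax (B * m') B (mul_ne_zero hB hm') hB
    refine ⟨c, hc, fun v y z hy hz => ?_⟩
    obtain ⟨h1, h1'⟩ := h1 v y z hy hz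
    obtain ⟨h3, h3'⟩ := h3 v
    rw [map_mul, map_mul] at h3
    have e1 : ∀ y : RatFunc K, aeval y (C a * X ^ (n + 1)) = aeval y (C a * X ^ n) * y := by
      intro y; rw [pow_succ, ← mul_assoc, map_mul, aeval_X]
    rw [e1, e1]
    constructor
    · rw [map_mul]
      exact (mul_le_mul' h1 (hy.trans (h2 v))).trans h3
    · have e2 : aeval y (C a * X ^ n) * y - aeval z (C a * X ^ n) * z =
          aeval y (C a * X ^ n) * (y - z) + (aeval y (C a * X ^ n) - aeval z (C a * X ^ n)) * z := by
        ring
      rw [e2]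
      refine v.val.map_add_le ?_ ?_
      · rw [map_mul]
        exact mul_le_mul' (h1.trans h3') le_rfl
      · rw [map_mul]
        refine (mul_le_mul' h1' (hz.trans (h2 v))).trans ?_
        rw [mul_right_comm]
        exact mul_le_mul' h3 le_rfl

end Dense

/-! ### Criteria for the three kinds of extensions -/

section Kinds

variable {K L Γ₀ Γ : Type*} [Field K] [Field L] [Algebra K L]
  [LinearOrderedCommGroupWithZero Γ₀] [LinearOrderedCommGroupWithZero Γ]
  {v₀ : Valuation K Γ₀} {v : Valuation L Γ} [v₀.HasExtension v]

theorem val_eq_of_sub_lt {u a : L} (h : v (u - a) < v a) : v u = v a :=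
  v.map_eq_of_sub_lt h

theorem residue_eq_of_sub_lt {u : L} (hu : v u ≤ 1) {a : K} (h : v (u - algebraMap K L a) < 1) :
    ∃ ha : v₀ a ≤ 1, IsLocalRing.residue v.valuationSubring ⟨u, hu⟩ =
      algebraMap (Residue v₀) (Residue v)
        (IsLocalRing.residue v₀.valuationSubring ⟨a, ha⟩) := by
  have ha : v₀ a ≤ 1 := by
    rw [← Valuation.HasExtension.val_map_le_one_iff v₀ v, ← sub_sub_cancel u (algebraMap K L a)]
    exact v.map_sub_le hu h.le
  refine ⟨ha, ?_⟩
  rw [Valuation.HasExtension.algebraMap_residue_eq_residue_algebraMap, ← sub_eq_zero, ← map_sub,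
    IsLocalRing.residue_eq_zero_iff]
  exact (Valuation.mem_maximalIdeal_iff _ _).2 h

theorem isAlgebraic_of_surjective {A B : Type*} [Field A] [Field B] [Algebra A B]
    (h : Function.Surjective (algebraMap A B)) : Algebra.IsAlgebraic A B :=
  ⟨fun y => by obtain ⟨x, rfl⟩ := h y; exact isAlgebraic_algebraMap x⟩

theorem residue_surjective_of (h : ∀ u : L, v u = 1 → ∃ a : K, v (u - algebraMap K L a) < 1) :
    Function.Surjective (algebraMap (Residue v₀) (Residue v)) := by
  intro y
  obtain ⟨⟨u, hu⟩, rfl⟩ := IsLocalRing.residue_surjective y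
  rcases lt_or_eq_of_le ((Valuation.mem_valuationSubring_iff v u).1 hu) with h1 | h1
  · refine ⟨0, ?_⟩
    rw [map_zero, eq_comm, IsLocalRing.residue_eq_zero_iff]
    exact (Valuation.mem_maximalIdeal_iff _ _).2 h1
  · obtain ⟨a, ha⟩ := h u h1
    obtain ⟨ha', h2⟩ := residue_eq_of_sub_lt (v₀ := v₀) hu ha
    exact ⟨_, h2.symm⟩

theorem mem_baseValueGroup_iff (u : Lˣ) :
    (⟨Units.map v.toMonoidWithZeroHom.toMonoidHom u, u, rfl⟩ : valueGroup v) ∈ baseValueGroup K v ↔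
      ∃ a : K, v (u : L) = v (algebraMap K L a) := by
  rw [baseValueGroup, Subgroup.mem_subgroupOf]
  constructor
  · rintro ⟨a, ha⟩
    refine ⟨a, ?_⟩
    have := congrArg (fun z : Γˣ => (z : Γ)) ha
    exact this.symm
  · rintro ⟨a, ha⟩
    have ha0 : a ≠ 0 := by
      rintro rfl
      rw [map_zero, map_zero, v.zero_iff] at ha
      exact u.ne_zero ha
    exact ⟨Units.mk0 a ha0, Units.ext ha.symm⟩

theorem baseValueGroup_eq_top (h : ∀ u : L, u ≠ 0 → ∃ a : K, v u = v (algebraMap K L a)) :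
    baseValueGroup K v = ⊤ := by
  rw [eq_top_iff]
  rintro ⟨_, u, rfl⟩ -
  exact (mem_baseValueGroup_iff u).2 (h u u.ne_zero)

theorem isImmediateExt_of
    (h : ∀ u : L, u ≠ 0 → ∃ a : K, v (u - algebraMap K L a) < v (algebraMap K L a)) :
    IsImmediateExt v₀ v := by
  refine ⟨baseValueGroup_eq_top fun u hu => ?_, residue_surjective_of fun u hu => ?_⟩
  · obtain ⟨a, ha⟩ := h u hu
    exact ⟨a, val_eq_of_sub_lt ha⟩
  · obtain ⟨a, ha⟩ := h u (by rintro rfl; simp at hu)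
    exact ⟨a, by rwa [← val_eq_of_sub_lt ha, hu] at ha⟩

theorem rationalRank_of_zpowers_eq_top {G : Type*} [CommGroup G] (g : G)
    (hg : Subgroup.zpowers g = ⊤) (hinf : ¬ IsOfFinOrder g) : rationalRank G = 1 := by
  have : Infinite G := by
    rw [← Set.infinite_univ_iff, ← Subgroup.coe_top, ← hg]
    exact infinite_zpowers.2 hinf
  have e : Additive G ≃+ ℤ :=
    (MulEquiv.toAdditive (intEquivOfZPowersEqTop g hg)).symm.trans
      (AddEquiv.additiveMultiplicative ℤ)
  have e2 : TensorProduct ℤ ℚ (Additive G) ≃ₗ[ℚ] ℚ :=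
    (TensorProduct.AlgebraTensorModule.congr (LinearEquiv.refl ℚ ℚ) e.toIntLinearEquiv).trans
      (TensorProduct.AlgebraTensorModule.rid ℤ ℚ ℚ)
  have := e2.lift_rank_eq
  rw [Module.rank_self, Cardinal.lift_one] at this
  rw [rationalRank]
  exact Cardinal.lift_eq_one.1 this

theorem rationalRank_of_subsingleton {G : Type*} [CommGroup G] [Subsingleton G] :
    rationalRank G = 0 := by
  have : Subsingleton (Additive G) := ‹Subsingleton G›
  have : Subsingleton (TensorProduct ℤ ℚ (Additive G)) := by
    refine subsingleton_of_forall_eq 0 fun z => ?_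
    induction z using TensorProduct.induction_on with
    | zero => rfl
    | tmul x y => rw [Subsingleton.elim y 0, TensorProduct.tmul_zero]
    | add x y hx hy => rw [hx, hy, add_zero]
  exact rank_subsingleton' ℚ _

theorem val_zpow_eq_iff {t : L}
    (htr : ∀ n : ℕ, 0 < n → ∀ d : K, v t ^ n ≠ v (algebraMap K L d)) {k : ℤ} {a : K}
    (h : v (t ^ k) = v (algebraMap K L a)) : k = 0 := by
  rcases lt_trichotomy k 0 with hk | hk | hk
  · obtain ⟨n, rfl⟩ : ∃ n : ℕ, k = -(n : ℤ) := ⟨k.natAbs, by omega⟩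
    refine absurd ?_ (htr n (by omega) a⁻¹)
    rw [map_inv₀, map_inv₀, ← h, zpow_neg, map_inv₀, inv_inv, zpow_natCast, map_pow]
  · exact hk
  · obtain ⟨n, rfl⟩ : ∃ n : ℕ, k = (n : ℤ) := ⟨k.natAbs, by omega⟩
    refine absurd ?_ (htr n (by omega) a)
    rw [← h, zpow_natCast, map_pow]

/-- Every u is some a tᵏ up to a principal unit, so vt generates vL/vK, which is infinite cyclic and
has rational rank 1. If u has value 1, then k = 0, so the residue field does not grow. -/
theorem isValueTransExt_of {t : L} (ht : t ≠ 0)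
    (htr : ∀ n : ℕ, 0 < n → ∀ d : K, v t ^ n ≠ v (algebraMap K L d))
    (h : ∀ u : L, u ≠ 0 → ∃ (a : K) (k : ℤ), a ≠ 0 ∧
      v (u - algebraMap K L a * t ^ k) < v (algebraMap K L a * t ^ k)) :
    IsValueTransExt v₀ v := by
  constructor
  · set τ : valueGroup v := ⟨Units.map v.toMonoidWithZeroHom.toMonoidHom (Units.mk0 t ht), _, rfl⟩
    refine rationalRank_of_zpowers_eq_top (QuotientGroup.mk τ : ValueQuotient K v) ?_ ?_
    · rw [eq_top_iff]
      rintro ⟨_, u, rfl⟩ -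
      obtain ⟨a, k, ha, hlt⟩ := h u u.ne_zero
      refine ⟨k, ?_⟩
      change (QuotientGroup.mk τ : ValueQuotient K v) ^ k = QuotientGroup.mk _
      rw [← QuotientGroup.mk_zpow, QuotientGroup.eq]
      have hm := (mem_baseValueGroup_iff (K := K) (v := v) ((Units.mk0 t ht ^ k)⁻¹ * u)).2
        ⟨a, ?_⟩
      · convert hm using 1
        apply Subtype.ext
        simp [τ]
      · have h1 := val_eq_of_sub_lt hlt
        rw [map_mul] at h1
        have h2 : v (t ^ k) ≠ 0 := (Valuation.ne_zero_iff _).2 (zpow_ne_zero _ ht)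
        push_cast
        rw [map_mul, h1, Units.val_mk0, map_inv₀]
        field_simp
    · rw [isOfFinOrder_iff_pow_eq_one]
      rintro ⟨n, hn, h1⟩
      rw [← QuotientGroup.mk_pow, QuotientGroup.eq_one_iff] at h1
      have h2 : τ ^ n = ⟨Units.map v.toMonoidWithZeroHom.toMonoidHom (Units.mk0 t ht ^ n), _, rfl⟩ := by
        apply Subtype.ext
        simp [τ]
      rw [h2] at h1
      obtain ⟨a, ha⟩ := (mem_baseValueGroup_iff _).1 h1
      refine htr n hn a ?_
      rw [← ha]
      simp
  · have hs : Function.Surjective (algebraMap (Residue v₀) (Residue v)) := by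
      refine residue_surjective_of fun u hu => ?_
      obtain ⟨a, k, ha, hlt⟩ := h u (by rintro rfl; simp at hu)
      have h1 := val_eq_of_sub_lt hlt
      have hk : k = 0 := by
        refine val_zpow_eq_iff htr (a := a⁻¹) ?_
        have : v (algebraMap K L a) ≠ 0 := by simpa using ha
        rw [hu, map_mul] at h1
        rw [map_inv₀, map_inv₀]
        exact (eq_inv_of_mul_eq_one_right h1.symm)
      rw [← h1, hu, hk] at hlt
      exact ⟨a, by simpa using hlt⟩
    exact isAlgebraic_of_surjective hs

/-- One generator bounds the transcendence degree by 1 and its transcendence makes it nonzero, while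
vL/vK is trivial and hence torsion. -/
theorem isResidueTransExt_of {τ : Residue v} (hτ : Transcendental (Residue v₀) τ)
    (hval : ∀ u : L, u ≠ 0 → ∃ a : K, v u = v (algebraMap K L a))
    (hres : ∀ y : Residue v, y ∈ IntermediateField.adjoin (Residue v₀) {τ}) :
    IsResidueTransExt v₀ v := by
  constructor
  · have halg : Algebra.IsAlgebraic (Algebra.adjoin (Residue v₀) {τ}) (Residue v) := by
      refine ⟨fun y => ?_⟩
      obtain ⟨r, s, rfl⟩ := (IntermediateField.mem_adjoin_simple_iff _ _).1 (hres y)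
      have h1 : ∀ p : Polynomial (Residue v₀),
          IsAlgebraic (Algebra.adjoin (Residue v₀) {τ}) (Polynomial.aeval τ p) := fun p =>
        isAlgebraic_algebraMap
          (⟨_, Polynomial.aeval_mem_adjoin_singleton _ _⟩ : Algebra.adjoin (Residue v₀) {τ})
      rw [div_eq_mul_inv]
      exact (h1 r).mul (h1 s).inv
    refine le_antisymm ?_ ?_
    · simpa using Algebra.IsAlgebraic.trdeg_le_cardinalMk (Residue v₀) ({τ} : Set (Residue v))
    · rw [Cardinal.one_le_iff_ne_zero, trdeg_ne_zero_iff]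
      exact ⟨⟨τ, hτ⟩⟩
  · intro g
    obtain ⟨g, rfl⟩ := QuotientGroup.mk_surjective g
    have : (QuotientGroup.mk g : ValueQuotient K v) = 1 := by
      rw [QuotientGroup.eq_one_iff, baseValueGroup_eq_top hval]
      trivial
    rw [this]
    exact IsOfFinOrder.one

theorem not_immediate_and_valueTrans : ¬ (IsImmediateExt v₀ v ∧ IsValueTransExt v₀ v) := by
  rintro ⟨⟨h1, -⟩, h2, -⟩
  have : Subsingleton (ValueQuotient K v) := by
    rw [ValueQuotient, h1]
    exact QuotientGroup.subsingleton_quotient_top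
  rw [rationalRank_of_subsingleton] at h2
  exact zero_ne_one h2

theorem not_valueTrans_and_residueTrans : ¬ (IsValueTransExt v₀ v ∧ IsResidueTransExt v₀ v) := by
  rintro ⟨⟨-, h1⟩, h2, -⟩
  rw [trdeg_eq_zero] at h2
  exact zero_ne_one h2

theorem not_immediate_and_residueTrans : ¬ (IsImmediateExt v₀ v ∧ IsResidueTransExt v₀ v) := by
  rintro ⟨⟨-, h1⟩, h2, -⟩
  have := isAlgebraic_of_surjective h1
  rw [trdeg_eq_zero] at h2
  exact zero_ne_one h2

end Kinds

/-! ### Kinds of approximation types in terms of best approximations -/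

section Centers

variable {K Γ₀ : Type*} [Field K] [LinearOrderedCommGroupWithZero Γ₀] {v₀ : Valuation K Γ₀}

theorem Ext.val_le_iff (v : Ext v₀) (a b : K) :
    v.val (algebraMap K _ a) ≤ v.val (algebraMap K _ b) ↔ v₀ a ≤ v₀ b :=
  Valuation.HasExtension.val_map_le_iff v₀ v.val a b

theorem Ext.val_lt_iff (v : Ext v₀) (a b : K) :
    v.val (algebraMap K _ a) < v.val (algebraMap K _ b) ↔ v₀ a < v₀ b :=
  Valuation.HasExtension.val_map_lt_iff v₀ v.val a b

theorem Ext.val_eq_iff (v : Ext v₀) (a b : K) :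
    v.val (algebraMap K _ a) = v.val (algebraMap K _ b) ↔ v₀ a = v₀ b :=
  Valuation.HasExtension.val_map_eq_iff v₀ v.val a b

theorem xSub_sub_xSub (b c : K) : xSub c - xSub b = algebraMap K _ (b - c) := by
  rw [xSub, xSub, map_sub]; ring

theorem xSub_sub_algebraMap (b c : K) : xSub c - algebraMap K _ (b - c) = xSub b := by
  rw [xSub, xSub, map_sub]; ring

theorem Ext.val_xSub_eq (v : Ext v₀) {b c : K} (h : v.val (xSub b) < v.val (xSub c)) :
    v.val (xSub c) = v.val (algebraMap K _ (b - c)) := by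
  rw [← xSub_sub_xSub, Valuation.map_sub_eq_of_lt_left _ h]

theorem Ext.apprX_le_iff {v v' : Ext v₀} (h : v'.apprX = v.apprX) (c d : K) :
    v'.val (xSub c) ≤ v'.val (algebraMap K _ d) ↔ v.val (xSub c) ≤ v.val (algebraMap K _ d) := by
  rw [← mem_closedAt_apprX, ← mem_closedAt_apprX, h]

theorem Ext.apprX_lt_iff {v v' : Ext v₀} (h : v'.apprX = v.apprX) (c d : K) :
    v'.val (xSub c) < v'.val (algebraMap K _ d) ↔ v.val (xSub c) < v.val (algebraMap K _ d) := by
  rw [← mem_openAt_apprX, ← mem_openAt_apprX, h]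

/-- An element of `K` is a center if it is a best approximation to `x`. -/
def Ext.IsCenter (v : Ext v₀) (b : K) : Prop := ∀ c, v.val (xSub b) ≤ v.val (xSub c)

/-- If c is closer to x than b, then x - b and c - b have the same value, and the open ball around c
of this radius belongs to the type but misses b. -/
theorem Ext.mem_inter_apprX_iff (v : Ext v₀) (b : K) : b ∈ v.apprX.inter ↔ v.IsCenter b := by
  constructor
  · intro h c
    by_contra! hlt
    have heq := v.val_xSub_eq hlt
    have hd : c - b ≠ 0 := by
      intro h0
      rw [h0, map_zero, map_zero] at heq
      exact (val_pos v (xSub_ne_zero b)).ne' heq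
    rw [heq, ← mem_openAt_apprX, AType.mem_openAt _ _ _ hd] at hlt
    have := h _ hlt
    simp only [Ball.mkOpen, openBall, Set.mem_ofPred_eq, v₀.map_sub_swap b c] at this
    exact lt_irrefl _ this
  · intro h B hB
    obtain ⟨c, hc⟩ := B.nonempty
    rcases hk : B.kind with _ | _
    · obtain ⟨d, -, rfl⟩ := B.eq_mkClosed hk hc
      rw [← AType.mem_closedAt] at hB
      have hb : b ∈ v.apprX.closedAt (v₀ d) := by
        rw [mem_closedAt_apprX] at hB ⊢
        exact (h c).trans hB
      exact v.apprX.sub_le_of_closedAt hb hB le_rfl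
    · obtain ⟨d, hd, -, rfl⟩ := B.eq_mkOpen hk hc
      rw [← AType.mem_openAt] at hB
      have hb : b ∈ v.apprX.openAt (v₀ d) := by
        rw [mem_openAt_apprX] at hB ⊢
        exact (h c).trans_lt hB
      exact v.apprX.sub_lt_of_openAt hb hB

theorem Ext.isImmediate_apprX_iff (v : Ext v₀) :
    v.apprX.IsImmediate ↔ ∀ b, ∃ c, v.val (xSub c) < v.val (xSub b) := by
  constructor
  · rintro ⟨-, h⟩ b
    by_contra! hb
    have := (v.mem_inter_apprX_iff b).2 hb
    rw [h] at this
    exact this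
  · intro h
    have : v.apprX.inter = ∅ := by
      rw [Set.eq_empty_iff_forall_notMem]
      intro b hb
      obtain ⟨c, hc⟩ := h b
      exact hc.not_ge ((v.mem_inter_apprX_iff b).1 hb c)
    refine ⟨?_, this⟩
    -- An empty type would have intersection K, not the empty set.
    by_contra h0
    rw [Set.not_nonempty_iff_eq_empty] at h0
    have h1 : (0 : K) ∈ v.apprX.inter := fun B hB => by rw [h0] at hB; exact hB.elim
    rw [this] at h1
    exact h1

theorem Ext.isImmediate_or_exists_isCenter (v : Ext v₀) :
    v.apprX.IsImmediate ∨ ∃ b, v.IsCenter b := by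
  rw [v.isImmediate_apprX_iff]
  by_cases h : ∀ b, ∃ c, v.val (xSub c) < v.val (xSub b)
  · exact Or.inl h
  · push Not at h
    exact Or.inr h

/-- For a center b, a closed ball of the type without an open one of the same radius exists exactly
when the value of x - b is itself such a radius. -/
theorem Ext.isValueExtending_apprX_iff (v : Ext v₀) :
    v.apprX.IsValueExtending ↔
      ∃ b, v.IsCenter b ∧ ∀ d, v.val (xSub b) ≠ v.val (algebraMap K _ d) := by
  constructor
  · rintro ⟨-, h, b, hb⟩
    rw [v.mem_inter_apprX_iff] at hb
    refine ⟨b, hb, fun d hd => ?_⟩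
    obtain ⟨c, hc⟩ := h (v₀ d) (AType.mem_supp_of_mem _ ((mem_closedAt_apprX v b d).2 hd.le))
    rw [mem_openAt_apprX, ← hd] at hc
    exact hc.not_ge (hb c)
  · rintro ⟨b, hb, h⟩
    refine ⟨v.not_isTrivial_apprX, fun γ hγ => ?_, b, (v.mem_inter_apprX_iff b).2 hb⟩
    obtain ⟨c, d, rfl, hc⟩ := AType.exists_of_mem_supp _ hγ
    rw [mem_closedAt_apprX] at hc
    exact ⟨b, (mem_openAt_apprX v b d).2 (((hb c).trans hc).lt_of_ne (h d))⟩

theorem Ext.IsCenter.exists_val_eq {v : Ext v₀} {b : K} (hb : v.IsCenter b) {d : K}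
    (hd : v.val (xSub b) = v.val (algebraMap K _ d)) (c : K) :
    ∃ e, v.val (xSub c) = v.val (algebraMap K _ e) := by
  rcases (hb c).lt_or_eq with h | h
  · exact ⟨b - c, v.val_xSub_eq h⟩
  · exact ⟨d, by rw [← h, hd]⟩

/-- The condition for c = b makes the value of x - b a value of K; conversely, for a center b this
makes the value of every x - c a value of K. -/
theorem Ext.isResidueExtending_apprX_iff (v : Ext v₀) :
    v.apprX.IsResidueExtending ↔
      ∃ b, v.IsCenter b ∧ ∃ d, v.val (xSub b) = v.val (algebraMap K _ d) := by
  constructor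
  · rintro ⟨-, h, b, hb⟩
    rw [v.mem_inter_apprX_iff] at hb
    obtain ⟨γ, hγ, h1, h2⟩ := h b
    obtain ⟨c, d, rfl, -⟩ := AType.exists_of_mem_supp _ hγ
    rw [mem_closedAt_apprX] at h1
    rw [mem_openAt_apprX] at h2
    exact ⟨b, hb, d, le_antisymm h1 (not_lt.1 h2)⟩
  · rintro ⟨b, hb, d, hd⟩
    refine ⟨v.not_isTrivial_apprX, fun c => ?_, b, (v.mem_inter_apprX_iff b).2 hb⟩
    obtain ⟨e, he⟩ := hb.exists_val_eq hd c
    have h1 := (mem_closedAt_apprX v c e).2 he.le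
    exact ⟨v₀ e, AType.mem_supp_of_mem _ h1, h1, fun h2 =>
      ((mem_openAt_apprX v c e).1 h2).ne he⟩

theorem Ext.fixesValue_apprX (v : Ext v₀) {f : Polynomial K} {c d : K}
    (hc : v.val (xSub c) ≤ v.val (algebraMap K _ d)) (γ : v.1.ValueGroup)
    (h : ∀ c, v.val (xSub c) ≤ v.val (algebraMap K _ d) →
      v.val (algebraMap K _ (f.eval c)) = γ) : v.apprX.FixesValue f := by
  refine ⟨v₀ d, AType.mem_supp_of_mem _ ((mem_closedAt_apprX v c d).2 hc), fun a ha b hb => ?_⟩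
  rw [mem_closedAt_apprX] at ha hb
  rw [← v.val_eq_iff, h a ha, h b hb]

end Centers

/-! ### Principal units common to all extensions with the same approximation type -/

section Fibers

open Polynomial

variable {K Γ₀ : Type*} [Field K] [LinearOrderedCommGroupWithZero Γ₀] {v₀ : Valuation K Γ₀}

/-- The group of elements of `K(x)` that are principal units for all extensions with the same
approximation type as `v`. -/
noncomputable def Ext.fiberUnits (v : Ext v₀) : Subgroup (RatFunc K)ˣ :=
  ⨅ v' : {v' : Ext v₀ // v'.apprX = v.apprX}, v'.1.1.principalUnitGroup

theorem Ext.mem_fiberUnits (v : Ext v₀) (u : (RatFunc K)ˣ) :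
    u ∈ v.fiberUnits ↔ ∀ v' : Ext v₀, v'.apprX = v.apprX → v'.val ((u : RatFunc K) - 1) < 1 := by
  rw [Ext.fiberUnits, Subgroup.mem_iInf]
  exact ⟨fun h v' hv' => h ⟨v', hv'⟩, fun h v' => h v'.1 v'.2⟩

/-- The image of the multiplicative group of `K` in that of `K(x)`. -/
noncomputable def constUnits (K : Type*) [Field K] : Subgroup (RatFunc K)ˣ :=
  (Units.map (algebraMap K (RatFunc K)).toMonoidHom).range

theorem mem_constUnits {a : K} {u : (RatFunc K)ˣ} (hu : (u : RatFunc K) = algebraMap K _ a) :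
    u ∈ constUnits K := by
  have ha : a ≠ 0 := by
    rintro rfl
    rw [map_zero] at hu
    exact u.ne_zero hu
  exact ⟨Units.mk0 a ha, Units.ext hu.symm⟩

/-- The quotient f / g is a principal unit throughout the fiber; subgroups above `fiberUnits` do not
distinguish f from g. -/
theorem Ext.mem_of_val_sub_lt {v : Ext v₀} {H : Subgroup (RatFunc K)ˣ} (hH : v.fiberUnits ≤ H)
    {f g : (RatFunc K)ˣ} (hg : g ∈ H)
    (h : ∀ v' : Ext v₀, v'.apprX = v.apprX → v'.val ((f : RatFunc K) - g) < v'.val g) : f ∈ H := by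
  rw [← div_mul_cancel f g]
  refine H.mul_mem (hH ((v.mem_fiberUnits _).2 fun v' hv' => ?_)) hg
  have : ((f / g : (RatFunc K)ˣ) : RatFunc K) - 1 = ((f : RatFunc K) - g) / g := by
    rw [Units.val_div_eq_div_val, sub_div, div_self g.ne_zero]
  rw [this, map_div₀, div_lt_one₀ (val_pos v' g.ne_zero)]
  exact h v' hv'

theorem eq_top_of_polynomials (H : Subgroup (RatFunc K)ˣ)
    (h : ∀ p : K[X], ∀ u : (RatFunc K)ˣ, (u : RatFunc K) = algebraMap K[X] _ p → u ∈ H) :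
    H = ⊤ := by
  rw [eq_top_iff]
  rintro u -
  have hn : algebraMap K[X] (RatFunc K) (u : RatFunc K).num ≠ 0 := by
    simp
  have hd : algebraMap K[X] (RatFunc K) (u : RatFunc K).denom ≠ 0 := by
    simpa using RatFunc.denom_ne_zero (u : RatFunc K)
  have : u = Units.mk0 _ hn / Units.mk0 _ hd := by
    apply Units.ext
    rw [Units.val_div_eq_div_val, Units.val_mk0, Units.val_mk0, RatFunc.num_div_denom]
  rw [this]
  exact H.div_mem (h _ _ rfl) (h _ _ rfl)

theorem xSub_zero : xSub (0 : K) = RatFunc.X := by simp [xSub]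

theorem prod_mem_of_forall {L : Type*} [Field L] {H : Subgroup Lˣ} {α : Type*} (t : Multiset α)
    (g : α → L) (hg : ∀ a (u : Lˣ), (u : L) = g a → u ∈ H) (u : Lˣ)
    (hu : (u : L) = (t.map g).prod) : u ∈ H := by
  induction t using Multiset.induction_on generalizing u with
  | empty =>
    have : u = 1 := Units.ext (by simpa using hu)
    rw [this]; exact H.one_mem
  | cons a s ih =>
    rw [Multiset.map_cons, Multiset.prod_cons] at hu
    have h0 : g a * (s.map g).prod ≠ 0 := hu ▸ u.ne_zero
    have : u = Units.mk0 _ (left_ne_zero_of_mul h0) * Units.mk0 _ (right_ne_zero_of_mul h0) :=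
      Units.ext hu
    rw [this]
    exact H.mul_mem (hg _ _ rfl) (ih _ rfl)

theorem Ext.bounded_or (v : Ext v₀) :
    (∃ m : K, m ≠ 0 ∧ v.val RatFunc.X ≤ v.val (algebraMap K _ m)) ∨
      ∀ m : K, v.val (algebraMap K _ m) < v.val RatFunc.X := by
  by_cases h : ∀ m : K, v.val (algebraMap K _ m) < v.val RatFunc.X
  · exact Or.inr h
  · push Not at h
    obtain ⟨m, hm⟩ := h
    refine Or.inl ⟨m, ?_, hm⟩
    rintro rfl
    rw [map_zero, map_zero, le_zero_iff, Valuation.zero_iff] at hm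
    exact RatFunc.X_ne_zero hm

theorem val_sub_leading_lt (v : Ext v₀) (h : ∀ m : K, v.val (algebraMap K _ m) < v.val RatFunc.X)
    {p : K[X]} (hp : p ≠ 0) :
    v.val (algebraMap K[X] (RatFunc K) p -
        algebraMap K _ p.leadingCoeff * RatFunc.X ^ p.natDegree) <
      v.val (algebraMap K (RatFunc K) p.leadingCoeff * RatFunc.X ^ p.natDegree) := by
  have hlc : p.leadingCoeff ≠ 0 := by simpa using hp
  have h1 : 1 < v.val RatFunc.X := by simpa using h 1
  rw [← RatFunc.aeval_X_left_eq_algebraMap, aeval_eq_sum_range, Finset.sum_range_succ,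
    Algebra.smul_def, coeff_natDegree, add_sub_cancel_right]
  have hne : v.val (algebraMap K (RatFunc K) p.leadingCoeff * RatFunc.X ^ p.natDegree) ≠ 0 := by
    rw [Valuation.ne_zero_iff]
    exact mul_ne_zero ((_root_.map_ne_zero _).2 hlc) (pow_ne_zero _ RatFunc.X_ne_zero)
  refine Valuation.map_sum_lt _ hne fun i hi => ?_
  rw [Finset.mem_range] at hi
  rw [Algebra.smul_def, map_mul, map_mul, map_pow, map_pow]
  -- That x exceeds this quotient makes the leading coefficient times xⁱ⁺¹ dominate the term of
  -- degree i.
  have h2 := h (p.coeff i / p.leadingCoeff)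
  rw [map_div₀, map_div₀, div_lt_iff₀' (val_pos v ((_root_.map_ne_zero _).2 hlc))] at h2
  have h3 : 0 < v.val RatFunc.X ^ i := pow_pos (zero_lt_one.trans h1) _
  calc _ < v.val (algebraMap K _ p.leadingCoeff) * v.val RatFunc.X * v.val RatFunc.X ^ i :=
        mul_lt_mul_of_pos_right h2 h3
    _ = v.val (algebraMap K _ p.leadingCoeff) * v.val RatFunc.X ^ (i + 1) := by
        rw [mul_assoc, pow_succ']
    _ ≤ _ := mul_le_mul' le_rfl (pow_le_pow_right₀ h1.le hi)

/-- If the distances of `x` to `K` are bounded away from zero, then up to principal units, `K(x)`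
is multiplicatively generated by `K` and the elements `x - c`. -/
theorem DenseInAlgClosure.eq_top_of_linear (hK : DenseInAlgClosure v₀) {v : Ext v₀} {e : K}
    (he : e ≠ 0) (h : ∀ c, v.val (algebraMap K _ e) ≤ v.val (xSub c))
    {H : Subgroup (RatFunc K)ˣ} (hH : v.fiberUnits ≤ H) (hc : constUnits K ≤ H)
    (hl : ∀ c (u : (RatFunc K)ˣ), (u : RatFunc K) = xSub c → u ∈ H) : H = ⊤ := by
  refine eq_top_of_polynomials H fun p u hu => ?_
  have hp : p ≠ 0 := by
    rintro rfl
    rw [map_zero] at hu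
    exact u.ne_zero hu
  rcases v.bounded_or with ⟨m, hm, hxm⟩ | hx
  · obtain ⟨a, t, ha, hat⟩ := hK.exists_linear_approx hp he hm
    -- The bounds on x and on the x - c are statements about the approximation type, so the same
    -- product of linear factors works for every v' in the fiber.
    have hlt : ∀ v' : Ext v₀, v'.apprX = v.apprX →
        v'.val (u - algebraMap K _ a * (t.map xSub).prod) <
          v'.val (algebraMap K _ a * (t.map xSub).prod) := by
      intro v' hv'
      rw [hu, ← RatFunc.aeval_X_left_eq_algebraMap]
      refine hat v' _ ?_ fun c _ => ?_
      · rw [← xSub_zero] at hxm ⊢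
        exact (Ext.apprX_le_iff hv' _ _).2 hxm
      · rw [← not_lt]
        exact fun h' => ((Ext.apprX_lt_iff hv' c e).1 h').not_ge (h c)
    have h0 : algebraMap K _ a * (t.map xSub).prod ≠ 0 := by
      intro h0
      have := hlt v rfl
      rw [h0, map_zero] at this
      exact not_lt_zero this
    refine Ext.mem_of_val_sub_lt hH (g := Units.mk0 _ h0) ?_ hlt
    have : Units.mk0 _ h0 = Units.mk0 _ (left_ne_zero_of_mul h0) *
        Units.mk0 _ (right_ne_zero_of_mul h0) := Units.ext rfl
    rw [this]
    exact H.mul_mem (hc (mem_constUnits rfl)) (prod_mem_of_forall t xSub hl _ rfl)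
  -- If x exceeds all constants, the leading term dominates and no approximation of roots is needed.
  · have hx' : ∀ v' : Ext v₀, v'.apprX = v.apprX →
        ∀ m : K, v'.val (algebraMap K _ m) < v'.val RatFunc.X := by
      intro v' hv' m
      have := hx m
      rw [← xSub_zero, ← not_le] at this ⊢
      rwa [Ext.apprX_le_iff hv']
    have hlc : algebraMap K (RatFunc K) p.leadingCoeff ≠ 0 := by simpa using hp
    refine Ext.mem_of_val_sub_lt hH
      (g := Units.mk0 _ hlc * (Units.mk0 _ RatFunc.X_ne_zero) ^ p.natDegree) ?_ fun v' hv' => ?_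
    · exact H.mul_mem (hc (mem_constUnits rfl)) (H.pow_mem (hl 0 _ xSub_zero.symm) _)
    · rw [hu]
      exact val_sub_leading_lt v' (hx' v' hv') hp

/-- Near `x`, a polynomial whose value at `x` is not too small is almost constant. -/
theorem Ext.exists_val_sub_eval_lt {v : Ext v₀}
    (h : ∀ η : K, η ≠ 0 → ∃ c, v.val (xSub c) < v.val (algebraMap K _ η)) {f : K[X]} {η : K}
    (hη : η ≠ 0) (hf : v.val (algebraMap K _ η) ≤ v.val (algebraMap K[X] _ f)) :
    ∃ δ : K, δ ≠ 0 ∧ ∀ c, v.val (xSub c) < v.val (algebraMap K _ δ) →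
      ∀ v' : Ext v₀, v'.apprX = v.apprX →
        v'.val (algebraMap K[X] _ f - algebraMap K _ (f.eval c)) <
          v'.val (algebraMap K _ (f.eval c)) := by
  obtain ⟨m, hm, hxm⟩ : ∃ m : K, m ≠ 0 ∧ v.val RatFunc.X ≤ v.val (algebraMap K _ m) := by
    rcases v.bounded_or with h' | h'
    · exact h'
    · obtain ⟨c, hc⟩ := h 1 one_ne_zero
      have h1 : v.val RatFunc.X ≤ max 1 (v.val (algebraMap K _ c)) := by
        have : RatFunc.X = xSub c + algebraMap K _ c := by simp [xSub]
        rw [this]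
        refine (Valuation.map_add _ _ _).trans (max_le_max ?_ le_rfl)
        simpa using hc.le
      have h2 := h' 1
      rw [map_one, map_one] at h2
      exact absurd h1 (not_le.2 (max_lt h2 (h' c)))
  obtain ⟨B, hB, hL⟩ := exists_lipschitz v₀ f m
  -- The bound by m keeps c where the Lipschitz constant B is valid; the bound by η / B makes the
  -- error smaller than η.
  obtain ⟨δ, hδ, hδm, hδη⟩ : ∃ δ : K, δ ≠ 0 ∧ v₀ δ ≤ v₀ m ∧ v₀ δ ≤ v₀ (η / B) := by
    rcases le_total (v₀ m) (v₀ (η / B)) with h' | h'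
    · exact ⟨m, hm, le_rfl, h'⟩
    · exact ⟨η / B, div_ne_zero hη hB, h', le_rfl⟩
  refine ⟨δ, hδ, fun c hc => ?_⟩
  have key : ∀ v' : Ext v₀, v'.apprX = v.apprX →
      v'.val (algebraMap K[X] _ f - algebraMap K _ (f.eval c)) < v'.val (algebraMap K _ η) := by
    intro v' hv'
    have hx' : v'.val RatFunc.X ≤ v'.val (algebraMap K _ m) := by
      rw [← xSub_zero] at hxm ⊢
      exact (Ext.apprX_le_iff hv' _ _).2 hxm
    have hc1 := (Ext.apprX_lt_iff hv' c δ).2 hc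
    have hc' : v'.val (algebraMap K _ c) ≤ v'.val (algebraMap K _ m) := by
      have : algebraMap K _ c = RatFunc.X - xSub c := by simp [xSub]
      rw [this]
      exact v'.val.map_sub_le hx' (hc1.le.trans ((v'.val_le_iff _ _).2 hδm))
    have h1 := (hL v' _ _ hx' hc').2
    rw [RatFunc.aeval_X_left_eq_algebraMap, aeval_algebraMap_apply] at h1
    refine h1.trans_lt ?_
    have h2 := hc1.trans_le ((v'.val_le_iff _ _).2 hδη)
    rw [map_div₀, map_div₀, lt_div_iff₀' (val_pos v' ((_root_.map_ne_zero _).2 hB))] at h2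
    exact h2
  -- Obtained from v, this inequality takes place in K and is thus available for every v' in the
  -- fiber.
  have h1 : v₀ η ≤ v₀ (f.eval c) := by
    have h2 := (key v rfl).trans_le hf
    rw [Valuation.map_sub_swap] at h2
    rw [← v.val_le_iff, v.val.map_eq_of_sub_lt h2]
    exact hf
  intro v' hv'
  exact (key v' hv').trans_le ((v'.val_le_iff _ _).2 h1)

end Fibers

/-! ### Generators of K(x)ˣ modulo principal units, and uniqueness -/

section Structure

open Polynomial

variable {K Γ₀ : Type*} [Field K] [LinearOrderedCommGroupWithZero Γ₀] {v₀ : Valuation K Γ₀}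

theorem Ext.val_mul_pow_le_one_iff (v : Ext v₀) (t : RatFunc K) {a e : K} (ha : a ≠ 0) {n : ℕ}
    (hn : n ≠ 0) (he : v₀ e ^ n = v₀ a⁻¹) :
    v.val (algebraMap K _ a * t ^ n) ≤ 1 ↔ v.val t ≤ v.val (algebraMap K _ e) := by
  have h1 : v.val (algebraMap K _ e) ^ n = (v.val (algebraMap K _ a))⁻¹ := by
    rw [← map_pow, ← map_pow, ← map_inv₀, ← map_inv₀, v.val_eq_iff, map_pow, he]
  have h2 := val_pos v ((map_ne_zero (algebraMap K (RatFunc K))).2 ha)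
  rw [map_mul, map_pow, ← le_inv_mul_iff₀ h2, mul_one, ← h1, pow_le_pow_iff_left₀ zero_le zero_le hn]

theorem Ext.val_mul_inv_pow_le_one_iff (v : Ext v₀) {t : RatFunc K} (ht : t ≠ 0) {a e : K} {n : ℕ}
    (hn : n ≠ 0) (he : v₀ e ^ n = v₀ a) :
    v.val (algebraMap K _ a * (t ^ n)⁻¹) ≤ 1 ↔ v.val (algebraMap K _ e) ≤ v.val t := by
  have h1 : v.val (algebraMap K _ e) ^ n = v.val (algebraMap K _ a) := by
    rw [← map_pow, ← map_pow, v.val_eq_iff, map_pow, he]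
  rw [map_mul, map_inv₀, map_pow, mul_inv_le_iff₀ (pow_pos (val_pos v ht) n), one_mul, ← h1,
    pow_le_pow_iff_left₀ zero_le zero_le hn]

/-- An extension is determined by its approximation type if, for all extensions with this
approximation type, the value group is generated by that of `K` and the value of one element which
realizes a fixed cut. -/
theorem Ext.determinedByAppr_of {v : Ext v₀} (hdiv : DivisibleValueGroup v₀) {t : RatFunc K}
    (ht : t ≠ 0)
    (h : ∀ u : RatFunc K, u ≠ 0 → ∃ (a : K) (k : ℤ), a ≠ 0 ∧ ∀ v' : Ext v₀, v'.apprX = v.apprX →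
      v'.val u = v'.val (algebraMap K _ a * t ^ k))
    (h1 : ∀ v' : Ext v₀, v'.apprX = v.apprX → ∀ d,
      v'.val t ≤ v'.val (algebraMap K _ d) ↔ v.val t ≤ v.val (algebraMap K _ d))
    (h2 : ∀ v' : Ext v₀, v'.apprX = v.apprX → ∀ d,
      v'.val (algebraMap K _ d) ≤ v'.val t ↔ v.val (algebraMap K _ d) ≤ v.val t) :
    v.DeterminedByAppr := by
  intro v' hv'
  apply Subtype.ext
  apply SetLike.ext
  intro u
  rw [← ValuationSubring.valuation_le_one_iff, ← ValuationSubring.valuation_le_one_iff]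
  by_cases hu : u = 0
  · simp [hu]
  obtain ⟨a, k, ha, hk⟩ := h u hu
  change v'.val u ≤ 1 ↔ v.val u ≤ 1
  rw [hk v' hv', hk v rfl]
  -- By divisibility the value of a or of its inverse has a root of order |k|, the value of some e.
  -- Membership of a tᵏ in the valuation ring then compares t with e, from a side that depends on
  -- the sign of k.
  rcases lt_trichotomy k 0 with hk0 | rfl | hk0
  · obtain ⟨n, rfl⟩ : ∃ n : ℕ, k = -(n : ℤ) := ⟨k.natAbs, by omega⟩
    have hn : n ≠ 0 := by omega
    obtain ⟨e, he⟩ := hdiv n (by omega) a ha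
    rw [zpow_neg, zpow_natCast, v'.val_mul_inv_pow_le_one_iff ht hn he,
      v.val_mul_inv_pow_le_one_iff ht hn he]
    exact h2 v' hv' e
  · rw [zpow_zero, mul_one]
    have := (v'.val_le_iff a 1).trans (v.val_le_iff a 1).symm
    simpa using this
  · obtain ⟨n, rfl⟩ : ∃ n : ℕ, k = (n : ℤ) := ⟨k.natAbs, by omega⟩
    have hn : n ≠ 0 := by omega
    obtain ⟨e, he⟩ := hdiv n (by omega) a⁻¹ (inv_ne_zero ha)
    rw [zpow_natCast, v'.val_mul_pow_le_one_iff t ha hn he, v.val_mul_pow_le_one_iff t ha hn he]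
    exact h1 v' hv' e

theorem Ext.determinedByAppr_of_val_eq {v : Ext v₀} (hdiv : DivisibleValueGroup v₀)
    (h : ∀ u : RatFunc K, u ≠ 0 → ∃ a : K, ∀ v' : Ext v₀, v'.apprX = v.apprX →
      v'.val u = v'.val (algebraMap K _ a)) : v.DeterminedByAppr := by
  refine Ext.determinedByAppr_of hdiv one_ne_zero (fun u hu => ?_) (fun v' _ d => ?_)
    (fun v' _ d => ?_)
  · obtain ⟨a, ha⟩ := h u hu
    refine ⟨a, 0, ?_, by simpa using ha⟩
    rintro rfl
    have := ha v rfl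
    rw [map_zero, map_zero, Valuation.zero_iff] at this
    exact hu this
  · rw [← map_one (algebraMap K (RatFunc K)), v'.val_le_iff, v.val_le_iff]
  · rw [← map_one (algebraMap K (RatFunc K)), v'.val_le_iff, v.val_le_iff]

theorem Ext.val_sub_lt_of_mem_fiberUnits {v : Ext v₀} {w g : (RatFunc K)ˣ} (hw : w ∈ v.fiberUnits)
    {v' : Ext v₀} (hv' : v'.apprX = v.apprX) :
    v'.val (((w * g : (RatFunc K)ˣ) : RatFunc K) - g) < v'.val g := by
  have : ((w * g : (RatFunc K)ˣ) : RatFunc K) - g = (w - 1) * g := by push_cast; ring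
  rw [this, map_mul]
  exact (mul_lt_iff_lt_one_left (val_pos v' g.ne_zero)).2 ((v.mem_fiberUnits w).1 hw v' hv')

theorem Ext.exists_const_of_eq_top {v : Ext v₀} (h : v.fiberUnits ⊔ constUnits K = ⊤)
    {u : RatFunc K} (hu : u ≠ 0) : ∃ a : K, ∀ v' : Ext v₀, v'.apprX = v.apprX →
      v'.val (u - algebraMap K _ a) < v'.val (algebraMap K _ a) := by
  have hmem : Units.mk0 u hu ∈ v.fiberUnits ⊔ constUnits K := by rw [h]; trivial
  obtain ⟨w, hw, g, ⟨a, ha⟩, hwg⟩ := Subgroup.mem_sup.1 hmem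
  refine ⟨a, fun v' hv' => ?_⟩
  have := Ext.val_sub_lt_of_mem_fiberUnits (g := g) hw hv'
  rw [hwg, ← ha] at this
  exact this

theorem Ext.exists_const_mul_zpow_of_eq_top {v : Ext v₀} {t : (RatFunc K)ˣ}
    (h : v.fiberUnits ⊔ (constUnits K ⊔ Subgroup.zpowers t) = ⊤)
    {u : RatFunc K} (hu : u ≠ 0) : ∃ (a : K) (k : ℤ), a ≠ 0 ∧
      ∀ v' : Ext v₀, v'.apprX = v.apprX →
      v'.val (u - algebraMap K _ a * (t : RatFunc K) ^ k) <
        v'.val (algebraMap K _ a * (t : RatFunc K) ^ k) := by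
  have hmem : Units.mk0 u hu ∈ v.fiberUnits ⊔ (constUnits K ⊔ Subgroup.zpowers t) := by
    rw [h]; trivial
  obtain ⟨w, hw, g, hg, hwg⟩ := Subgroup.mem_sup.1 hmem
  obtain ⟨_, ⟨a, rfl⟩, _, ⟨k, rfl⟩, hg'⟩ := Subgroup.mem_sup.1 hg
  refine ⟨a, k, a.ne_zero, fun v' hv' => ?_⟩
  have := Ext.val_sub_lt_of_mem_fiberUnits (g := g) hw hv'
  rw [hwg, ← hg'] at this
  simpa using this

theorem Ext.isImmediateExt_and_determined {v : Ext v₀} (hdiv : DivisibleValueGroup v₀)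
    (h : v.fiberUnits ⊔ constUnits K = ⊤) :
    IsImmediateExt v₀ v.val ∧ v.DeterminedByAppr := by
  constructor
  · refine isImmediateExt_of fun u hu => ?_
    obtain ⟨a, ha⟩ := Ext.exists_const_of_eq_top h hu
    exact ⟨a, ha v rfl⟩
  · refine Ext.determinedByAppr_of_val_eq hdiv fun u hu => ?_
    obtain ⟨a, ha⟩ := Ext.exists_const_of_eq_top h hu
    exact ⟨a, fun v' hv' => val_eq_of_sub_lt (ha v' hv')⟩

/-- Roots in an ordered group are unique, so a value that is torsion modulo a divisible subgroup
already lies in it. -/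
theorem Ext.val_pow_ne {v : Ext v₀} (hdiv : DivisibleValueGroup v₀) {t : RatFunc K} (ht : t ≠ 0)
    (h : ∀ d, v.val t ≠ v.val (algebraMap K _ d)) (n : ℕ) (hn : 0 < n) (d : K) :
    v.val t ^ n ≠ v.val (algebraMap K _ d) := by
  intro heq
  have hd : d ≠ 0 := by
    rintro rfl
    rw [map_zero, map_zero] at heq
    exact (pow_pos (val_pos v ht) n).ne' heq
  obtain ⟨e, he⟩ := hdiv n hn d hd
  refine h e ?_
  rw [← map_pow, ← v.val_eq_iff, map_pow, map_pow, ← heq] at he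
  exact ((pow_left_inj₀ zero_le zero_le hn.ne').1 he).symm

theorem Ext.isValueTransExt_and_determined {v : Ext v₀} (hdiv : DivisibleValueGroup v₀)
    {t : (RatFunc K)ˣ} (h : v.fiberUnits ⊔ (constUnits K ⊔ Subgroup.zpowers t) = ⊤)
    (ht : ∀ d, v.val (t : RatFunc K) ≠ v.val (algebraMap K _ d))
    (h1 : ∀ v' : Ext v₀, v'.apprX = v.apprX → ∀ d,
      v'.val (t : RatFunc K) ≤ v'.val (algebraMap K _ d) ↔
        v.val (t : RatFunc K) ≤ v.val (algebraMap K _ d))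
    (h2 : ∀ v' : Ext v₀, v'.apprX = v.apprX → ∀ d,
      v'.val (algebraMap K _ d) ≤ v'.val (t : RatFunc K) ↔
        v.val (algebraMap K _ d) ≤ v.val (t : RatFunc K)) :
    IsValueTransExt v₀ v.val ∧ v.DeterminedByAppr := by
  constructor
  · refine isValueTransExt_of t.ne_zero (Ext.val_pow_ne hdiv t.ne_zero ht) fun u hu => ?_
    obtain ⟨a, k, ha, hk⟩ := Ext.exists_const_mul_zpow_of_eq_top h hu
    exact ⟨a, k, ha, hk v rfl⟩
  · refine Ext.determinedByAppr_of hdiv t.ne_zero (fun u hu => ?_) h1 h2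
    obtain ⟨a, k, ha, hk⟩ := Ext.exists_const_mul_zpow_of_eq_top h hu
    exact ⟨a, k, ha, fun v' hv' => val_eq_of_sub_lt (hk v' hv')⟩

/-- A polynomial is small if its value is beyond all values of `K`. -/
def Ext.IsSmall (v : Ext v₀) (p : K[X]) : Prop :=
  ∀ η : K, η ≠ 0 → v.val (algebraMap K[X] _ p) < v.val (algebraMap K _ η)

/-- The element `x` is a limit of elements of `K`. -/
def Ext.IsLimit (v : Ext v₀) : Prop :=
  ∀ η : K, η ≠ 0 → ∃ c, v.val (xSub c) < v.val (algebraMap K _ η)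

theorem Ext.IsLimit.of_apprX_eq {v v' : Ext v₀} (h : v.IsLimit) (hv : v'.apprX = v.apprX) :
    v'.IsLimit := fun η hη => by
  obtain ⟨c, hc⟩ := h η hη
  exact ⟨c, (Ext.apprX_lt_iff hv c η).2 hc⟩

/-- For c close to x, such an f agrees with the constant f(c) up to a principal unit. -/
theorem Ext.IsLimit.mem_of_not_isSmall {v : Ext v₀} (h : v.IsLimit) {H : Subgroup (RatFunc K)ˣ}
    (hH : v.fiberUnits ⊔ constUnits K ≤ H) {f : K[X]} (hf : ¬ v.IsSmall f) (u : (RatFunc K)ˣ)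
    (hu : (u : RatFunc K) = algebraMap K[X] _ f) : u ∈ H := by
  simp only [Ext.IsSmall, not_forall, not_lt] at hf
  obtain ⟨η, hη, hf⟩ := hf
  obtain ⟨δ, hδ, H1⟩ := Ext.exists_val_sub_eval_lt h hη hf
  obtain ⟨c, hc⟩ := h δ hδ
  have h2 := H1 c hc
  have h0 : algebraMap K (RatFunc K) (f.eval c) ≠ 0 := by
    intro h0
    have := h2 v rfl
    rw [h0, map_zero] at this
    exact not_lt_zero this
  refine Ext.mem_of_val_sub_lt (le_sup_left.trans hH) (g := Units.mk0 _ h0)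
    (hH (Subgroup.mem_sup_right (mem_constUnits rfl))) fun v' hv' => ?_
  rw [hu]
  exact h2 v' hv'

theorem Ext.IsLimit.eq_top {v : Ext v₀} (h : v.IsLimit) (hP : ∀ p, p ≠ 0 → ¬ v.IsSmall p) :
    v.fiberUnits ⊔ constUnits K = ⊤ := by
  refine eq_top_of_polynomials _ fun p u hu => h.mem_of_not_isSmall le_rfl (hP p ?_) u hu
  rintro rfl
  rw [map_zero] at hu
  exact u.ne_zero hu

/-- If p were not small for v', it would agree near x with a nonzero constant p(c) for the whole
fiber, in particular for v. -/
theorem Ext.IsSmall.of_apprX_eq {v v' : Ext v₀} (h : v.IsLimit) (hv : v'.apprX = v.apprX) {p : K[X]}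
    (hp : v.IsSmall p) : v'.IsSmall p := by
  by_contra hp'
  simp only [Ext.IsSmall, not_forall, not_lt] at hp'
  obtain ⟨η, hη, hf⟩ := hp'
  obtain ⟨δ, hδ, H1⟩ := Ext.exists_val_sub_eval_lt (h.of_apprX_eq hv) hη hf
  obtain ⟨c, hc⟩ := h.of_apprX_eq hv δ hδ
  have h2 := H1 c hc v hv.symm
  have h0 : p.eval c ≠ 0 := by
    intro h0
    rw [h0, map_zero, map_zero] at h2
    exact not_lt_zero h2
  exact (hp _ h0).ne (val_eq_of_sub_lt h2)

/-- The factor q is bounded by a constant: if it exceeded all constants it would not be small, and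
would share its value with a constant. -/
theorem Ext.IsSmall.mul_right {v : Ext v₀} (h : v.IsLimit) {p : K[X]} (hp : v.IsSmall p)
    (q : K[X]) : v.IsSmall (p * q) := by
  intro η hη
  by_cases hq : ∀ B : K, v.val (algebraMap K _ B) < v.val (algebraMap K[X] _ q)
  · have hq1 : ¬ v.IsSmall q := fun h' => (h' 1 one_ne_zero).not_gt (hq 1)
    simp only [Ext.IsSmall, not_forall, not_lt] at hq1
    obtain ⟨η', hη', hf⟩ := hq1
    obtain ⟨δ, hδ, H1⟩ := Ext.exists_val_sub_eval_lt h hη' hf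
    obtain ⟨c, hc⟩ := h δ hδ
    exact absurd (val_eq_of_sub_lt (H1 c hc v rfl)) (hq _).ne'
  · push Not at hq
    obtain ⟨B, hB⟩ := hq
    by_cases hB0 : B = 0
    · rw [hB0, map_zero, map_zero, le_zero_iff] at hB
      rw [map_mul, map_mul, hB, mul_zero]
      exact val_pos v ((_root_.map_ne_zero _).2 hη)
    have h1 := hp (η / B) (div_ne_zero hη hB0)
    rw [map_div₀, map_div₀, lt_div_iff₀ (val_pos v ((_root_.map_ne_zero _).2 hB0))] at h1
    rw [map_mul, map_mul]
    exact (mul_le_mul' le_rfl hB).trans_lt h1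

/-- If `x` is a limit of elements of `K` and there are small polynomials, then the extension is
value-transcendental and determined by its approximation type. -/
theorem Ext.IsLimit.isValueTransExt {v : Ext v₀} (hdiv : DivisibleValueGroup v₀) (h : v.IsLimit)
    (hP : ∃ p, p ≠ 0 ∧ v.IsSmall p) : IsValueTransExt v₀ v.val ∧ v.DeterminedByAppr := by
  -- A small polynomial of least degree is the additional generator: dividing by it repeatedly
  -- leaves a polynomial that is not small.
  obtain ⟨p, ⟨hp0, hp⟩, hmin⟩ :=
    (measure (natDegree (R := K))).wf.has_min {p | p ≠ 0 ∧ v.IsSmall p} hP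
  have hmin' : ∀ r : K[X], r ≠ 0 → r.natDegree < p.natDegree → ¬ v.IsSmall r :=
    fun r hr hlt hs => hmin r ⟨hr, hs⟩ hlt
  have hpL : algebraMap K[X] (RatFunc K) p ≠ 0 :=
    (map_ne_zero_iff _ (IsFractionRing.injective _ _)).2 hp0
  set t : (RatFunc K)ˣ := Units.mk0 _ hpL
  have hsm : ∀ v' : Ext v₀, v'.apprX = v.apprX → v'.IsSmall p := fun v' hv' =>
    Ext.IsSmall.of_apprX_eq h hv' hp
  have hpdeg : 0 < p.natDegree := by
    rw [Nat.pos_iff_ne_zero]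
    intro h0
    rw [natDegree_eq_zero] at h0
    obtain ⟨a, rfl⟩ := h0
    have ha : a ≠ 0 := by rintro rfl; simp at hp0
    have := hp a ha
    rw [← algebraMap_eq, ← IsScalarTower.algebraMap_apply] at this
    exact lt_irrefl _ this
  refine Ext.isValueTransExt_and_determined hdiv (t := t) ?_ (fun d hd => ?_)
    (fun v' hv' d => ?_) (fun v' hv' d => ?_)
  · refine eq_top_of_polynomials _ fun f => ?_
    induction hn : f.natDegree using Nat.strong_induction_on generalizing f with
    | _ n ih =>
    subst hn
    intro u hu
    have hf0 : f ≠ 0 := by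
      rintro rfl
      rw [map_zero] at hu
      exact u.ne_zero hu
    by_cases hr : f % p = 0
    · have hpq : f = p * (f / p) := by
        conv_lhs => rw [← EuclideanDomain.div_add_mod f p, hr, add_zero]
      have hq0 : f / p ≠ 0 := by
        intro hq
        rw [hq, mul_zero] at hpq
        exact hf0 hpq
      have hdeg : (f / p).natDegree < f.natDegree := by
        conv_rhs => rw [hpq, natDegree_mul hp0 hq0]
        omega
      have hqL : algebraMap K[X] (RatFunc K) (f / p) ≠ 0 :=
        (map_ne_zero_iff _ (IsFractionRing.injective _ _)).2 hq0
      have : u = t * Units.mk0 _ hqL := by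
        apply Units.ext
        rw [hu, Units.val_mul, Units.val_mk0, Units.val_mk0, ← map_mul, ← hpq]
      rw [this]
      exact mul_mem (Subgroup.mem_sup_right (Subgroup.mem_sup_right (Subgroup.mem_zpowers t)))
        (ih _ hdeg _ rfl _ rfl)
    -- By minimality the nonzero remainder is not small. It differs from f by a multiple of p, which
    -- is small, so f is not small either.
    · have hdeg : (f % p).natDegree < p.natDegree :=
        natDegree_lt_natDegree hr (degree_mod_lt f hp0)
      refine h.mem_of_not_isSmall (sup_le_sup_left le_sup_left _) (fun hf => hmin' _ hr hdeg ?_) u hu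
      intro η hη
      have : f % p = f - p * (f / p) :=
        eq_sub_of_add_eq' (EuclideanDomain.div_add_mod f p)
      rw [this, map_sub]
      exact (Valuation.map_sub _ _ _).trans_lt (max_lt (hf η hη) (hp.mul_right h _ η hη))
  · by_cases hd0 : d = 0
    · rw [hd0, map_zero, map_zero] at hd
      exact (val_pos v t.ne_zero).ne' hd
    · exact (hp d hd0).ne hd
  -- Throughout the fiber p is below all nonzero constants and above 0, so its comparison with d has
  -- the same outcome for v and v'.
  · by_cases hd0 : d = 0
    · rw [hd0, map_zero, map_zero, map_zero]
      exact iff_of_false (val_pos v' t.ne_zero).not_ge (val_pos v t.ne_zero).not_ge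
    · exact iff_of_true (hsm v' hv' d hd0).le (hp d hd0).le
  · by_cases hd0 : d = 0
    · simp [hd0]
    · exact iff_of_false (hsm v' hv' d hd0).not_ge (hp d hd0).not_ge

/-- If the value of `x - b` is not in the value group of `K` and `x` is not a limit of elements of
`K`, then the extension is value-transcendental and determined by its approximation type. -/
theorem DenseInAlgClosure.isValueTransExt (hK : DenseInAlgClosure v₀) {v : Ext v₀}
    (hL : ¬ v.IsLimit) {b : K} (hb : ∀ d, v.val (xSub b) ≠ v.val (algebraMap K _ d)) :
    IsValueTransExt v₀ v.val ∧ v.DeterminedByAppr := by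
  simp only [Ext.IsLimit, not_forall, not_exists, not_lt] at hL
  obtain ⟨e, he, hL⟩ := hL
  set t : (RatFunc K)ˣ := Units.mk0 _ (xSub_ne_zero b)
  have h2 : ∀ v' : Ext v₀, v'.apprX = v.apprX → ∀ d,
      v'.val (algebraMap K _ d) < v'.val (xSub b) ↔ v.val (algebraMap K _ d) < v.val (xSub b) := by
    intro v' hv' d
    rw [← not_le, Ext.apprX_le_iff hv', not_le]
  refine Ext.isValueTransExt_and_determined hK.divisibleValueGroup (t := t) ?_ hb
    (fun v' hv' d => Ext.apprX_le_iff hv' _ _) (fun v' hv' d => ?_)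
  · refine hK.eq_top_of_linear he hL le_sup_left (le_sup_left.trans le_sup_right) fun c u hu => ?_
    -- In x - c = (x - b) + (b - c) the summands have different values, and the dominant one
    -- represents x - c up to a principal unit.
    rcases lt_or_gt_of_ne (hb (b - c)) with h | h
    · have h0 : algebraMap K (RatFunc K) (b - c) ≠ 0 := by
        intro h0
        rw [h0, map_zero] at h
        exact not_lt_zero h
      refine Ext.mem_of_val_sub_lt le_sup_left (g := Units.mk0 _ h0)
        (Subgroup.mem_sup_right (Subgroup.mem_sup_left (mem_constUnits rfl))) fun v' hv' => ?_
      rw [hu, Units.val_mk0, xSub_sub_algebraMap]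
      exact (Ext.apprX_lt_iff hv' _ _).2 h
    · refine Ext.mem_of_val_sub_lt le_sup_left (g := t)
        (Subgroup.mem_sup_right (Subgroup.mem_sup_right (Subgroup.mem_zpowers t))) fun v' hv' => ?_
      rw [hu, Units.val_mk0, xSub_sub_xSub]
      exact (h2 v' hv' _).2 h
  · rw [← not_lt, ← not_lt]
    exact not_congr (Ext.apprX_lt_iff hv' _ _)

end Structure

/-! ### Algebraic and transcendental immediate types -/

section ImmediateTypes

open Polynomial

variable {K Γ₀ : Type*} [Field K] [LinearOrderedCommGroupWithZero Γ₀] {v₀ : Valuation K Γ₀}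

theorem Ext.exists_closer {v : Ext v₀} (h : ∀ b, ∃ c, v.val (xSub c) < v.val (xSub b))
    (t : Multiset K) : ∃ c, ∀ a ∈ t, v.val (xSub c) < v.val (xSub a) := by
  induction t using Multiset.induction_on with
  | empty => exact ⟨0, by simp⟩
  | cons a s ih =>
    obtain ⟨c, hc⟩ := ih
    obtain ⟨c', hc'⟩ := h a
    rcases le_total (v.val (xSub c)) (v.val (xSub c')) with hle | hle
    · exact ⟨c, by simpa using ⟨hle.trans_lt hc', hc⟩⟩
    · exact ⟨c', by simpa using ⟨hc', fun a ha => hle.trans_lt (hc a ha)⟩⟩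

theorem Ext.exists_val_xSub_eq {v : Ext v₀} (h : ∀ b, ∃ c, v.val (xSub c) < v.val (xSub b))
    (c : K) : ∃ d, d ≠ 0 ∧ v.val (xSub c) = v.val (algebraMap K _ d) := by
  obtain ⟨b, hb⟩ := h c
  have h1 := v.val_xSub_eq hb
  refine ⟨b - c, ?_, h1⟩
  intro h0
  rw [h0, map_zero, map_zero] at h1
  exact (val_pos v (xSub_ne_zero c)).ne' h1

/-- Replace f by a product of linear factors over K. Once c is closer to x than all the roots r, the
values of c - r and x - r agree, so the value of f(c) no longer depends on c. -/
theorem DenseInAlgClosure.isTransImmediate_apprX (hK : DenseInAlgClosure v₀) {v : Ext v₀}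
    (hI : v.apprX.IsImmediate) (hL : ¬ v.IsLimit) : v.apprX.IsTransImmediate := by
  refine ⟨hI, fun f => ?_⟩
  rw [v.isImmediate_apprX_iff] at hI
  obtain ⟨m, hm, hxm⟩ := Ext.exists_val_xSub_eq hI 0
  rw [xSub_zero] at hxm
  simp only [Ext.IsLimit, not_forall, not_exists, not_lt] at hL
  obtain ⟨e, he, hL⟩ := hL
  by_cases hf : f = 0
  · subst hf
    exact v.fixesValue_apprX (c := 0) (d := m) (by rw [xSub_zero, hxm])
      0 fun c _ => by simp
  obtain ⟨a, t, ha, hat⟩ := hK.exists_linear_approx hf he hm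
  -- Including 0 ensures that the value of c stays bounded by that of m.
  obtain ⟨c₀, hc₀⟩ := Ext.exists_closer hI (0 ::ₘ t)
  obtain ⟨d, hd, hcd⟩ := Ext.exists_val_xSub_eq hI c₀
  refine v.fixesValue_apprX (c := c₀) (d := d) hcd.le
    (v.val (algebraMap K _ a * (t.map xSub).prod)) fun c hc => ?_
  rw [← hcd] at hc
  have hroot : ∀ r ∈ t, v.val (algebraMap K _ c - algebraMap K _ r) = v.val (xSub r) := by
    intro r hr
    have h1 := hc.trans_lt (hc₀ r (by simp [hr]))
    rw [← map_sub, ← v.val_xSub_eq h1]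
  have hcm : v.val (algebraMap K _ c) ≤ v.val (algebraMap K _ m) := by
    have : algebraMap K _ c = RatFunc.X - xSub c := by simp [xSub]
    rw [this, ← hxm]
    refine v.val.map_sub_le le_rfl ?_
    have := hc₀ 0 (by simp)
    rw [xSub_zero] at this
    exact hc.trans this.le
  have h1 := hat v (algebraMap K _ c) hcm fun r hr => by rw [hroot r hr]; exact hL r
  rw [aeval_algebraMap_apply_eq_algebraMap_eval] at h1
  rw [val_eq_of_sub_lt h1, map_mul, map_mul, map_multiset_prod, map_multiset_prod,
    Multiset.map_map, Multiset.map_map]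
  congr 2
  exact Multiset.map_congr rfl hroot

theorem Ext.IsLimit.isTransImmediate_apprX {v : Ext v₀} (h : v.IsLimit) (hI : v.apprX.IsImmediate)
    (hP : ∀ p, p ≠ 0 → ¬ v.IsSmall p) : v.apprX.IsTransImmediate := by
  refine ⟨hI, fun f => ?_⟩
  rw [v.isImmediate_apprX_iff] at hI
  by_cases hf : f = 0
  · subst hf
    obtain ⟨c, hc⟩ := h 1 one_ne_zero
    exact v.fixesValue_apprX hc.le 0 fun c _ => by simp
  have hf' := hP f hf
  simp only [Ext.IsSmall, not_forall, not_lt] at hf'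
  obtain ⟨η, hη, hf'⟩ := hf'
  obtain ⟨δ, hδ, H⟩ := Ext.exists_val_sub_eval_lt h hη hf'
  obtain ⟨c, hc⟩ := h δ hδ
  obtain ⟨d, hd, hcd⟩ := Ext.exists_val_xSub_eq hI c
  refine v.fixesValue_apprX hcd.le (v.val (algebraMap K[X] _ f)) fun c' hc' => ?_
  exact (val_eq_of_sub_lt (H c' (hc'.trans_lt (hcd ▸ hc)) v rfl)).symm

theorem Ext.IsLimit.isCompletionType {v : Ext v₀} (h : v.IsLimit) (hI : v.apprX.IsImmediate) :
    v.apprX.IsCompletionType := by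
  refine ⟨hI, ?_⟩
  ext γ
  constructor
  · intro hγ
    obtain ⟨c, d, rfl, hc⟩ := AType.exists_of_mem_supp _ hγ
    refine ⟨d, ?_, rfl⟩
    rintro rfl
    rw [mem_closedAt_apprX, map_zero, map_zero] at hc
    exact (val_pos v (xSub_ne_zero c)).not_ge hc
  · rintro ⟨d, hd, rfl⟩
    obtain ⟨c, hc⟩ := h d hd
    exact AType.mem_supp_of_mem _ ((mem_closedAt_apprX v c d).2 hc.le)

/-- As c approaches x, the nonzero values p(c) must keep getting smaller, since the value of p at x
is below all nonzero constants; they are not constant on any ball of the type. -/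
theorem Ext.IsLimit.isAlgImmediate_apprX {v : Ext v₀} (h : v.IsLimit) (hI : v.apprX.IsImmediate)
    {p : K[X]} (hp0 : p ≠ 0) (hp : v.IsSmall p) : v.apprX.IsAlgImmediate := by
  refine ⟨hI, p, ?_⟩
  rw [v.isImmediate_apprX_iff] at hI
  rintro ⟨γ, hγ, hfix⟩
  obtain ⟨c₀, d, rfl, hc₀⟩ := AType.exists_of_mem_supp _ hγ
  obtain ⟨c, hc⟩ := Ext.exists_closer hI (c₀ ::ₘ p.roots)
  have hc₀' := (mem_closedAt_apprX v c₀ d).1 hc₀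
  have hcd : v.val (xSub c) < v.val (algebraMap K _ d) := (hc c₀ (by simp)).trans_le hc₀'
  have hroot : p.eval c ≠ 0 := by
    intro h0
    exact lt_irrefl _ (hc c (by simp [hp0, h0]))
  -- Approximation by constants near x does not apply to the small p. It applies to p - p(c), which
  -- has the value of p(c), and yields points c'' with p(c'') of smaller value than p(c).
  set q : K[X] := p - C (p.eval c) with hq
  have hqL : algebraMap K[X] (RatFunc K) q =
      algebraMap K[X] (RatFunc K) p - algebraMap K _ (p.eval c) := by
    rw [hq, map_sub, ← algebraMap_eq, ← IsScalarTower.algebraMap_apply]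
  have hval : v.val (algebraMap K[X] _ q) = v.val (algebraMap K _ (p.eval c)) := by
    rw [hqL, Valuation.map_sub_eq_of_lt_right _ (hp _ hroot)]
  obtain ⟨δ, hδ, H⟩ := Ext.exists_val_sub_eval_lt h hroot hval.ge
  obtain ⟨c', hc'⟩ := h δ hδ
  obtain ⟨c'', hc''⟩ : ∃ c'', v.val (xSub c'') < v.val (algebraMap K _ δ) ∧
      v.val (xSub c'') < v.val (algebraMap K _ d) := by
    rcases le_total (v.val (xSub c)) (v.val (xSub c')) with hle | hle
    · exact ⟨c, hle.trans_lt hc', hcd⟩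
    · exact ⟨c', hc', hle.trans_lt hcd⟩
  have h1 := H c'' hc''.1 v rfl
  have h2 := val_eq_of_sub_lt h1
  rw [← h2, hval, hqL, hq, eval_sub, eval_C, map_sub (algebraMap K (RatFunc K)),
    sub_sub_sub_cancel_right] at h1
  have h3 : v.val (algebraMap K _ (p.eval c'')) < v.val (algebraMap K _ (p.eval c)) := by
    have : algebraMap K (RatFunc K) (p.eval c'') = algebraMap K[X] _ p -
      (algebraMap K[X] _ p - algebraMap K _ (p.eval c'')) := by ring
    rw [this]
    exact (Valuation.map_sub _ _ _).trans_lt (max_lt (hp _ hroot) h1)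
  rw [v.val_lt_iff] at h3
  exact h3.ne (hfix _ ((mem_closedAt_apprX v c'' d).2 hc''.2.le) _
    ((mem_closedAt_apprX v c d).2 hcd.le))

end ImmediateTypes

/-! ### Best approximations at a distance in the value group of K -/

section ResidueTranscendental

variable {K Γ₀ : Type*} [Field K] [LinearOrderedCommGroupWithZero Γ₀] {v₀ : Valuation K Γ₀}

theorem mem_range_of_isAlgebraic {k E : Type*} [Field k] [Field E] [Algebra k E]
    [IsAlgClosed k] {y : E} (hy : IsAlgebraic k y) : y ∈ (algebraMap k E).range :=
  minpoly.mem_range_of_degree_eq_one k y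
    (IsAlgClosed.degree_eq_one_of_irreducible k (minpoly.irreducible hy.isIntegral))

/-- If some c were closer to x than b, then d(x - b) would have the same residue as the constant d(c
- b). -/
theorem Ext.isCenter_of_isResidueTransElem {v : Ext v₀} {b d : K}
    (h : IsResidueTransElem v₀ v.val (dxSub d b)) :
    v.IsCenter b ∧ d ≠ 0 ∧ v.val (xSub b) = v.val (algebraMap K _ d⁻¹) := by
  obtain ⟨h1, hm, htr⟩ := h
  have hd : d ≠ 0 := by
    rintro rfl
    rw [dxSub, map_zero, zero_mul, map_zero] at h1
    exact zero_ne_one h1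
  have hd' := val_pos v ((map_ne_zero (algebraMap K (RatFunc K))).2 hd)
  rw [dxSub, map_mul] at h1
  refine ⟨fun c => ?_, hd, ?_⟩
  · by_contra! hlt
    have h2 : v.val (dxSub d b - algebraMap K _ (d * (c - b))) < 1 := by
      have : dxSub d b - algebraMap K _ (d * (c - b)) = algebraMap K _ d * xSub c := by
        rw [dxSub, xSub, xSub, map_mul, map_sub]; ring
      rw [this, map_mul, ← h1]
      exact mul_lt_mul_of_pos_left hlt hd'
    obtain ⟨ha, h3⟩ := residue_eq_of_sub_lt (v₀ := v₀) (v := v.val) hm h2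
    rw [h3] at htr
    exact htr (isAlgebraic_algebraMap _)
  · rw [map_inv₀, map_inv₀]
    exact eq_inv_of_mul_eq_one_right h1

/-- An algebraic residue would be the residue of some a in K, the residue field of K being
algebraically closed, and then b + da would be closer to x than b. -/
theorem DenseInAlgClosure.isResidueTransElem (hK : DenseInAlgClosure v₀) {v : Ext v₀} {b d : K}
    (hb : v.IsCenter b) (hd : d ≠ 0) (hbd : v.val (xSub b) = v.val (algebraMap K _ d)) :
    IsResidueTransElem v₀ v.val (dxSub d⁻¹ b) := by
  have hd' := val_pos v ((map_ne_zero (algebraMap K (RatFunc K))).2 hd)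
  have h1 : v.val (dxSub d⁻¹ b) = 1 := by
    rw [dxSub, map_mul, hbd, map_inv₀, map_inv₀, inv_mul_cancel₀ hd'.ne']
  refine ⟨h1, h1.le, fun halg => ?_⟩
  have := hK.isAlgClosed_residue
  obtain ⟨y, hy⟩ := mem_range_of_isAlgebraic halg
  obtain ⟨⟨a, ha⟩, rfl⟩ := IsLocalRing.residue_surjective y
  rw [Valuation.HasExtension.algebraMap_residue_eq_residue_algebraMap, ← sub_eq_zero, ← map_sub,
    IsLocalRing.residue_eq_zero_iff, Valuation.mem_maximalIdeal_iff] at hy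
  have h2 : v.val (algebraMap K _ a - dxSub d⁻¹ b) < 1 := hy
  have h3 : algebraMap K _ a - dxSub d⁻¹ b = -(algebraMap K _ d⁻¹ * xSub (b + d * a)) := by
    rw [dxSub, xSub, xSub, map_add, map_mul, map_inv₀]
    have : algebraMap K (RatFunc K) d ≠ 0 := (map_ne_zero _).2 hd
    field_simp
    ring
  rw [h3, Valuation.map_neg, map_mul, map_inv₀, map_inv₀, inv_mul_lt_one₀ hd', ← hbd] at h2
  exact h2.not_ge (hb _)

theorem Ext.IsCenter.exists_val_eq_fiber {v : Ext v₀} {b d : K} (hb : v.IsCenter b)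
    (hbd : v.val (xSub b) = v.val (algebraMap K _ d)) (c : K) : ∃ e : K, ∀ v' : Ext v₀,
      v'.apprX = v.apprX → v'.val (xSub c) = v'.val (algebraMap K _ e) := by
  obtain ⟨e, he⟩ := hb.exists_val_eq hbd c
  refine ⟨e, fun v' hv' => le_antisymm ((Ext.apprX_le_iff hv' c e).2 he.le) ?_⟩
  rw [← not_lt, Ext.apprX_lt_iff hv', he]
  exact lt_irrefl _

theorem DenseInAlgClosure.exists_val_eq (hK : DenseInAlgClosure v₀) {v : Ext v₀} {b d : K}
    (hb : v.IsCenter b) (hd : d ≠ 0) (hbd : v.val (xSub b) = v.val (algebraMap K _ d))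
    (u : RatFunc K) (hu : u ≠ 0) : ∃ a : K, ∀ v' : Ext v₀, v'.apprX = v.apprX →
      v'.val u = v'.val (algebraMap K _ a) := by
  let H : Subgroup (RatFunc K)ˣ :=
    { carrier := {u | ∃ a : K, ∀ v' : Ext v₀, v'.apprX = v.apprX →
        v'.val (u : RatFunc K) = v'.val (algebraMap K _ a)}
      mul_mem' := by
        rintro u w ⟨a, ha⟩ ⟨a', ha'⟩
        refine ⟨a * a', fun v' hv' => ?_⟩
        rw [Units.val_mul, map_mul, map_mul, map_mul, ha v' hv', ha' v' hv']
      one_mem' := ⟨1, fun v' _ => by simp⟩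
      inv_mem' := by
        rintro u ⟨a, ha⟩
        refine ⟨a⁻¹, fun v' hv' => ?_⟩
        rw [Units.val_inv_eq_inv_val, map_inv₀, map_inv₀, map_inv₀, ha v' hv'] }
  have hH : H = ⊤ := by
    refine hK.eq_top_of_linear (v := v) hd (fun c => hbd ▸ hb c) (fun w hw => ?_) ?_ fun c u hu => ?_
    · refine ⟨1, fun v' hv' => ?_⟩
      have h1 := (v.mem_fiberUnits w).1 hw v' hv'
      rw [map_one, map_one]
      rw [← map_one v'.val] at h1
      rw [val_eq_of_sub_lt h1, map_one]
    · rintro _ ⟨a, rfl⟩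
      exact ⟨a, fun v' _ => rfl⟩
    · obtain ⟨e, he⟩ := hb.exists_val_eq_fiber hbd c
      exact ⟨e, fun v' hv' => by rw [hu, he v' hv']⟩
  have : Units.mk0 u hu ∈ H := by rw [hH]; trivial
  exact this

theorem residue_eq_one {L Γ : Type*} [Field L] [LinearOrderedCommGroupWithZero Γ]
    {v : Valuation L Γ} (y : v.valuationSubring) (h : v ((y : L) - 1) < 1) :
    IsLocalRing.residue v.valuationSubring y = 1 := by
  rw [← sub_eq_zero, ← map_one (IsLocalRing.residue v.valuationSubring), ← map_sub,
    IsLocalRing.residue_eq_zero_iff]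
  exact (Valuation.mem_maximalIdeal_iff _ _).2 h

theorem residue_ne_zero_iff {L Γ : Type*} [Field L] [LinearOrderedCommGroupWithZero Γ]
    {v : Valuation L Γ} (y : v.valuationSubring) :
    IsLocalRing.residue v.valuationSubring y ≠ 0 ↔ v (y : L) = 1 := by
  rw [Ne, IsLocalRing.residue_eq_zero_iff, Valuation.mem_maximalIdeal_iff, not_lt]
  exact ⟨fun h => le_antisymm y.2 h, fun h => h.ge⟩

theorem DenseInAlgClosure.isResidueTransExt (hK : DenseInAlgClosure v₀) {v : Ext v₀} {b d : K}
    (hb : v.IsCenter b) (hd : d ≠ 0) (hbd : v.val (xSub b) = v.val (algebraMap K _ d)) :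
    IsResidueTransExt v₀ v.val ∧ v.DeterminedByAppr := by
  have hval := hK.exists_val_eq hb hd hbd
  refine ⟨?_, Ext.determinedByAppr_of_val_eq hK.divisibleValueGroup hval⟩
  obtain ⟨h1, hm, htr⟩ := hK.isResidueTransElem hb hd hbd
  refine isResidueTransExt_of htr (fun u hu => ?_) ?_
  · obtain ⟨a, ha⟩ := hval u hu
    exact ⟨a, ha v rfl⟩
  set τ := IsLocalRing.residue v.val.valuationSubring ⟨dxSub d⁻¹ b, hm⟩ with hτ
  set F := IntermediateField.adjoin (Residue v₀) {τ} with hF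
  have hdL : algebraMap K (RatFunc K) d ≠ 0 := (map_ne_zero _).2 hd
  have hd' := val_pos v hdL
  -- Only elements of value 1 have nonzero residues; allowing a scaling by a constant makes the
  -- condition on residues one that defines a group.
  let H : Subgroup (RatFunc K)ˣ :=
    { carrier := {u | ∃ (a : K) (y : v.val.valuationSubring), a ≠ 0 ∧
        (y : RatFunc K) = u * algebraMap K _ a ∧ v.val (y : RatFunc K) = 1 ∧
          IsLocalRing.residue v.val.valuationSubring y ∈ F}
      mul_mem' := by
        rintro u w ⟨a, y, ha, hy, hy1, hyF⟩ ⟨a', y', ha', hy', hy1', hyF'⟩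
        refine ⟨a * a', y * y', mul_ne_zero ha ha', ?_, ?_, ?_⟩
        · rw [MulMemClass.coe_mul, hy, hy', Units.val_mul, map_mul]; ring
        · rw [MulMemClass.coe_mul, map_mul, hy1, hy1', one_mul]
        · rw [map_mul]; exact mul_mem hyF hyF'
      one_mem' := ⟨1, 1, one_ne_zero, by simp, by simp, by rw [map_one]; exact one_mem _⟩
      inv_mem' := by
        rintro u ⟨a, y, ha, hy, hy1, hyF⟩
        have hz : v.val ((y : RatFunc K)⁻¹) = 1 := by rw [map_inv₀, hy1, inv_one]
        refine ⟨a⁻¹, ⟨(y : RatFunc K)⁻¹, hz.le⟩, inv_ne_zero ha, ?_, hz, ?_⟩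
        · change (y : RatFunc K)⁻¹ = _
          rw [hy, mul_inv, Units.val_inv_eq_inv_val, map_inv₀]
        · have h0 : (y : RatFunc K) ≠ 0 := by
            intro h0
            rw [h0, map_zero] at hy1
            exact zero_ne_one hy1
          have h2 : (⟨(y : RatFunc K)⁻¹, hz.le⟩ : v.val.valuationSubring) * y = 1 :=
            Subtype.ext (inv_mul_cancel₀ h0)
          have h3 := congrArg (IsLocalRing.residue v.val.valuationSubring) h2
          rw [map_mul, map_one] at h3
          rw [eq_inv_of_mul_eq_one_left h3]
          exact inv_mem hyF }
  have hH : H = ⊤ := by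
    refine hK.eq_top_of_linear (v := v) hd (fun c => hbd ▸ hb c) (fun w hw => ?_) ?_ fun c u hu => ?_
    · have h2 := (v.mem_fiberUnits w).1 hw v rfl
      have h3 : v.val (w : RatFunc K) = 1 := by
        rw [← map_one v.val] at h2
        rw [val_eq_of_sub_lt h2, map_one]
      refine ⟨1, ⟨w, h3.le⟩, one_ne_zero, by simp, h3, ?_⟩
      rw [residue_eq_one _ h2]
      exact one_mem _
    · rintro _ ⟨a, rfl⟩
      refine ⟨(a : K)⁻¹, 1, inv_ne_zero a.ne_zero, ?_, by simp, by rw [map_one]; exact one_mem _⟩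
      simp
    -- If c is no farther from b than x is, the residue of (x - c)/d is τ plus a constant; otherwise
    -- (x - c)/(b - c) is a principal unit.
    · rcases le_or_gt (v.val (algebraMap K _ (b - c))) (v.val (algebraMap K _ d)) with h | h
      · have h2 : v.val (xSub c) = v.val (algebraMap K _ d) := by
          refine le_antisymm ?_ (hbd ▸ hb c)
          have : xSub c = xSub b + algebraMap K _ (b - c) := by
            rw [← xSub_sub_xSub]; ring
          rw [this]
          exact v.val.map_add_le hbd.le h
        have h3 : v.val (u * algebraMap K _ d⁻¹) = 1 := by
          rw [hu, map_mul, h2, map_inv₀, map_inv₀, mul_inv_cancel₀ hd'.ne']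
        have h4 : v₀ ((b - c) / d) ≤ 1 := by
          rw [← Valuation.HasExtension.val_map_le_one_iff v₀ v.val, map_div₀, map_div₀,
            div_le_one₀ hd']
          exact h
        refine ⟨d⁻¹, ⟨_, h3.le⟩, inv_ne_zero hd, rfl, h3, ?_⟩
        have h5 : (⟨u * algebraMap K _ d⁻¹, h3.le⟩ : v.val.valuationSubring) =
            ⟨dxSub d⁻¹ b, hm⟩ + algebraMap v₀.valuationSubring v.val.valuationSubring
              ⟨(b - c) / d, h4⟩ := by
          apply Subtype.ext
          change (u : RatFunc K) * algebraMap K _ d⁻¹ =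
            dxSub d⁻¹ b + algebraMap K _ ((b - c) / d)
          rw [hu, dxSub, div_eq_mul_inv, map_mul, ← xSub_sub_xSub]
          ring
        rw [h5, map_add, ← Valuation.HasExtension.algebraMap_residue_eq_residue_algebraMap]
        exact add_mem (IntermediateField.mem_adjoin_simple_self _ _)
          (IntermediateField.algebraMap_mem _ _)
      · have hbc : b - c ≠ 0 := by
          intro h0
          rw [h0, map_zero, map_zero] at h
          exact not_lt_zero h
        have hbcL : algebraMap K (RatFunc K) (b - c) ≠ 0 := (map_ne_zero _).2 hbc
        have h2 : v.val (u * algebraMap K _ (b - c)⁻¹ - 1) < 1 := by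
          have : (u : RatFunc K) * algebraMap K _ (b - c)⁻¹ - 1 =
              xSub b / algebraMap K _ (b - c) := by
            rw [hu, eq_div_iff hbcL, sub_mul, map_inv₀, inv_mul_cancel_right₀ hbcL, one_mul,
              xSub_sub_algebraMap]
          rw [this, map_div₀, div_lt_one₀ (val_pos v hbcL), hbd]
          exact h
        have h3 : v.val (u * algebraMap K _ (b - c)⁻¹) = 1 := by
          rw [← map_one v.val] at h2
          rw [val_eq_of_sub_lt h2, map_one]
        refine ⟨(b - c)⁻¹, ⟨_, h3.le⟩, inv_ne_zero hbc, rfl, h3, ?_⟩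
        rw [residue_eq_one _ h2]
        exact one_mem _
  intro y
  obtain ⟨⟨u, hu⟩, rfl⟩ := IsLocalRing.residue_surjective y
  by_cases hu0 : IsLocalRing.residue v.val.valuationSubring ⟨u, hu⟩ = 0
  · rw [hu0]; exact zero_mem _
  have hu1 := (residue_ne_zero_iff _).1 hu0
  have hune : u ≠ 0 := by
    rintro rfl
    simp at hu1
  have hmem : Units.mk0 u hune ∈ H := by rw [hH]; trivial
  obtain ⟨a, y, ha, hy, hy1, hyF⟩ := hmem
  -- Both u and its multiple y have value 1, so the scaling constant a has a nonzero residue, which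
  -- can be divided out in F.
  have ha1 : v₀ a = 1 := by
    rw [hy, map_mul, Units.val_mk0] at hy1
    rw [← Valuation.HasExtension.val_map_eq_one_iff v₀ v.val]
    have hu1' : v.val u = 1 := hu1
    rwa [hu1', one_mul] at hy1
  set α : v₀.valuationSubring := ⟨a, ha1.le⟩
  have hα : algebraMap (Residue v₀) (Residue v.val) (IsLocalRing.residue _ α) ≠ 0 :=
    (map_ne_zero _).2 ((residue_ne_zero_iff α).2 ha1)
  have hyu : y = ⟨u, hu⟩ * algebraMap v₀.valuationSubring v.val.valuationSubring α :=
    Subtype.ext hy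
  rw [hyu, map_mul, ← Valuation.HasExtension.algebraMap_residue_eq_residue_algebraMap] at hyF
  have := div_mem hyF (F.algebraMap_mem (IsLocalRing.residue _ α))
  rwa [mul_div_cancel_right₀ _ hα] at this

end ResidueTranscendental

/-! ### Classification of extensions by approximation type -/

section Classification

open Polynomial

variable {K Γ₀ : Type*} [Field K] [LinearOrderedCommGroupWithZero Γ₀] {v₀ : Valuation K Γ₀}

/-- The possible kinds of the approximation type of an extension to `K(x)`, and the corresponding
kinds of the extension. -/
theorem DenseInAlgClosure.classification (hK : DenseInAlgClosure v₀) (v : Ext v₀) :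
    ((v.apprX.IsTransImmediate ∧ IsImmediateExt v₀ v.val) ∨
      ((v.apprX.IsAlgImmediate ∧ v.apprX.IsCompletionType) ∧ IsValueTransExt v₀ v.val) ∨
      (v.apprX.IsValueExtending ∧ IsValueTransExt v₀ v.val) ∨
      (v.apprX.IsResidueExtending ∧ IsResidueTransExt v₀ v.val)) ∧ v.DeterminedByAppr := by
  have hdiv := hK.divisibleValueGroup
  rcases v.isImmediate_or_exists_isCenter with hI | ⟨b, hb⟩
  · by_cases hL : v.IsLimit
    · by_cases hP : ∃ p, p ≠ 0 ∧ v.IsSmall p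
      · obtain ⟨h1, h2⟩ := hL.isValueTransExt hdiv hP
        obtain ⟨p, hp0, hp⟩ := hP
        exact ⟨Or.inr (Or.inl ⟨⟨hL.isAlgImmediate_apprX hI hp0 hp, hL.isCompletionType hI⟩, h1⟩), h2⟩
      · push Not at hP
        obtain ⟨h1, h2⟩ := Ext.isImmediateExt_and_determined hdiv (hL.eq_top hP)
        exact ⟨Or.inl ⟨hL.isTransImmediate_apprX hI hP, h1⟩, h2⟩
    · have hT := hK.isTransImmediate_apprX hI hL
      -- Every c admits a closer c', and x - c is then the constant c' - c up to a principal unit.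
      have htop : v.fiberUnits ⊔ constUnits K = ⊤ := by
        rw [v.isImmediate_apprX_iff] at hI
        simp only [Ext.IsLimit, not_forall, not_exists, not_lt] at hL
        obtain ⟨e, he, hL⟩ := hL
        refine hK.eq_top_of_linear he hL le_sup_left le_sup_right fun c u hu => ?_
        obtain ⟨c', hc'⟩ := hI c
        have hval := v.val_xSub_eq hc'
        have h0 : algebraMap K (RatFunc K) (c' - c) ≠ 0 := by
          intro h0
          rw [h0, map_zero] at hval
          exact (val_pos v (xSub_ne_zero c)).ne' hval
        refine Ext.mem_of_val_sub_lt le_sup_left (g := Units.mk0 _ h0)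
          (Subgroup.mem_sup_right (mem_constUnits rfl)) fun v' hv' => ?_
        rw [hu, Units.val_mk0, xSub_sub_algebraMap, Ext.apprX_lt_iff hv', ← hval]
        exact hc'
      obtain ⟨h1, h2⟩ := Ext.isImmediateExt_and_determined hdiv htop
      exact ⟨Or.inl ⟨hT, h1⟩, h2⟩
  · by_cases hd : ∃ d, v.val (xSub b) = v.val (algebraMap K _ d)
    · have hR := v.isResidueExtending_apprX_iff.2 ⟨b, hb, hd⟩
      obtain ⟨d, hd⟩ := hd
      have hd0 : d ≠ 0 := by
        rintro rfl
        rw [map_zero, map_zero] at hd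
        exact (val_pos v (xSub_ne_zero b)).ne' hd
      obtain ⟨h1, h2⟩ := hK.isResidueTransExt hb hd0 hd
      exact ⟨Or.inr (Or.inr (Or.inr ⟨hR, h1⟩)), h2⟩
    · push Not at hd
      have hV := v.isValueExtending_apprX_iff.2 ⟨b, hb, hd⟩
      suffices h : IsValueTransExt v₀ v.val ∧ v.DeterminedByAppr from
        ⟨Or.inr (Or.inr (Or.inl ⟨hV, h.1⟩)), h.2⟩
      by_cases hL : v.IsLimit
      -- The center b is at least as close to x as any c, so for a limit X - b is small.
      · refine hL.isValueTransExt hdiv ⟨X - C b, X_sub_C_ne_zero b, fun η hη => ?_⟩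
        rw [← xSub_eq_algebraMap]
        obtain ⟨c, hc⟩ := hL η hη
        exact (hb c).trans_lt hc
      · exact hK.isValueTransExt hL hd

theorem AType.not_isTransImmediate_and_isAlgImmediate {A : AType v₀} (h : A.IsTransImmediate)
    (h' : A.IsAlgImmediate) : False := by
  obtain ⟨-, f, hf⟩ := h'
  exact hf (h.2 f)

theorem AType.not_isImmediate_and_inter_nonempty {A : AType v₀} (h : A.IsImmediate)
    (h' : A.inter.Nonempty) : False := by
  rw [h.2] at h'
  exact Set.not_nonempty_empty h'

theorem Ext.not_isValueExtending_and_isResidueExtending {v : Ext v₀}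
    (h : v.apprX.IsValueExtending) (h' : v.apprX.IsResidueExtending) : False := by
  rw [v.isValueExtending_apprX_iff] at h
  rw [v.isResidueExtending_apprX_iff] at h'
  obtain ⟨b, hb, h⟩ := h
  obtain ⟨b', hb', d, hd⟩ := h'
  exact h d ((le_antisymm (hb b') (hb' b)).trans hd)

/-- If the value of x - b is not a value of K, then b is a center, since a closer c would give x - b
the value of c - b. Divisibility excludes torsion in the converse. -/
theorem DenseInAlgClosure.exists_isValueTransElem_iff (hK : DenseInAlgClosure v₀) (v : Ext v₀) :
    (∃ b : K, IsValueTransElem K v.val (xSub b)) ↔ v.apprX.IsValueExtending := by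
  rw [v.isValueExtending_apprX_iff]
  constructor
  · rintro ⟨b, -, h⟩
    have h' : ∀ d, v.val (xSub b) ≠ v.val (algebraMap K _ d) := fun d => by
      simpa using h 1 one_pos d
    refine ⟨b, fun c => ?_, h'⟩
    by_contra! hlt
    exact h' _ (v.val_xSub_eq hlt)
  · rintro ⟨b, -, h⟩
    exact ⟨b, xSub_ne_zero b, Ext.val_pow_ne hK.divisibleValueGroup (xSub_ne_zero b) h⟩

theorem DenseInAlgClosure.exists_isResidueTransElem_iff (hK : DenseInAlgClosure v₀) (v : Ext v₀) :
    (∃ b d : K, IsResidueTransElem v₀ v.val (dxSub d b)) ↔ v.apprX.IsResidueExtending := by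
  rw [v.isResidueExtending_apprX_iff]
  constructor
  · rintro ⟨b, d, h⟩
    obtain ⟨hb, -, h⟩ := Ext.isCenter_of_isResidueTransElem h
    exact ⟨b, hb, _, h⟩
  · rintro ⟨b, hb, d, hd⟩
    have hd0 : d ≠ 0 := by
      rintro rfl
      rw [map_zero, map_zero] at hd
      exact (val_pos v (xSub_ne_zero b)).ne' hd
    exact ⟨b, _, hK.isResidueTransElem hb hd0 hd⟩

theorem IsValueTransElem.of_dxSub {v : Ext v₀} {d b : K}
    (h : IsValueTransElem K v.val (dxSub d b)) : IsValueTransElem K v.val (xSub b) := by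
  obtain ⟨h0, h⟩ := h
  refine ⟨xSub_ne_zero b, fun n hn e he => h n hn (d ^ n * e) ?_⟩
  rw [dxSub, map_mul, mul_pow, he, map_mul, map_mul, map_pow, map_pow]

theorem DenseInAlgClosure.isPure_iff (hK : DenseInAlgClosure v₀) (v : Ext v₀) :
    v.IsPure ↔ v.apprX.IsPure := by
  have h1 := hK.exists_isValueTransElem_iff v
  have h2 := hK.exists_isResidueTransElem_iff v
  constructor
  · rintro (⟨b, d, h | h⟩ | h)
    · exact Or.inr (Or.inl (h1.1 ⟨b, h.of_dxSub⟩))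
    · exact Or.inr (Or.inr (h2.1 ⟨b, d, h⟩))
    · exact Or.inl h
  · rintro (h | h | h)
    · exact Or.inr h
    · obtain ⟨b, hb⟩ := h1.2 h
      refine Or.inl ⟨b, 1, Or.inl ?_⟩
      rwa [dxSub, map_one, one_mul]
    · obtain ⟨b, d, hb⟩ := h2.2 h
      exact Or.inl ⟨b, d, Or.inr hb⟩

theorem DenseInAlgClosure.isAlmostPure_apprX (hK : DenseInAlgClosure v₀) (v : Ext v₀) :
    v.apprX.IsAlmostPure := by
  rcases (hK.classification v).1 with h | h | h | h
  · exact Or.inl (Or.inl h.1)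
  · exact Or.inr h.1
  · exact Or.inl (Or.inr (Or.inl h.1))
  · exact Or.inl (Or.inr (Or.inr h.1))

theorem DenseInAlgClosure.isAlmostPure_iff (hK : DenseInAlgClosure v₀) (v : Ext v₀) :
    v.IsAlmostPure ↔ v.apprX.IsAlmostPure :=
  or_congr (hK.isPure_iff v) Iff.rfl

theorem AType.IsImmediate.not_isTrivial {A : AType v₀} (h : A.IsImmediate) : ¬ A.IsTrivial := by
  rintro ⟨c, rfl⟩
  have : c ∈ (appr v₀ v₀ c).inter := by
    intro B hB
    obtain ⟨a, ha⟩ := B.nonempty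
    rcases hk : B.kind with _ | _
    · obtain ⟨d, -, rfl⟩ := B.eq_mkClosed hk ha
      rw [← AType.mem_closedAt, mem_closedAt_appr] at hB
      exact hB
    · obtain ⟨d, hd, -, rfl⟩ := B.eq_mkOpen hk ha
      rw [← AType.mem_openAt, mem_openAt_appr] at hB
      exact hB
  rw [h.2] at this
  exact this

theorem AType.IsAlmostPure.not_isTrivial {A : AType v₀} (h : A.IsAlmostPure) : ¬ A.IsTrivial := by
  rcases h with (h | h | h) | h
  · exact h.1.not_isTrivial
  · exact h.1
  · exact h.1
  · exact h.1.1.not_isTrivial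

/-- All roots r of f lie in K; for c closer to x than all of them, c - r has the value of x - r, so
the value of f(c) is fixed. -/
theorem Ext.not_isAlgImmediate_of_isAlgClosed [IsAlgClosed K] (v : Ext v₀) :
    ¬ v.apprX.IsAlgImmediate := by
  rintro ⟨hI, f, hf⟩
  refine hf ?_
  rw [v.isImmediate_apprX_iff] at hI
  obtain ⟨c₀, hc₀⟩ := Ext.exists_closer hI f.roots
  obtain ⟨d, hd, hcd⟩ := Ext.exists_val_xSub_eq hI c₀
  refine v.fixesValue_apprX (c := c₀) (d := d) hcd.le
    (v.val (algebraMap K _ f.leadingCoeff * (f.roots.map xSub).prod)) fun c hc => ?_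
  have hroot : ∀ r ∈ f.roots, v.val (algebraMap K _ (c - r)) = v.val (xSub r) := by
    intro r hr
    rw [← hcd] at hc
    rw [v.val_xSub_eq (hc.trans_lt (hc₀ r hr))]
  conv_lhs => rw [(IsAlgClosed.splits f).eq_prod_roots]
  rw [eval_mul, eval_C, eval_multiset_prod, map_mul, map_mul, map_mul, map_multiset_prod,
    map_multiset_prod, map_multiset_prod, Multiset.map_map, Multiset.map_map, Multiset.map_map,
    Multiset.map_map]
  congr 2
  refine Multiset.map_congr rfl fun r hr => ?_
  simpa using hroot r hr

theorem DenseInAlgClosure.bijOn_apprX (hK : DenseInAlgClosure v₀) :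
    Set.BijOn (fun v : Ext v₀ => v.apprX) Set.univ {A : AType v₀ | ¬ A.IsTrivial} := by
  refine ⟨fun v _ => v.not_isTrivial_apprX, fun v _ v' _ h => ?_, fun A hA => ?_⟩
  · exact (hK.classification v').2 v h
  · obtain ⟨v, hv⟩ := exists_ext_apprX_eq A hA
    exact ⟨v, trivial, hv⟩

theorem DenseInAlgClosure.bijOn_isAlmostPure (hK : DenseInAlgClosure v₀) :
    Set.BijOn (fun v : Ext v₀ => v.apprX) {v | v.IsAlmostPure} {A : AType v₀ | A.IsAlmostPure} := by
  refine ⟨fun v _ => hK.isAlmostPure_apprX v, fun v _ v' _ h => ?_, fun A hA => ?_⟩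
  · exact (hK.classification v').2 v h
  · obtain ⟨v, rfl⟩ := exists_ext_apprX_eq A (AType.IsAlmostPure.not_isTrivial hA)
    exact ⟨v, (hK.isAlmostPure_iff v).2 hA, rfl⟩

theorem DenseInAlgClosure.bijOn_isPure (hK : DenseInAlgClosure v₀) :
    Set.BijOn (fun v : Ext v₀ => v.apprX) {v | v.IsPure} {A : AType v₀ | A.IsPure} := by
  refine ⟨fun v hv => (hK.isPure_iff v).1 hv, fun v _ v' _ h => ?_, fun A hA => ?_⟩
  · exact (hK.classification v').2 v h
  · obtain ⟨v, rfl⟩ := exists_ext_apprX_eq A (AType.IsAlmostPure.not_isTrivial (Or.inl hA))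
    exact ⟨v, (hK.isPure_iff v).2 hA, rfl⟩

theorem DenseInAlgClosure.threeExclusiveCases (hK : DenseInAlgClosure v₀) (v : Ext v₀) :
    v.ThreeExclusiveCases := by
  refine ⟨?_, not_immediate_and_valueTrans, not_immediate_and_residueTrans,
    not_valueTrans_and_residueTrans⟩
  rcases (hK.classification v).1 with h | h | h | h
  · exact Or.inl h.2
  · exact Or.inr (Or.inl h.2)
  · exact Or.inr (Or.inl h.2)
  · exact Or.inr (Or.inr h.2)

/-- The kind of an extension corresponds to the kind of its approximation type. -/
theorem DenseInAlgClosure.kind_iff (hK : DenseInAlgClosure v₀) (v : Ext v₀) :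
    (IsImmediateExt v₀ v.val ↔ v.apprX.IsTransImmediate) ∧
      (IsValueTransExt v₀ v.val ↔ v.apprX.IsValueExtending ∨ v.apprX.IsAlgImmediate) ∧
      (IsResidueTransExt v₀ v.val ↔ v.apprX.IsResidueExtending) := by
  obtain ⟨-, e1, e2, e3⟩ := hK.threeExclusiveCases v
  have a1 : v.apprX.IsTransImmediate → v.apprX.IsAlgImmediate → False :=
    AType.not_isTransImmediate_and_isAlgImmediate
  have a2 : v.apprX.IsTransImmediate → v.apprX.IsValueExtending → False := fun h h' =>
    AType.not_isImmediate_and_inter_nonempty h.1 h'.2.2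
  have a3 : v.apprX.IsTransImmediate → v.apprX.IsResidueExtending → False := fun h h' =>
    AType.not_isImmediate_and_inter_nonempty h.1 h'.2.2
  have a5 : v.apprX.IsAlgImmediate → v.apprX.IsResidueExtending → False := fun h h' =>
    AType.not_isImmediate_and_inter_nonempty h.1 h'.2.2
  have a6 : v.apprX.IsValueExtending → v.apprX.IsResidueExtending → False :=
    Ext.not_isValueExtending_and_isResidueExtending
  rcases (hK.classification v).1 with ⟨h, h'⟩ | ⟨⟨h, -⟩, h'⟩ | ⟨h, h'⟩ | ⟨h, h'⟩
  · exact ⟨iff_of_true h' h,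
      iff_of_false (fun g => e1 ⟨h', g⟩) fun g => g.elim (a2 h) (a1 h),
      iff_of_false (fun g => e2 ⟨h', g⟩) (a3 h)⟩
  · exact ⟨iff_of_false (fun g => e1 ⟨g, h'⟩) fun g => a1 g h, iff_of_true h' (Or.inr h),
      iff_of_false (fun g => e3 ⟨h', g⟩) (a5 h)⟩
  · exact ⟨iff_of_false (fun g => e1 ⟨g, h'⟩) fun g => a2 g h, iff_of_true h' (Or.inl h),
      iff_of_false (fun g => e3 ⟨h', g⟩) (a6 h)⟩
  · exact ⟨iff_of_false (fun g => e2 ⟨g, h'⟩) fun g => a3 g h,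
      iff_of_false (fun g => e3 ⟨g, h'⟩) fun g => g.elim (fun g => a6 g h) fun g => a5 g h,
      iff_of_true h' h⟩

end Classification
end ApproxType

/-! ### The theorem -/

open ApproxType in
theorem theorem5p9 {K Γ₀ : Type*} [Field K] [LinearOrderedCommGroupWithZero Γ₀]
    (v₀ : Valuation K Γ₀) :
    -- the map `v ↦ appr_v(x, K)` is a bijection onto the non-trivial approximation types
    (IsAlgClosed K ∨ DenseInAlgClosure v₀ →
      Set.BijOn (fun v : Ext v₀ => v.apprX) Set.univ {A : AType v₀ | ¬ A.IsTrivial}) ∧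
    -- the case of an algebraically closed field
    (IsAlgClosed K →
      DivisibleValueGroup v₀ ∧
      (∀ v : Ext v₀, v.IsPure) ∧
      (∀ v : Ext v₀, v.ThreeExclusiveCases ∧
        -- immediate
        ((IsImmediateExt v₀ v.val ↔ v.apprX.IsImmediate) ∧
          (IsImmediateExt v₀ v.val → v.DeterminedByAppr)) ∧
        -- value-transcendental
        ((IsValueTransExt v₀ v.val ↔ ∃ b : K, IsValueTransElem K v.val (xSub b)) ∧
          ((∃ b : K, IsValueTransElem K v.val (xSub b)) ↔ v.apprX.IsValueExtending) ∧
          (IsValueTransExt v₀ v.val → v.DeterminedByAppr)) ∧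
        -- residue-transcendental
        ((IsResidueTransExt v₀ v.val ↔ ∃ b d : K, IsResidueTransElem v₀ v.val (dxSub d b)) ∧
          ((∃ b d : K, IsResidueTransElem v₀ v.val (dxSub d b)) ↔
            v.apprX.IsResidueExtending) ∧
          (IsResidueTransExt v₀ v.val → v.DeterminedByAppr))) ∧
      Set.BijOn (fun v : Ext v₀ => v.apprX) {v | v.IsPure} {A : AType v₀ | A.IsPure}) ∧
    -- the case of a field that is dense in its algebraic closure
    (DenseInAlgClosure v₀ →
      DivisibleValueGroup v₀ ∧
      (∀ v : Ext v₀, v.IsAlmostPure) ∧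
      (∀ v : Ext v₀, v.ThreeExclusiveCases ∧
        -- immediate
        ((IsImmediateExt v₀ v.val ↔ v.apprX.IsTransImmediate) ∧
          (v.apprX.IsAlgImmediate → IsValueTransExt v₀ v.val)) ∧
        -- value-transcendental
        ((v.IsPure → (IsValueTransExt v₀ v.val ↔ ∃ b : K, IsValueTransElem K v.val (xSub b))) ∧
          (IsValueTransExt v₀ v.val ↔
            (∃ b : K, IsValueTransElem K v.val (xSub b)) ∨ v.apprX.IsAlgImmediate) ∧
          ((∃ b : K, IsValueTransElem K v.val (xSub b)) ↔ v.apprX.IsValueExtending) ∧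
          (IsValueTransExt v₀ v.val → v.DeterminedByAppr)) ∧
        -- residue-transcendental
        ((IsResidueTransExt v₀ v.val ↔ ∃ b d : K, IsResidueTransElem v₀ v.val (dxSub d b)) ∧
          ((∃ b d : K, IsResidueTransElem v₀ v.val (dxSub d b)) ↔
            v.apprX.IsResidueExtending) ∧
          (IsResidueTransExt v₀ v.val → v.DeterminedByAppr))) ∧
      Set.BijOn (fun v : Ext v₀ => v.apprX) {v | v.IsAlmostPure}
        {A : AType v₀ | A.IsAlmostPure}) := by
  have hdense : IsAlgClosed K → DenseInAlgClosure v₀ := fun _ =>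
    denseInAlgClosure_of_isAlgClosed v₀
  refine ⟨fun h => (h.elim hdense id).bijOn_apprX, fun hac => ?_, fun hK => ?_⟩
  · have hK := hdense hac
    have hpure : ∀ v : Ext v₀, v.IsPure := fun v => by
      rcases (hK.isAlmostPure_iff v).2 (hK.isAlmostPure_apprX v) with h | h
      · exact h
      · exact (Ext.not_isAlgImmediate_of_isAlgClosed v h.1).elim
    refine ⟨hK.divisibleValueGroup, hpure, fun v => ?_, hK.bijOn_isPure⟩
    have hdet := (hK.classification v).2
    have hval := hK.exists_isValueTransElem_iff v
    have hres := hK.exists_isResidueTransElem_iff v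
    have hna := Ext.not_isAlgImmediate_of_isAlgClosed v
    obtain ⟨k1, k2, k3⟩ := hK.kind_iff v
    have himm : v.apprX.IsImmediate ↔ v.apprX.IsTransImmediate := by
      refine ⟨fun h => ⟨h, fun f => ?_⟩, fun h => h.1⟩
      by_contra hf
      exact hna ⟨h, f, hf⟩
    refine ⟨hK.threeExclusiveCases v, ⟨k1.trans himm.symm, fun _ => hdet⟩,
      ⟨?_, hval, fun _ => hdet⟩, k3.trans hres.symm, hres, fun _ => hdet⟩
    rw [k2, hval, or_iff_left hna]
  · refine ⟨hK.divisibleValueGroup,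
      fun v => (hK.isAlmostPure_iff v).2 (hK.isAlmostPure_apprX v), fun v => ?_,
      hK.bijOn_isAlmostPure⟩
    have hdet := (hK.classification v).2
    have hval := hK.exists_isValueTransElem_iff v
    have hres := hK.exists_isResidueTransElem_iff v
    obtain ⟨k1, k2, k3⟩ := hK.kind_iff v
    refine ⟨hK.threeExclusiveCases v, ⟨k1, fun h => k2.2 (Or.inr h)⟩,
      ⟨fun hp => ?_, ?_, hval, fun _ => hdet⟩, k3.trans hres.symm, hres, fun _ => hdet⟩
    · rw [k2, hval, or_iff_left]
      intro ha
      rcases (hK.isPure_iff v).1 hp with h | h | h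
      · exact AType.not_isTransImmediate_and_isAlgImmediate h ha
      · exact AType.not_isImmediate_and_inter_nonempty ha.1 h.2.2
      · exact AType.not_isImmediate_and_inter_nonempty ha.1 h.2.2
    · rw [k2, hval]
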